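/- Let $U\subset\mathbb R^n$ be an open set that is star-shaped with respect to one of its points (a coordinate neighbourhood; every point of a manifold has arbitrarily small ones), with coordinates $u^1,\dots,u^n$. Let $$\hat{\mathcal A}=C^\infty(U)[u^{i,s+1},\theta_i^s\mid 1\le i\le n,\ s\ge 0]$$ be the algebra of differential polynomials, with even variables $u^{i,s}$ ($u^{i,0}=u^i$) and anticommuting odd variables $\theta_i^s$ ($\theta_i^0=\theta_i$), bigraded by $\deg_x u^{i,s}=\deg_x\theta_i^s=s$, $\deg_\theta u^{i,s}=0$, $\deg_\theta\theta_i^s=1$; $\hat{\mathcal A}^p_d$ is the part with $\deg_\theta=p$, $\deg_x=d$. Let $\partial_x=\sum_{i,s\ge0}u^{i,s+1}\frac{\partial}{\partial u^{i,s}}+\theta_i^{s+1}\frac{\partial}{\partial\theta_i^s}$ and $\hat{\mathcal F}=\hat{\mathcal A}/\partial_x\hat{\mathcal A}$, graded accordingly, with classes denoted by $\int f$. For $F=\int f$ put $\frac{\delta F}{\delta u^i}=\sum_s(-\partial_x)^s\frac{\partial f}{\partial u^{i,s}}$ and $\frac{\delta F}{\delta\theta_i}=\sum_s(-\partial_x)^s\frac{\partial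 f}{\partial\theta_i^s}$ (left derivatives), and for $P\in\hat{\mathcal F}^p$, $Q\in\hat{\mathcal F}^q$ $$[P,Q]=\int\sum_i\Big(\frac{\delta P}{\delta\theta_i}\frac{\delta Q}{\delta u^i}+(-1)^p\frac{\delta P}{\delta u^i}\frac{\delta Q}{\delta\theta_i}\Big).$$ Let $P\in\hat{\mathcal F}^2_1$ be a (nondegenerate) Hamiltonian structure of hydrodynamic type: $[P,P]=0$ and $$P=\frac12\int\sum_{i,j} g^{ij}(u)\theta_i\theta_j^1+\sum_{i,j,k}\Gamma^{ij}_k(u)u^{k,1}\theta_i\theta_j$$ with smooth $g^{ij}=g^{ji}$, $\Gamma^{ij}_k$ on $U$ and $\det(g^{ij}(u))\ne0$ for all $u\in U$. Put $$D_P=\sum_{i,s}\partial_x^s\Big(\frac{\delta P}{\delta\theta_i}\Big)\frac{\partial}{\partial u^{i,s}}+\partial_x^s\Big(\frac{\delta P}{\delta u^i}\Big)\frac{\partial}{\partial\theta_i^s}.$$ Let $\Omega$ be the free left $\hat{\mathcal A}$-module with basis $\delta u^{i,s},\delta\theta_i^s$ ($1\le i\le n$, $s\ge0$), and let $\Omega^p_d$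 be the space of all $\sum_{i,s} g_{i,s}\delta u^{i,s}+h^i_s\delta\theta_i^s$ with $g_{i,s}\in\hat{\mathcal A}^p_{d-s}$, $h^i_s\in\hat{\mathcal A}^{p-1}_{d-s}$. Let $\delta f=\sum_{i,s}\frac{\partial f}{\partial u^{i,s}}\,\delta u^{i,s}+(-1)^{p-1}\frac{\partial f}{\partial\theta_i^s}\,\delta\theta_i^s$ for $f\in\hat{\mathcal A}^p$. A derivation $X$ of super degree $q$ acts on $\Omega$ by the Lie derivative $$\mathcal L_X\Big(\sum_{i,s} g_{i,s}\delta u^{i,s}+h^i_s\delta\theta_i^s\Big)=\sum_{i,s}X(g_{i,s})\delta u^{i,s}+(-1)^{pq}g_{i,s}\,\delta(X(u^{i,s}))+X(h^i_s)\delta\theta_i^s+(-1)^{(p-1)q}h^i_s\,\delta(X(\theta_i^s))$$ for $g_{i,s}\in\hat{\mathcal A}^p$, $h^i_s\in\hat{\mathcal A}^{p-1}$. Write $\partial_x$ also for $\mathcal L_{\partial_x}$ on $\Omega$, let $\bar\Omega=\Omega/\partial_x\Omega$ with $\bar\Omega^p_d$ the image of $\Omega^p_d$, and let $\tilde D_P$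 be the operator $\mathcal L_{D_P}$ on $\Omega$ and the operator it induces on $\bar\Omega$ (here $q=1$). Put $$H^p_d(\Omega,\tilde D_P)=\frac{\Omega^p_d\cap\ker\tilde D_P}{\Omega^p_d\cap\operatorname{im}\tilde D_P},\qquad H^p_d(\bar\Omega,\tilde D_P)=\frac{\bar\Omega^p_d\cap\ker\tilde D_P}{\bar\Omega^p_d\cap\operatorname{im}\tilde D_P}.$$ Theorem (triviality of the variational Hamiltonian cohomology) and Corollary. For all $p>0$ and $d>0$, $$H^p_d(\Omega,\tilde D_P)=0\qquad\text{and}\qquad H^p_d(\bar\Omega,\tilde D_P)=0.$$ -/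

import Mathlib

open scoped ContDiff TensorProduct

noncomputable section
namespace VarHam
variable {n : ℕ}

theorem extend_val (U : TopologicalSpace.Opens (Fin n → ℝ)) (f : U → ℝ) {x : Fin n → ℝ}
    (hx : x ∈ U) : Function.extend Subtype.val f 0 x = f ⟨x, hx⟩ :=
  Subtype.val_injective.extend_apply f 0 ⟨x, hx⟩

/-- The algebra `C^∞(U)` of smooth real functions on an open subset `U` of `ℝⁿ`. A function on `U`
is extended by zero only in order to speak of its derivatives at the points of `U`. -/
def SmoothFun (U : TopologicalSpace.Opens (Fin n → ℝ)) : Subalgebra ℝ (U → ℝ) where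
  carrier := {f | ContDiffOn ℝ ∞ (Function.extend Subtype.val f 0) (U : Set (Fin n → ℝ))}
  mul_mem' {f g} hf hg := (hf.mul hg).congr fun x hx => by
    simp only [Pi.mul_apply, extend_val U _ hx]
  add_mem' {f g} hf hg := (hf.add hg).congr fun x hx => by
    simp only [Pi.add_apply, extend_val U _ hx]
  algebraMap_mem' c := (contDiffOn_const (c := c)).congr fun x hx => by
    rw [extend_val U _ hx]; rfl

variable (U : TopologicalSpace.Opens (Fin n → ℝ))

/-- The coordinate function `u^i`. -/
def coordFun (i : Fin n) : SmoothFun U :=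
  ⟨fun x => x.1 i, ((contDiff_apply ℝ ℝ i).contDiffOn (s := (U : Set (Fin n → ℝ)))).congr
    fun x hx => by rw [extend_val U _ hx]⟩

/-- The partial derivative of a smooth function, evaluated pointwise. -/
def partialFun (i : Fin n) (f : U → ℝ) : U → ℝ := fun x =>
  fderiv ℝ (Function.extend Subtype.val f 0) x.1 (Pi.single i 1)

theorem smoothFun_differentiableAt (f : SmoothFun U) (x : U) :
    DifferentiableAt ℝ (Function.extend Subtype.val f.1 0) x.1 :=
  (ContDiffOn.contDiffAt f.2 (U.isOpen.mem_nhds x.2)).differentiableAt (by simp)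

theorem partialFun_mem (i : Fin n) (f : SmoothFun U) : partialFun U i f.1 ∈ SmoothFun U := by
  have h : ContDiffOn ℝ ∞ (fun x => fderiv ℝ (Function.extend Subtype.val f.1 0) x
      (Pi.single i (1 : ℝ))) (U : Set (Fin n → ℝ)) :=
    (ContDiffOn.fderiv_of_isOpen (m := ∞) f.2 U.isOpen (by simp)).clm_apply contDiffOn_const
  exact h.congr fun x hx => by rw [extend_val U _ hx]; rfl

theorem fderiv_extend_congr {f : U → ℝ} {F : (Fin n → ℝ) → ℝ} (h : ∀ x : U, f x = F x.1) (x : U) :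
    fderiv ℝ (Function.extend Subtype.val f 0) x.1 = fderiv ℝ F x.1 := by
  apply Filter.EventuallyEq.fderiv_eq
  filter_upwards [U.isOpen.mem_nhds x.2] with y hy
  rw [extend_val U _ hy, h]

/-- The derivation `∂/∂u^i` of `C^∞(U)`. -/
def coordPartial (i : Fin n) : Derivation ℝ (SmoothFun U) (SmoothFun U) :=
  Derivation.mk'
    { toFun := fun f => ⟨partialFun U i f.1, partialFun_mem U i f⟩
      map_add' := fun f g => by
        ext x
        have h := fderiv_extend_congr U (f := (f + g).1)
          (F := Function.extend Subtype.val f.1 0 + Function.extend Subtype.val g.1 0)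
          (fun x => by simp) x
        have := fderiv_add (smoothFun_differentiableAt U f x) (smoothFun_differentiableAt U g x)
        change partialFun U i (f + g).1 x = partialFun U i f.1 x + partialFun U i g.1 x
        unfold partialFun
        rw [h, this]; rfl
      map_smul' := fun c f => by
        ext x
        have h := fderiv_extend_congr U (f := (c • f).1)
          (F := c • Function.extend Subtype.val f.1 0)
          (fun x => by simp) x
        have := fderiv_const_smul (smoothFun_differentiableAt U f x) c
        change fderiv ℝ _ _ _ = c * fderiv ℝ _ _ _
        rw [h, this]; rfl }
    (fun f g => by
      ext x
      have h := fderiv_extend_congr U (f := (f * g).1)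
        (F := Function.extend Subtype.val f.1 0 * Function.extend Subtype.val g.1 0)
        (fun x => by simp) x
      have := fderiv_mul (smoothFun_differentiableAt U f x) (smoothFun_differentiableAt U g x)
      change fderiv ℝ _ _ _ = f.1 x * fderiv ℝ _ _ _ + g.1 x * fderiv ℝ _ _ _
      rw [h, this]
      simp)

theorem coordPartial_comm (i j : Fin n) (f : SmoothFun U) :
    coordPartial U i (coordPartial U j f) = coordPartial U j (coordPartial U i f) := by
  have key : ∀ (i j : Fin n) (x : U), (coordPartial U i (coordPartial U j f)).1 x =
      fderiv ℝ (fderiv ℝ (Function.extend Subtype.val f.1 0)) x.1 (Pi.single i 1)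
        (Pi.single j 1) := by
    intro i j x
    have h := fderiv_extend_congr U (f := (coordPartial U j f).1)
      (F := fun y => fderiv ℝ (Function.extend Subtype.val f.1 0) y (Pi.single j 1))
      (fun x => rfl) x
    change fderiv ℝ _ _ _ = _
    rw [h]
    have hd : DifferentiableAt ℝ (fderiv ℝ (Function.extend Subtype.val f.1 0)) x.1 :=
      ((ContDiffOn.fderiv_of_isOpen (m := ∞) f.2 U.isOpen (by simp)).contDiffAt
        (U.isOpen.mem_nhds x.2)).differentiableAt (by simp)
    rw [fderiv_clm_apply hd (by fun_prop)]
    simp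
  ext x
  rw [key, key]
  have hs : IsSymmSndFDerivAt ℝ (Function.extend Subtype.val f.1 0) x.1 :=
    (ContDiffOn.contDiffAt f.2 (U.isOpen.mem_nhds x.2)).isSymmSndFDerivAt (by
      rw [minSmoothness_of_isRCLikeNormedField]; exact WithTop.coe_le_coe.2 le_top)
  exact hs _ _

/-- The index `(i, s)` of a jet variable: `u^{i,s}` or `θ_i^s`. -/
abbrev JetIdx (n : ℕ) : Type := Fin n × ℕ


/-- The even differential polynomials `C^∞(U)[u^{i,s+1} | s ≥ 0]`, written as
`C^∞(U) ⊗ ℝ[u^{i,s+1}]`; the polynomial variable with index `(i, s)` is `u^{i,s+1}`. -/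
def EvenJet : Type := SmoothFun U ⊗[ℝ] MvPolynomial (JetIdx n) ℝ

instance : CommRing (EvenJet U) :=
  inferInstanceAs (CommRing (SmoothFun U ⊗[ℝ] MvPolynomial (JetIdx n) ℝ))
instance : Algebra ℝ (EvenJet U) :=
  inferInstanceAs (Algebra ℝ (SmoothFun U ⊗[ℝ] MvPolynomial (JetIdx n) ℝ))

/-- The exterior algebra on the odd variables `θ_i^s`, `s ≥ 0`. -/
abbrev OddJet (n : ℕ) : Type := ExteriorAlgebra ℝ (JetIdx n →₀ ℝ)

/-- The superalgebra of differential polynomials `C^∞(U)[u^{i,s+1}, θ_i^s | s ≥ 0]`. Since the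
even variables commute with everything, it is the ordinary tensor product of algebras. -/
def DiffPoly : Type := EvenJet U ⊗[ℝ] OddJet n

instance : Ring (DiffPoly U) := inferInstanceAs (Ring (EvenJet U ⊗[ℝ] OddJet n))
instance : Algebra ℝ (DiffPoly U) := inferInstanceAs (Algebra ℝ (EvenJet U ⊗[ℝ] OddJet n))

variable {U} in
/-- The product `f p` of a function `f` of `u` and a polynomial `p` in the `u^{i,s+1}`. -/
def evenTmul (f : SmoothFun U) (p : MvPolynomial (JetIdx n) ℝ) : EvenJet U := f ⊗ₜ[ℝ] p

variable {U} in
/-- The product `a e` of an even polynomial `a` and a polynomial `e` in the `θ_i^s`. -/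
def jetTmul (a : EvenJet U) (e : OddJet n) : DiffPoly U := a ⊗ₜ[ℝ] e

variable {U} in
theorem evenJet_induction {C : EvenJet U → Prop} (a : EvenJet U) (zero : C 0)
    (add : ∀ x y, C x → C y → C (x + y)) (tmul : ∀ f p, C (evenTmul f p)) : C a :=
  TensorProduct.induction_on (motive := C) a zero tmul add

variable {U} in
theorem diffPoly_induction {C : DiffPoly U → Prop} (a : DiffPoly U) (zero : C 0)
    (add : ∀ x y, C x → C y → C (x + y)) (tmul : ∀ f p, C (jetTmul f p)) : C a :=
  TensorProduct.induction_on (motive := C) a zero tmul add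

theorem evenTmul_mul (f g : SmoothFun U) (p q : MvPolynomial (JetIdx n) ℝ) :
    evenTmul f p * evenTmul g q = evenTmul (f * g) (p * q) :=
  Algebra.TensorProduct.tmul_mul_tmul f g p q

theorem jetTmul_mul (a b : EvenJet U) (e k : OddJet n) :
    jetTmul a e * jetTmul b k = jetTmul (a * b) (e * k) :=
  Algebra.TensorProduct.tmul_mul_tmul a b e k

theorem jetTmul_add (a : EvenJet U) (e k : OddJet n) :
    jetTmul a (e + k) = jetTmul a e + jetTmul a k := TensorProduct.tmul_add _ _ _

theorem add_jetTmul (a b : EvenJet U) (e : OddJet n) :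
    jetTmul (a + b) e = jetTmul a e + jetTmul b e := TensorProduct.add_tmul _ _ _

theorem jetTmul_zero (a : EvenJet U) : jetTmul a 0 = 0 := TensorProduct.tmul_zero _ _

theorem jetTmul_neg (a : EvenJet U) (e : OddJet n) :
    jetTmul a (-e) = - jetTmul a e :=
  eq_neg_of_add_eq_zero_left (by rw [← jetTmul_add, neg_add_cancel, jetTmul_zero])

theorem zero_jetTmul (e : OddJet n) : jetTmul (0 : EvenJet U) e = 0 := TensorProduct.zero_tmul _ _

theorem evenTmul_add (f : SmoothFun U) (p q : MvPolynomial (JetIdx n) ℝ) :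
    evenTmul f (p + q) = evenTmul f p + evenTmul f q := TensorProduct.tmul_add _ _ _

theorem add_evenTmul (f g : SmoothFun U) (p : MvPolynomial (JetIdx n) ℝ) :
    evenTmul (f + g) p = evenTmul f p + evenTmul g p := TensorProduct.add_tmul _ _ _

theorem evenTmul_zero (f : SmoothFun U) : evenTmul f 0 = 0 := TensorProduct.tmul_zero _ _

theorem zero_evenTmul (p : MvPolynomial (JetIdx n) ℝ) : evenTmul (0 : SmoothFun U) p = 0 :=
  TensorProduct.zero_tmul _ _

theorem evenTmul_one : evenTmul (1 : SmoothFun U) 1 = 1 := rfl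

theorem jetTmul_one : jetTmul (1 : EvenJet U) 1 = 1 := rfl

/-- A smooth function as a differential polynomial. -/
def ofFun (f : SmoothFun U) : DiffPoly U := jetTmul (evenTmul f 1) 1

/-- The even jet variables `u^{i,s}`; `u^{i,0}` is the coordinate function `u^i`. -/
def jetU : JetIdx n → DiffPoly U
  | (i, 0) => ofFun U (coordFun U i)
  | (i, s + 1) => jetTmul (evenTmul 1 (MvPolynomial.X (i, s))) 1

/-- The odd jet variables `θ_i^s`. -/
def jetTh (j : JetIdx n) : DiffPoly U :=
  jetTmul 1 (ExteriorAlgebra.ι ℝ (Finsupp.single j 1))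

/-- The partial derivative `∂/∂u^{i,s}` on the even part. -/
def evenPartial : JetIdx n → EvenJet U →ₗ[ℝ] EvenJet U
  | (i, 0) => LinearMap.rTensor _ (coordPartial U i).toLinearMap
  | (i, s + 1) => LinearMap.lTensor _ (MvPolynomial.pderiv (i, s)).toLinearMap

/-- The partial derivative `∂/∂u^{i,s}`. -/
def dU (j : JetIdx n) : DiffPoly U →ₗ[ℝ] DiffPoly U := LinearMap.rTensor _ (evenPartial U j)

/-- The left partial derivative `∂/∂θ_i^s`. -/
def dTh (j : JetIdx n) : DiffPoly U →ₗ[ℝ] DiffPoly U :=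
  LinearMap.lTensor _ (CliffordAlgebra.contractLeft (Finsupp.lapply j))

/-- The parity automorphism `f ↦ (-1)^p f` for `f` of super degree `p`. -/
def parity : DiffPoly U →ₐ[ℝ] DiffPoly U :=
  Algebra.TensorProduct.map (AlgHom.id ℝ (EvenJet U)) CliffordAlgebra.involute

theorem evenPartial_zero_tmul (i : Fin n) (f : SmoothFun U) (p : MvPolynomial (JetIdx n) ℝ) :
    evenPartial U (i, 0) (evenTmul f p) = evenTmul (coordPartial U i f) p := rfl

theorem evenPartial_succ_tmul (i : Fin n) (s : ℕ) (f : SmoothFun U)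
    (p : MvPolynomial (JetIdx n) ℝ) :
    evenPartial U (i, s + 1) (evenTmul f p) = evenTmul f (MvPolynomial.pderiv (i, s) p) := rfl

theorem evenPartial_mul (j : JetIdx n) (a b : EvenJet U) :
    evenPartial U j (a * b) = evenPartial U j a * b + a * evenPartial U j b := by
  induction a using evenJet_induction with
  | zero => simp
  | add x y hx hy => simp only [add_mul, map_add, hx, hy]; abel
  | tmul f p =>
    induction b using evenJet_induction with
    | zero => simp
    | add x y hx hy => simp only [mul_add, map_add, hx, hy]; abel
    | tmul g q =>
      obtain ⟨i, _ | s⟩ := j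
      · simp only [evenTmul_mul, evenPartial_zero_tmul, Derivation.leibniz, smul_eq_mul,
          add_evenTmul]
        rw [add_comm, mul_comm g]
      · simp only [evenTmul_mul, evenPartial_succ_tmul, Derivation.leibniz, smul_eq_mul,
          evenTmul_add]
        rw [add_comm, mul_comm q]

theorem pderiv_pderiv_swap {σ : Type*} (j k : σ) (p : MvPolynomial σ ℝ) :
    MvPolynomial.pderiv j (MvPolynomial.pderiv k p) =
      MvPolynomial.pderiv k (MvPolynomial.pderiv j p) := by
  classical
  have h : ⁅MvPolynomial.pderiv (R := ℝ) j, MvPolynomial.pderiv (R := ℝ) k⁆ = 0 :=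
    MvPolynomial.derivation_ext fun i => by
      simp only [Derivation.commutator_apply, MvPolynomial.pderiv_X, Derivation.zero_apply,
        Pi.single_apply]
      split_ifs <;> simp
  have h2 := congrArg (fun D => D p) h
  simpa [Derivation.commutator_apply, sub_eq_zero] using h2

theorem evenPartial_comm (j k : JetIdx n) (a : EvenJet U) :
    evenPartial U j (evenPartial U k a) = evenPartial U k (evenPartial U j a) := by
  induction a using evenJet_induction with
  | zero => simp
  | add x y hx hy => simp only [map_add, hx, hy]
  | tmul f p =>
    obtain ⟨i, _ | s⟩ := j <;> obtain ⟨l, _ | t⟩ := k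
    · simp only [evenPartial_zero_tmul, coordPartial_comm U i l]
    · simp only [evenPartial_zero_tmul, evenPartial_succ_tmul]
    · simp only [evenPartial_zero_tmul, evenPartial_succ_tmul]
    · simp only [evenPartial_succ_tmul, pderiv_pderiv_swap (i, s) (l, t) p]

theorem dU_tmul (j : JetIdx n) (a : EvenJet U) (e : OddJet n) :
    dU U j (jetTmul a e) = jetTmul (evenPartial U j a) e := rfl

theorem dTh_tmul (j : JetIdx n) (a : EvenJet U) (e : OddJet n) :
    dTh U j (jetTmul a e) = jetTmul a (CliffordAlgebra.contractLeft (Finsupp.lapply j) e) := rfl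

theorem parity_tmul (a : EvenJet U) (e : OddJet n) :
    parity U (jetTmul a e) = jetTmul a (CliffordAlgebra.involute e) := rfl

theorem parity_parity (a : DiffPoly U) : parity U (parity U a) = a := by
  induction a using diffPoly_induction with
  | zero => simp
  | add x y hx hy => simp only [map_add, hx, hy]
  | tmul f p => rw [parity_tmul, parity_tmul, CliffordAlgebra.involute_involute]

theorem dU_mul (j : JetIdx n) (a b : DiffPoly U) :
    dU U j (a * b) = dU U j a * b + a * dU U j b := by
  induction a using diffPoly_induction with
  | zero => simp
  | add x y hx hy => simp only [add_mul, map_add, hx, hy]; abel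
  | tmul f p =>
    induction b using diffPoly_induction with
    | zero => simp
    | add x y hx hy => simp only [mul_add, map_add, hx, hy]; abel
    | tmul g q =>
      simp only [dU_tmul, jetTmul_mul, evenPartial_mul,
        add_jetTmul]

theorem contractLeft_mul {M : Type*} [AddCommGroup M] [Module ℝ M] (d : Module.Dual ℝ M)
    (x y : ExteriorAlgebra ℝ M) :
    CliffordAlgebra.contractLeft d (x * y) = CliffordAlgebra.contractLeft d x * y +
      CliffordAlgebra.involute x * CliffordAlgebra.contractLeft d y := by
  induction x using CliffordAlgebra.left_induction with
  | algebraMap r => simp [CliffordAlgebra.contractLeft_algebraMap_mul]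
  | add x y hx hy => simp only [add_mul, map_add, hx, hy]; abel
  | ι_mul x m hx =>
    simp only [mul_assoc, CliffordAlgebra.contractLeft_ι_mul, hx, map_mul,
      CliffordAlgebra.involute_ι, sub_mul, mul_add, neg_mul, smul_mul_assoc]
    abel

theorem ι_mul_eq {M : Type*} [AddCommGroup M] [Module ℝ M] (m : M) (x : ExteriorAlgebra ℝ M) :
    ExteriorAlgebra.ι ℝ m * x = CliffordAlgebra.involute x * ExteriorAlgebra.ι ℝ m := by
  induction x using CliffordAlgebra.left_induction with
  | algebraMap r => simp [Algebra.commutes]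
  | add x y hx hy => simp only [mul_add, map_add, hx, hy, add_mul]
  | ι_mul x k hx =>
    have h := ExteriorAlgebra.ι_add_mul_swap (R := ℝ) m k
    have h2 : ExteriorAlgebra.ι ℝ m * ExteriorAlgebra.ι ℝ k =
      - (ExteriorAlgebra.ι ℝ k * ExteriorAlgebra.ι ℝ m) := eq_neg_of_add_eq_zero_left h
    change ExteriorAlgebra.ι ℝ m * (ExteriorAlgebra.ι ℝ k * x) = _
    rw [← mul_assoc, h2, map_mul, CliffordAlgebra.involute_ι, neg_mul, mul_assoc, hx]
    simp [mul_assoc, ExteriorAlgebra.ι]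

theorem involute_contractLeft {M : Type*} [AddCommGroup M] [Module ℝ M] (d : Module.Dual ℝ M)
    (x : ExteriorAlgebra ℝ M) :
    CliffordAlgebra.involute (CliffordAlgebra.contractLeft d x) =
      - CliffordAlgebra.contractLeft d (CliffordAlgebra.involute x) := by
  induction x using CliffordAlgebra.left_induction with
  | algebraMap r => simp [CliffordAlgebra.contractLeft_algebraMap]
  | add x y hx hy => simp only [map_add, hx, hy]; abel
  | ι_mul x m hx =>
    simp only [CliffordAlgebra.contractLeft_ι_mul, hx, map_mul, map_sub, map_smul,
      CliffordAlgebra.involute_ι, neg_mul, mul_neg, map_neg]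
    abel

theorem dTh_mul (j : JetIdx n) (a b : DiffPoly U) :
    dTh U j (a * b) = dTh U j a * b + parity U a * dTh U j b := by
  induction a using diffPoly_induction with
  | zero => simp
  | add x y hx hy => simp only [add_mul, map_add, hx, hy]; abel
  | tmul f p =>
    induction b using diffPoly_induction with
    | zero => simp
    | add x y hx hy => simp only [mul_add, map_add, hx, hy]; abel
    | tmul g q =>
      simp only [dTh_tmul, parity_tmul, jetTmul_mul, contractLeft_mul,
        jetTmul_add]

theorem dU_comm (j k : JetIdx n) (a : DiffPoly U) : dU U j (dU U k a) = dU U k (dU U j a) := by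
  induction a using diffPoly_induction with
  | zero => simp
  | add x y hx hy => simp only [map_add, hx, hy]
  | tmul f p => simp only [dU_tmul, evenPartial_comm U j k]

theorem dTh_dU (j k : JetIdx n) (a : DiffPoly U) : dTh U j (dU U k a) = dU U k (dTh U j a) := by
  induction a using diffPoly_induction with
  | zero => simp
  | add x y hx hy => simp only [map_add, hx, hy]
  | tmul f p => simp only [dU_tmul, dTh_tmul]

theorem dTh_dTh (j k : JetIdx n) (a : DiffPoly U) :
    dTh U j (dTh U k a) = - dTh U k (dTh U j a) := by
  induction a using diffPoly_induction with
  | zero => simp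
  | add x y hx hy => simp only [map_add, hx, hy]; abel
  | tmul f p =>
    simp only [dTh_tmul]
    rw [CliffordAlgebra.contractLeft_comm, jetTmul_neg]

theorem parity_dU (j : JetIdx n) (a : DiffPoly U) : parity U (dU U j a) = dU U j (parity U a) := by
  induction a using diffPoly_induction with
  | zero => simp
  | add x y hx hy => simp only [map_add, hx, hy]
  | tmul f p => simp only [dU_tmul, parity_tmul]

theorem parity_dTh (j : JetIdx n) (a : DiffPoly U) :
    parity U (dTh U j a) = - dTh U j (parity U a) := by
  induction a using diffPoly_induction with
  | zero => simp
  | add x y hx hy => simp only [map_add, hx, hy]; abel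
  | tmul f p => simp only [dTh_tmul, parity_tmul, involute_contractLeft, jetTmul_neg]

theorem jetTh_mul (j : JetIdx n) (a : DiffPoly U) :
    jetTh U j * a = parity U a * jetTh U j := by
  induction a using diffPoly_induction with
  | zero => simp
  | add x y hx hy => simp only [map_add, mul_add, add_mul, hx, hy]
  | tmul f p =>
    simp only [jetTh, parity_tmul, jetTmul_mul, ι_mul_eq, one_mul, mul_one]

theorem tmul_one_mul (x : EvenJet U) (a : DiffPoly U) :
    jetTmul x (1 : OddJet n) * a = a * jetTmul x (1 : OddJet n) := by
  induction a using diffPoly_induction with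
  | zero => simp
  | add x y hx hy => simp only [mul_add, add_mul, hx, hy]
  | tmul f p => simp only [jetTmul_mul, one_mul, mul_one, mul_comm]

theorem jetU_mul (j : JetIdx n) (a : DiffPoly U) : jetU U j * a = a * jetU U j := by
  obtain ⟨i, _ | s⟩ := j
  · exact tmul_one_mul U _ a
  · exact tmul_one_mul U _ a

theorem parity_jetU (j : JetIdx n) : parity U (jetU U j) = jetU U j := by
  obtain ⟨i, _ | s⟩ := j <;> simp [jetU, ofFun, parity_tmul]

theorem parity_jetTh (j : JetIdx n) : parity U (jetTh U j) = - jetTh U j := by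
  simp only [jetTh, parity_tmul]
  rw [← jetTmul_neg]
  exact congrArg _ (CliffordAlgebra.involute_ι _)

theorem coordPartial_coordFun (i k : Fin n) :
    coordPartial U i (coordFun U k) = if i = k then 1 else 0 := by
  ext x
  have h := fderiv_extend_congr U (f := (coordFun U k).1)
    (F := fun y => ContinuousLinearMap.proj (R := ℝ) (φ := fun _ : Fin n => ℝ) k y)
    (fun x => rfl) x
  change fderiv ℝ _ _ _ = _
  rw [h, ContinuousLinearMap.fderiv]
  by_cases hik : i = k
  · subst hik; simp
  · simp [hik, Ne.symm hik]

theorem dU_jetU (j k : JetIdx n) : dU U j (jetU U k) = if j = k then 1 else 0 := by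
  obtain ⟨i, _ | s⟩ := j <;> obtain ⟨l, _ | t⟩ := k
  · simp only [jetU, ofFun, dU_tmul, evenPartial_zero_tmul, coordPartial_coordFun]
    by_cases h : i = l
    · simp [h, evenTmul_one, jetTmul_one]
    · simp [h, zero_evenTmul, zero_jetTmul]
  · simp [jetU, dU_tmul, evenPartial_zero_tmul, zero_evenTmul, zero_jetTmul]
  · simp [jetU, ofFun, dU_tmul, evenPartial_succ_tmul, evenTmul_zero, zero_jetTmul]
  · simp only [jetU, dU_tmul, evenPartial_succ_tmul, MvPolynomial.pderiv_X, Pi.single_apply]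
    by_cases h : (l, t) = (i, s)
    · have h' : ((i, s + 1) : JetIdx n) = (l, t + 1) := by simp_all
      rw [if_pos h, if_pos h', evenTmul_one, jetTmul_one]
    · have h' : ¬ ((i, s + 1) : JetIdx n) = (l, t + 1) := by
        simp only [Prod.mk.injEq, Nat.add_right_cancel_iff] at h ⊢
        exact fun hh => h ⟨hh.1.symm, hh.2.symm⟩
      rw [if_neg h, if_neg h', evenTmul_zero, zero_jetTmul]

theorem evenPartial_one (j : JetIdx n) : evenPartial U j 1 = 0 := by
  rw [← evenTmul_one]
  obtain ⟨i, _ | s⟩ := j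
  · rw [evenPartial_zero_tmul, Derivation.map_one_eq_zero, zero_evenTmul]
  · rw [evenPartial_succ_tmul, Derivation.map_one_eq_zero, evenTmul_zero]

theorem dU_jetTh (j k : JetIdx n) : dU U j (jetTh U k) = 0 := by
  rw [jetTh, dU_tmul, evenPartial_one, zero_jetTmul]

theorem dTh_jetU (j k : JetIdx n) : dTh U j (jetU U k) = 0 := by
  obtain ⟨i, _ | s⟩ := k <;> simp [jetU, ofFun, dTh_tmul, jetTmul_zero]

theorem dTh_jetTh (j k : JetIdx n) : dTh U j (jetTh U k) = if j = k then 1 else 0 := by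
  simp only [jetTh, dTh_tmul]
  have h : CliffordAlgebra.contractLeft (Finsupp.lapply j)
      (ExteriorAlgebra.ι ℝ (Finsupp.single k (1 : ℝ))) =
      algebraMap ℝ (OddJet n) (Finsupp.lapply j (Finsupp.single k (1 : ℝ))) :=
    CliffordAlgebra.contractLeft_ι _ _ _
  rw [h]
  by_cases hjk : j = k
  · simp [hjk, jetTmul_one]
  · simp [hjk, jetTmul_zero]

theorem dU_finite (a : DiffPoly U) : {j | dU U j a ≠ 0}.Finite := by
  induction a using diffPoly_induction with
  | zero => simp
  | add x y hx hy =>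
    refine (hx.union hy).subset fun j hj => ?_
    by_contra h
    simp only [Set.mem_union, Set.mem_ofPred_eq, not_or, not_not] at h
    exact hj (by rw [map_add, h.1, h.2, add_zero])
  | tmul b e =>
    have key : {j | evenPartial U j b ≠ 0}.Finite := by
      induction b using evenJet_induction with
      | zero => simp
      | add x y hx hy =>
        refine (hx.union hy).subset fun j hj => ?_
        by_contra h
        simp only [Set.mem_union, Set.mem_ofPred_eq, not_or, not_not] at h
        exact hj (by rw [map_add, h.1, h.2, add_zero])
      | tmul f p =>
        refine ((Set.finite_range fun i : Fin n => ((i, 0) : JetIdx n)).union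
          ((p.vars.finite_toSet).image fun j => (j.1, j.2 + 1))).subset ?_
        rintro ⟨i, _ | s⟩ hj
        · exact Or.inl ⟨i, rfl⟩
        · refine Or.inr ⟨(i, s), ?_, rfl⟩
          by_contra h
          refine hj ?_
          rw [evenPartial_succ_tmul, MvPolynomial.pderiv_eq_zero_of_notMem_vars h, evenTmul_zero]
    refine key.subset fun j hj h => hj ?_
    rw [dU_tmul, h, zero_jetTmul]

theorem dTh_finite (a : DiffPoly U) : {j | dTh U j a ≠ 0}.Finite := by
  induction a using diffPoly_induction with
  | zero => simp
  | add x y hx hy =>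
    refine (hx.union hy).subset fun j hj => ?_
    by_contra h
    simp only [Set.mem_union, Set.mem_ofPred_eq, not_or, not_not] at h
    exact hj (by rw [map_add, h.1, h.2, add_zero])
  | tmul b e =>
    have key : {j | CliffordAlgebra.contractLeft (Finsupp.lapply j) e ≠ 0}.Finite := by
      induction e using CliffordAlgebra.left_induction with
      | algebraMap r => simp [CliffordAlgebra.contractLeft_algebraMap]
      | add x y hx hy =>
        refine (hx.union hy).subset fun j hj => ?_
        by_contra h
        simp only [Set.mem_union, Set.mem_ofPred_eq, not_or, not_not] at h
        exact hj (by rw [map_add, h.1, h.2, add_zero])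
      | ι_mul x m hx =>
        refine (hx.union m.support.finite_toSet).subset fun j hj => ?_
        by_contra h
        simp only [Set.mem_union, Set.mem_ofPred_eq, not_or, not_not, Finset.mem_coe,
          Finsupp.notMem_support_iff] at h
        refine hj ?_
        rw [CliffordAlgebra.contractLeft_ι_mul, h.1, Finsupp.lapply_apply, h.2]
        simp
    refine key.subset fun j hj h => hj ?_
    rw [dTh_tmul, h, jetTmul_zero]

/-- All the partial derivatives `∂f/∂u^{i,s}` of `f`; finitely many are nonzero. -/
def gradU : DiffPoly U →ₗ[ℝ] (JetIdx n →₀ DiffPoly U) where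
  toFun a := Finsupp.ofSupportFinite (fun j => dU U j a) (dU_finite U a)
  map_add' a b := by ext j; exact map_add (dU U j) a b
  map_smul' c a := by ext j; exact map_smul (dU U j) c a

/-- All the left partial derivatives `∂f/∂θ_i^s` of `f`; finitely many are nonzero. -/
def gradTh : DiffPoly U →ₗ[ℝ] (JetIdx n →₀ DiffPoly U) where
  toFun a := Finsupp.ofSupportFinite (fun j => dTh U j a) (dTh_finite U a)
  map_add' a b := by ext j; exact map_add (dTh U j) a b
  map_smul' c a := by ext j; exact map_smul (dTh U j) c a

theorem gradU_apply (a : DiffPoly U) (j : JetIdx n) : gradU U a j = dU U j a := rfl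
theorem gradTh_apply (a : DiffPoly U) (j : JetIdx n) : gradTh U a j = dTh U j a := rfl

/-- The vector field `∑ X_{i,s} ∂/∂u^{i,s} + Y_{i,s} ∂/∂θ_i^s` acting on differential
polynomials. -/
def vectorField (X Y : JetIdx n → DiffPoly U) : DiffPoly U →ₗ[ℝ] DiffPoly U :=
  Finsupp.lsum ℝ (fun j => LinearMap.mulLeft ℝ (X j)) ∘ₗ gradU U +
    Finsupp.lsum ℝ (fun j => LinearMap.mulLeft ℝ (Y j)) ∘ₗ gradTh U

theorem vectorField_eq_sum (X Y : JetIdx n → DiffPoly U) (a : DiffPoly U)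
    (S : Finset (JetIdx n)) (h1 : ∀ j ∉ S, dU U j a = 0) (h2 : ∀ j ∉ S, dTh U j a = 0) :
    vectorField U X Y a = ∑ j ∈ S, (X j * dU U j a + Y j * dTh U j a) := by
  rw [Finset.sum_add_distrib]
  change (gradU U a).sum (fun j c => X j * c) + (gradTh U a).sum (fun j c => Y j * c) = _
  congr 1
  · refine Finsupp.sum_of_support_subset _ (fun j hj => ?_) _ (by simp)
    by_contra h
    exact (Finsupp.mem_support_iff.1 hj) (h1 j h)
  · refine Finsupp.sum_of_support_subset _ (fun j hj => ?_) _ (by simp)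
    by_contra h
    exact (Finsupp.mem_support_iff.1 hj) (h2 j h)

/-- The index of the `x`-derivative of a jet variable. -/
def shift (j : JetIdx n) : JetIdx n := (j.1, j.2 + 1)

/-- The total derivative `∂_x = ∑ u^{i,s+1} ∂/∂u^{i,s} + θ_i^{s+1} ∂/∂θ_i^s`. -/
def totalD : DiffPoly U →ₗ[ℝ] DiffPoly U :=
  vectorField U (fun j => jetU U (shift j)) (fun j => jetTh U (shift j))

theorem exists_support (l : List (DiffPoly U)) : ∃ S : Finset (JetIdx n), ∀ a ∈ l,
    ∀ j ∉ S, dU U j a = 0 ∧ dTh U j a = 0 := by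
  classical
  induction l with
  | nil => exact ⟨∅, by simp⟩
  | cons b l ih =>
    obtain ⟨S, hS⟩ := ih
    refine ⟨S ∪ ((dU_finite U b).toFinset ∪ (dTh_finite U b).toFinset), ?_⟩
    intro a ha j hj
    simp only [Finset.mem_union, Set.Finite.mem_toFinset, Set.mem_ofPred_eq, not_or, not_not] at hj
    rcases List.mem_cons.1 ha with rfl | ha
    · exact hj.2
    · exact hS a ha j hj.1

theorem totalD_mul (a b : DiffPoly U) : totalD U (a * b) = totalD U a * b + a * totalD U b := by
  obtain ⟨S, hS⟩ := exists_support U [a, b, a * b]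
  simp only [List.mem_cons, List.not_mem_nil, or_false, forall_eq_or_imp, forall_eq] at hS
  obtain ⟨ha, hb, hab⟩ := hS
  rw [totalD, vectorField_eq_sum U _ _ _ S (fun j h => (ha j h).1) (fun j h => (ha j h).2),
    vectorField_eq_sum U _ _ _ S (fun j h => (hb j h).1) (fun j h => (hb j h).2),
    vectorField_eq_sum U _ _ _ S (fun j h => (hab j h).1) (fun j h => (hab j h).2),
    Finset.sum_mul, Finset.mul_sum, ← Finset.sum_add_distrib]
  refine Finset.sum_congr rfl fun j _ => ?_
  have h1 : jetU U (shift j) * (a * dU U j b) = a * (jetU U (shift j) * dU U j b) := by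
    rw [← mul_assoc, jetU_mul, mul_assoc]
  have h2 : jetTh U (shift j) * (parity U a * dTh U j b) =
      a * (jetTh U (shift j) * dTh U j b) := by
    rw [← mul_assoc, jetTh_mul, ← mul_assoc]
    congr 2
    exact parity_parity U a
  rw [dU_mul, dTh_mul, mul_add, mul_add, h1, h2]
  noncomm_ring

theorem totalD_jetU (j : JetIdx n) : totalD U (jetU U j) = jetU U (shift j) := by
  classical
  rw [totalD, vectorField_eq_sum U _ _ _ {j}]
  · simp [dU_jetU, dTh_jetU]
  · intro k hk; rw [dU_jetU, if_neg (by simpa using hk)]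
  · intro k hk; rw [dTh_jetU]

theorem totalD_jetTh (j : JetIdx n) : totalD U (jetTh U j) = jetTh U (shift j) := by
  classical
  rw [totalD, vectorField_eq_sum U _ _ _ {j}]
  · simp [dU_jetTh, dTh_jetTh]
  · intro k hk; rw [dU_jetTh]
  · intro k hk; rw [dTh_jetTh, if_neg (by simpa using hk)]

theorem parity_totalD (a : DiffPoly U) : parity U (totalD U a) = totalD U (parity U a) := by
  obtain ⟨S, hS⟩ := exists_support U [a, parity U a]
  simp only [List.mem_cons, List.not_mem_nil, or_false, forall_eq_or_imp, forall_eq] at hS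
  obtain ⟨ha, hb⟩ := hS
  rw [totalD, vectorField_eq_sum U _ _ _ S (fun j h => (ha j h).1) (fun j h => (ha j h).2),
    vectorField_eq_sum U _ _ _ S (fun j h => (hb j h).1) (fun j h => (hb j h).2), map_sum]
  refine Finset.sum_congr rfl fun j _ => ?_
  rw [map_add, map_mul, map_mul, parity_jetU, parity_jetTh, parity_dU, parity_dTh, neg_mul_neg]

theorem shift_eq_iff (i : Fin n) (s : ℕ) (k : JetIdx n) : (i, s + 1) = shift k ↔ k = (i, s) := by
  simp only [shift, Prod.ext_iff]
  constructor
  · rintro ⟨h1, h2⟩; exact ⟨h1.symm, by simp at h2; omega⟩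
  · rintro ⟨h1, h2⟩; exact ⟨h1.symm, by simp [h2]⟩

theorem dU_totalD_sum (j : JetIdx n) (a : DiffPoly U) (S : Finset (JetIdx n))
    (hS : ∀ k ∉ S, dU U k a = 0 ∧ dTh U k a = 0) :
    dU U j (totalD U a) = totalD U (dU U j a) +
      ∑ k ∈ S, if j = shift k then dU U k a else 0 := by
  classical
  rw [totalD, vectorField_eq_sum U _ _ a S (fun j h => (hS j h).1) (fun j h => (hS j h).2),
    vectorField_eq_sum U _ _ (dU U j a) S
      (fun k h => by rw [dU_comm, (hS k h).1, map_zero])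
      (fun k h => by rw [dTh_dU, (hS k h).2, map_zero]), map_sum,
    ← Finset.sum_add_distrib]
  refine Finset.sum_congr rfl fun k _ => ?_
  rw [map_add, dU_mul, dU_mul, dU_jetU, dU_jetTh, dU_comm U j k, ← dTh_dU]
  split_ifs <;> simp [add_comm, add_left_comm]

theorem dTh_totalD_sum (j : JetIdx n) (a : DiffPoly U) (S : Finset (JetIdx n))
    (hS : ∀ k ∉ S, dU U k a = 0 ∧ dTh U k a = 0) :
    dTh U j (totalD U a) = totalD U (dTh U j a) +
      ∑ k ∈ S, if j = shift k then dTh U k a else 0 := by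
  classical
  rw [totalD, vectorField_eq_sum U _ _ a S (fun j h => (hS j h).1) (fun j h => (hS j h).2),
    vectorField_eq_sum U _ _ (dTh U j a) S
      (fun k h => by rw [← dTh_dU, (hS k h).1, map_zero])
      (fun k h => by rw [dTh_dTh, (hS k h).2, map_zero, neg_zero]), map_sum,
    ← Finset.sum_add_distrib]
  refine Finset.sum_congr rfl fun k _ => ?_
  rw [map_add, dTh_mul, dTh_mul, dTh_jetU, dTh_jetTh, parity_jetU, parity_jetTh, dTh_dTh U j k,
    dTh_dU]
  split_ifs <;> simp [add_comm, add_assoc]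

theorem dU_zero_totalD (i : Fin n) (a : DiffPoly U) :
    dU U (i, 0) (totalD U a) = totalD U (dU U (i, 0) a) := by
  obtain ⟨S, hS⟩ := exists_support U [a]
  rw [dU_totalD_sum U _ a S (hS a (by simp))]
  simp [shift]

theorem dTh_zero_totalD (i : Fin n) (a : DiffPoly U) :
    dTh U (i, 0) (totalD U a) = totalD U (dTh U (i, 0) a) := by
  obtain ⟨S, hS⟩ := exists_support U [a]
  rw [dTh_totalD_sum U _ a S (hS a (by simp))]
  simp [shift]

theorem dU_succ_totalD (i : Fin n) (s : ℕ) (a : DiffPoly U) :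
    dU U (i, s + 1) (totalD U a) = totalD U (dU U (i, s + 1) a) + dU U (i, s) a := by
  classical
  obtain ⟨S, hS⟩ := exists_support U [a]
  rw [dU_totalD_sum U _ a S (hS a (by simp))]
  simp only [shift_eq_iff, Finset.sum_ite_eq']
  split_ifs with h
  · rfl
  · rw [(hS a (by simp) _ h).1]

theorem dTh_succ_totalD (i : Fin n) (s : ℕ) (a : DiffPoly U) :
    dTh U (i, s + 1) (totalD U a) = totalD U (dTh U (i, s + 1) a) + dTh U (i, s) a := by
  classical
  obtain ⟨S, hS⟩ := exists_support U [a]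
  rw [dTh_totalD_sum U _ a S (hS a (by simp))]
  simp only [shift_eq_iff, Finset.sum_ite_eq']
  split_ifs with h
  · rfl
  · rw [(hS a (by simp) _ h).2]

/-- The sum `∑ (-∂_x)^s c_{i,s}` of a finitely supported family `c`. -/
def eulerSum (i : Fin n) : (JetIdx n →₀ DiffPoly U) →ₗ[ℝ] DiffPoly U :=
  Finsupp.lsum ℝ (fun s : ℕ => (-totalD U) ^ s) ∘ₗ
    Finsupp.lcomapDomain (fun s : ℕ => ((i, s) : JetIdx n)) (fun _ _ h => (Prod.ext_iff.1 h).2)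

theorem eulerSum_eq_zero (i : Fin n) (c c' : JetIdx n →₀ DiffPoly U)
    (h0 : c' (i, 0) = totalD U (c (i, 0)))
    (hs : ∀ s, c' (i, s + 1) = totalD U (c (i, s + 1)) + c (i, s)) : eulerSum U i c' = 0 := by
  have hsum : ∀ (b : JetIdx n →₀ DiffPoly U) (N : ℕ), (∀ s, N ≤ s → b (i, s) = 0) →
      eulerSum U i b = ∑ s ∈ Finset.range N, ((-totalD U) ^ s) (b (i, s)) := by
    intro b N hN
    change (Finsupp.comapDomain (fun s : ℕ => ((i, s) : JetIdx n)) b _).sum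
      (fun s x => ((-totalD U) ^ s) x) = _
    refine Finsupp.sum_of_support_subset _ (fun s hs => ?_) _ (by simp)
    rw [Finset.mem_range]
    by_contra h
    exact (Finsupp.mem_support_iff.1 hs) (hN s (not_lt.1 h))
  obtain ⟨N, hN⟩ : ∃ N, ∀ s, N ≤ s → c (i, s) = 0 := by
    refine ⟨c.support.sup Prod.snd + 1, fun s h => ?_⟩
    by_contra hne
    have := Finset.le_sup (f := Prod.snd) (Finsupp.mem_support_iff.2 hne)
    simp only at this
    omega
  have hN' : ∀ s, N + 1 ≤ s → c' (i, s) = 0 := by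
    intro s h
    obtain ⟨t, rfl⟩ : ∃ t, s = t + 1 := ⟨s - 1, by omega⟩
    rw [hs, hN _ (by omega), hN _ (by omega), map_zero, add_zero]
  have key : ∀ M, ∑ s ∈ Finset.range (M + 1), ((-totalD U) ^ s) (c' (i, s)) =
      - ((-totalD U) ^ (M + 1)) (c (i, M)) := by
    intro M
    induction M with
    | zero => simp [h0]
    | succ M ih =>
      rw [Finset.sum_range_succ, ih, hs, map_add, pow_succ (-totalD U) (M + 1)]
      simp
  rw [hsum c' (N + 1) hN', key, hN N le_rfl, map_zero, neg_zero]

/-- The space of local functionals, differential polynomials modulo total derivatives. -/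
abbrev LocalFunctional : Type := DiffPoly U ⧸ LinearMap.range (totalD U)

/-- The class `∫ f` of a differential polynomial. -/
def integral : DiffPoly U →ₗ[ℝ] LocalFunctional U := (LinearMap.range (totalD U)).mkQ

/-- The variational derivative `δF/δu^i = ∑ (-∂_x)^s ∂f/∂u^{i,s}` of `F = ∫ f`. -/
def varU (i : Fin n) : LocalFunctional U →ₗ[ℝ] DiffPoly U :=
  (LinearMap.range (totalD U)).liftQ (eulerSum U i ∘ₗ gradU U) (by
    rintro _ ⟨a, rfl⟩
    exact eulerSum_eq_zero U i (gradU U a) _ (dU_zero_totalD U i a)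
      (fun s => dU_succ_totalD U i s a))

/-- The variational derivative `δF/δθ_i = ∑ (-∂_x)^s ∂f/∂θ_i^s` of `F = ∫ f`. -/
def varTh (i : Fin n) : LocalFunctional U →ₗ[ℝ] DiffPoly U :=
  (LinearMap.range (totalD U)).liftQ (eulerSum U i ∘ₗ gradTh U) (by
    rintro _ ⟨a, rfl⟩
    exact eulerSum_eq_zero U i (gradTh U a) _ (dTh_zero_totalD U i a)
      (fun s => dTh_succ_totalD U i s a))

/-- The Schouten–Nijenhuis bracket `[P, Q]` for `P` of super degree `p`. -/
def schouten (p : ℕ) (P Q : LocalFunctional U) : LocalFunctional U :=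
  integral U (∑ i, (varTh U i P * varU U i Q + (-1) ^ p * (varU U i P * varTh U i Q)))

/-- The components `∂_x^s a_i` of an evolutionary vector field. -/
def prolong (a : Fin n → DiffPoly U) (j : JetIdx n) : DiffPoly U := (totalD U ^ j.2) (a j.1)

theorem totalD_prolong (a : Fin n → DiffPoly U) (j : JetIdx n) :
    totalD U (prolong U a j) = prolong U a (shift j) := by
  simp only [prolong, shift, pow_succ', Module.End.mul_apply]

theorem vectorField_totalD (a b : Fin n → DiffPoly U) (f : DiffPoly U) :
    vectorField U (prolong U a) (prolong U b) (totalD U f) =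
      totalD U (vectorField U (prolong U a) (prolong U b) f) := by
  classical
  obtain ⟨S, hS'⟩ := exists_support U [f]
  have hS := hS' f (by simp)
  have hT : ∀ k ∉ S ∪ S.image shift,
      dU U k (totalD U f) = 0 ∧ dTh U k (totalD U f) = 0 := by
    intro k hk
    simp only [Finset.mem_union, Finset.mem_image, not_or, not_exists, not_and] at hk
    rw [dU_totalD_sum U k f S hS, dTh_totalD_sum U k f S hS, (hS k hk.1).1, (hS k hk.1).2, map_zero,
      zero_add, zero_add]
    exact ⟨Finset.sum_eq_zero fun l hl => if_neg fun h => hk.2 l hl h.symm,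
      Finset.sum_eq_zero fun l hl => if_neg fun h => hk.2 l hl h.symm⟩
  have hS2 : ∀ k ∉ S ∪ S.image shift, dU U k f = 0 ∧ dTh U k f = 0 :=
    fun k hk => hS k fun h => hk (Finset.mem_union_left _ h)
  have hswap : ∀ (X c : JetIdx n → DiffPoly U), ∑ j ∈ S ∪ S.image shift,
      X j * (∑ k ∈ S, if j = shift k then c k else 0) = ∑ k ∈ S, X (shift k) * c k := by
    intro X c
    simp only [Finset.mul_sum]
    rw [Finset.sum_comm]
    refine Finset.sum_congr rfl fun k hk => ?_
    simp only [mul_ite, mul_zero]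
    rw [Finset.sum_ite_eq', if_pos (Finset.mem_union_right _ (Finset.mem_image_of_mem _ hk))]
  have hext : ∀ (X c : JetIdx n → DiffPoly U), (∀ k ∉ S, c k = 0) →
      ∑ k ∈ S, X k * c k = ∑ k ∈ S ∪ S.image shift, X k * c k := by
    intro X c hc
    exact Finset.sum_subset Finset.subset_union_left fun k _ hk => by rw [hc k hk, mul_zero]
  rw [vectorField_eq_sum U _ _ _ _ (fun j h => (hT j h).1) (fun j h => (hT j h).2),
    vectorField_eq_sum U _ _ _ _ (fun j h => (hS2 j h).1) (fun j h => (hS2 j h).2), map_sum]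
  simp only [dU_totalD_sum U _ f S hS, dTh_totalD_sum U _ f S hS, map_add, totalD_mul,
    totalD_prolong, mul_add, Finset.sum_add_distrib, hswap]
  rw [hext (fun k => prolong U a (shift k)) (fun k => dU U k f) (fun k hk => (hS k hk).1),
    hext (fun k => prolong U b (shift k)) (fun k => dTh U k f) (fun k hk => (hS k hk).2)]
  abel

/-- The one-forms `∑ g_{i,s} δu^{i,s} + h_s^i δθ_i^s`, as pairs `(g, h)` of finitely supported
families of coefficients. -/
abbrev JetForm : Type := (JetIdx n →₀ DiffPoly U) × (JetIdx n →₀ DiffPoly U)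

/-- The de Rham differential `δf = ∑ δu^{i,s} ∂f/∂u^{i,s} + δθ_i^s ∂f/∂θ_i^s` of a differential
polynomial. Moving the coefficients to the left costs a sign in `δθ_i^s c = (-1)^q c δθ_i^s` for
`c` of super degree `q`. -/
def delta : DiffPoly U →ₗ[ℝ] JetForm U :=
  (gradU U).prod (Finsupp.mapRange.linearMap (parity U).toLinearMap ∘ₗ gradTh U)

/-- The map `c ↦ (-1)^{rq} c w` for `c` of super degree `r`. -/
def signedSmul (q : ℕ) (w : JetForm U) : DiffPoly U →ₗ[ℝ] JetForm U :=
  (LinearMap.toSpanSingleton (DiffPoly U) (JetForm U) w).restrictScalars ℝ ∘ₗ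
    (parity U).toLinearMap ^ q

/-- The Lie derivative of one-forms along the vector field `V` of super degree `q` with
components `X`, `Y`: the coefficients of `∑ g δu^{i,s} + h δθ_i^s` are differentiated,
and `δu^{i,s}`, `δθ_i^s` are replaced by `δ(X_{i,s})`, `δ(Y_{i,s})`, with the sign
`(-1)^{rq}` for a coefficient of super degree `r`. -/
def lieForm (q : ℕ) (X Y : JetIdx n → DiffPoly U) : JetForm U →ₗ[ℝ] JetForm U :=
  (Finsupp.mapRange.linearMap (vectorField U X Y)).prodMap
      (Finsupp.mapRange.linearMap (vectorField U X Y)) +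
    (Finsupp.lsum ℝ (fun j => signedSmul U q (delta U (X j)))).coprod
      (Finsupp.lsum ℝ (fun j => signedSmul U q (delta U (Y j))))

/-- The Lie derivative along `∂_x`. -/
def formD : JetForm U →ₗ[ℝ] JetForm U :=
  lieForm U 0 (fun j => jetU U (shift j)) (fun j => jetTh U (shift j))

theorem lieForm_single_fst (q : ℕ) (X Y : JetIdx n → DiffPoly U) (j : JetIdx n) (c : DiffPoly U) :
    lieForm U q X Y (Finsupp.single j c, 0) =
      (Finsupp.single j (vectorField U X Y c), 0) + signedSmul U q (delta U (X j)) c := by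
  simp [lieForm, Finsupp.mapRange_single]

theorem lieForm_single_snd (q : ℕ) (X Y : JetIdx n → DiffPoly U) (j : JetIdx n) (c : DiffPoly U) :
    lieForm U q X Y (0, Finsupp.single j c) =
      (0, Finsupp.single j (vectorField U X Y c)) + signedSmul U q (delta U (Y j)) c := by
  simp [lieForm, Finsupp.mapRange_single]

theorem delta_jetU (j : JetIdx n) : delta U (jetU U j) = (Finsupp.single j 1, 0) := by
  refine Prod.ext (Finsupp.ext fun k => ?_) (Finsupp.ext fun k => ?_)
  · change dU U k (jetU U j) = _
    rw [dU_jetU, Finsupp.single_apply]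
    simp only [eq_comm]
  · change parity U (dTh U k (jetU U j)) = _
    rw [dTh_jetU, map_zero]; rfl

theorem delta_jetTh (j : JetIdx n) : delta U (jetTh U j) = (0, Finsupp.single j 1) := by
  refine Prod.ext (Finsupp.ext fun k => ?_) (Finsupp.ext fun k => ?_)
  · change dU U k (jetTh U j) = _
    rw [dU_jetTh]; rfl
  · change parity U (dTh U k (jetTh U j)) = _
    rw [dTh_jetTh, Finsupp.single_apply]
    simp only [eq_comm]
    split_ifs <;> simp

theorem jetForm_ext {V : Type*} [AddCommMonoid V] [Module ℝ V] {F G : JetForm U →ₗ[ℝ] V}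
    (h1 : ∀ j c, F (Finsupp.single j c, 0) = G (Finsupp.single j c, 0))
    (h2 : ∀ j c, F (0, Finsupp.single j c) = G (0, Finsupp.single j c)) : F = G :=
  LinearMap.prod_ext (Finsupp.lhom_ext h1) (Finsupp.lhom_ext h2)

theorem formD_eq : formD U =
    (Finsupp.mapRange.linearMap (totalD U) + Finsupp.lmapDomain (DiffPoly U) ℝ shift).prodMap
      (Finsupp.mapRange.linearMap (totalD U) + Finsupp.lmapDomain (DiffPoly U) ℝ shift) := by
  refine jetForm_ext U (fun j c => ?_) (fun j c => ?_)
  · rw [formD, lieForm_single_fst, delta_jetU]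
    simp [signedSmul, Finsupp.mapRange_single, Finsupp.mapDomain_single, totalD]
  · rw [formD, lieForm_single_snd, delta_jetTh]
    simp [signedSmul, Finsupp.mapRange_single, Finsupp.mapDomain_single, totalD]

theorem formD_smul (a : DiffPoly U) (w : JetForm U) :
    formD U (a • w) = totalD U a • w + a • formD U w := by
  have h : ∀ f : JetIdx n →₀ DiffPoly U, Finsupp.mapRange.linearMap (totalD U) (a • f) =
      totalD U a • f + a • Finsupp.mapRange.linearMap (totalD U) f := fun f => by
    ext j
    simp [totalD_mul]
  rw [formD_eq]
  refine Prod.ext ?_ ?_ <;>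
  · simp only [LinearMap.prodMap_apply, LinearMap.add_apply, Prod.smul_fst, Prod.smul_snd, h,
      Finsupp.lmapDomain_apply, Finsupp.mapDomain_smul, Prod.fst_add, Prod.snd_add, smul_add,
      add_assoc]

theorem formD_delta (a : DiffPoly U) : formD U (delta U a) = delta U (totalD U a) := by
  classical
  obtain ⟨S, hS'⟩ := exists_support U [a]
  have hS := hS' a (by simp)
  have h : ∀ (f : JetIdx n →₀ DiffPoly U), (∀ k ∉ S, f k = 0) → ∀ j,
      Finsupp.mapDomain shift f j = ∑ k ∈ S, if j = shift k then f k else 0 := by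
    intro f hf j
    rw [Finsupp.mapDomain, Finsupp.sum_of_support_subset (s := S) _ (fun k hk => by
      by_contra hne
      exact (Finsupp.mem_support_iff.1 hk) (hf k hne)) _ (by simp), Finsupp.finsetSum_apply]
    refine Finset.sum_congr rfl fun k _ => ?_
    rw [Finsupp.single_apply]
    simp only [eq_comm]
  rw [formD_eq]
  refine Prod.ext (Finsupp.ext fun j => ?_) (Finsupp.ext fun j => ?_)
  · change totalD U (dU U j a) + Finsupp.mapDomain shift (gradU U a) j = dU U j (totalD U a)
    rw [h _ (fun k hk => (hS k hk).1), dU_totalD_sum U j a S hS]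
    rfl
  · change totalD U (parity U (dTh U j a)) + Finsupp.mapDomain shift
      (Finsupp.mapRange.linearMap (parity U).toLinearMap (gradTh U a)) j =
        parity U (dTh U j (totalD U a))
    rw [h _ (fun k hk => by
        change parity U (dTh U k a) = 0
        rw [(hS k hk).2, map_zero]), dTh_totalD_sum U j a S hS, map_add, map_sum, parity_totalD]
    refine congrArg _ (Finset.sum_congr rfl fun k _ => ?_)
    split_ifs
    · rfl
    · rw [map_zero]

theorem formD_signedSmul (q : ℕ) (w : JetForm U) (c : DiffPoly U) :
    formD U (signedSmul U q w c) =
      signedSmul U q w (totalD U c) + signedSmul U q (formD U w) c := by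
  have h : ∀ q : ℕ, ((parity U).toLinearMap ^ q) (totalD U c) =
      totalD U (((parity U).toLinearMap ^ q) c) := by
    intro q
    induction q with
    | zero => rfl
    | succ q ih =>
      rw [pow_succ', Module.End.mul_apply, Module.End.mul_apply, ih]
      exact parity_totalD U _
  change formD U (((parity U).toLinearMap ^ q) c • w) =
    ((parity U).toLinearMap ^ q) (totalD U c) • w + ((parity U).toLinearMap ^ q) c • formD U w
  rw [formD_smul, h]

/-- The Lie derivative along an evolutionary vector field commutes with `∂_x`. -/
theorem lieForm_formD (q : ℕ) (a b : Fin n → DiffPoly U) :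
    lieForm U q (prolong U a) (prolong U b) ∘ₗ formD U =
      formD U ∘ₗ lieForm U q (prolong U a) (prolong U b) := by
  have h1 : ∀ j c, formD U (Finsupp.single j c, 0) =
      (Finsupp.single j (totalD U c), 0) + (Finsupp.single (shift j) c, 0) := by
    intro j c
    rw [formD_eq]
    simp [Finsupp.mapRange_single, Finsupp.mapDomain_single]
  have h2 : ∀ j c, formD U (0, Finsupp.single j c) =
      (0, Finsupp.single j (totalD U c)) + (0, Finsupp.single (shift j) c) := by
    intro j c
    rw [formD_eq]
    simp [Finsupp.mapRange_single, Finsupp.mapDomain_single]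
  refine jetForm_ext U (fun j c => ?_) (fun j c => ?_)
  · rw [LinearMap.comp_apply, LinearMap.comp_apply, h1, map_add, lieForm_single_fst,
      lieForm_single_fst, lieForm_single_fst, map_add, h1, formD_signedSmul, formD_delta,
      totalD_prolong, vectorField_totalD]
    abel
  · rw [LinearMap.comp_apply, LinearMap.comp_apply, h2, map_add, lieForm_single_snd,
      lieForm_single_snd, lieForm_single_snd, map_add, h2, formD_signedSmul, formD_delta,
      totalD_prolong, vectorField_totalD]
    abel

/-- The variational one-forms: one-forms modulo `∂_x`. -/
abbrev VarForm : Type := JetForm U ⧸ LinearMap.range (formD U)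

/-- The Lie derivative on one-forms along
`D_P = ∑ ∂_x^s(δP/δθ_i) ∂/∂u^{i,s} + (-1)^p ∂_x^s(δP/δu^i) ∂/∂θ_i^s`, for a local functional `P`
of super degree `p = 2`, so that `D_P` has super degree `1`. -/
def formLie (P : LocalFunctional U) : JetForm U →ₗ[ℝ] JetForm U :=
  lieForm U 1 (prolong U fun i => varTh U i P) (prolong U fun i => (-1) ^ 2 * varU U i P)

theorem formLie_formD (P : LocalFunctional U) (w : JetForm U) :
    formLie U P (formD U w) = formD U (formLie U P w) := by
  have h := LinearMap.congr_fun (lieForm_formD U 1 (fun i => varTh U i P)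
    (fun i => (-1) ^ 2 * varU U i P)) w
  rw [LinearMap.comp_apply, LinearMap.comp_apply] at h
  exact h

/-- The operator induced by the Lie derivative along `D_P` on variational one-forms. -/
def varFormLie (P : LocalFunctional U) : VarForm U →ₗ[ℝ] VarForm U :=
  (LinearMap.range (formD U)).mapQ (LinearMap.range (formD U)) (formLie U P) (by
    rintro _ ⟨w, rfl⟩
    rw [Submodule.mem_comap, formLie_formD]
    exact LinearMap.mem_range_self _ _)

/-- The differential polynomials of super degree `p` and differential degree `d`: the span of
the monomials `f(u) u^{i₁,s₁} ⋯ u^{i_k,s_k} θ_{j₁}^{t₁} ⋯ θ_{j_p}^{t_p}` with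
`∑ s + ∑ t = d`. It is zero if `p` or `d` is negative. -/
def polyDeg (p d : ℤ) : Submodule ℝ (DiffPoly U) :=
  Submodule.span ℝ {x | ∃ (f : SmoothFun U) (L K : List (JetIdx n)), (K.length : ℤ) = p ∧
    (((L.map Prod.snd).sum + (K.map Prod.snd).sum : ℕ) : ℤ) = d ∧
    x = ofFun U f * (L.map (jetU U)).prod * (K.map (jetTh U)).prod}

/-- The local functionals of super degree `p` and differential degree `d`. -/
def functionalDeg (p d : ℤ) : Submodule ℝ (LocalFunctional U) := (polyDeg U p d).map (integral U)

/-- The one-forms of super degree `p` and differential degree `d`, where `δu^{i,s}` has degrees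
`(0, s)` and `δθ_i^s` has degrees `(1, s)`. -/
def formDeg (p d : ℤ) : Submodule ℝ (JetForm U) where
  carrier := {w | ∀ j, w.1 j ∈ polyDeg U p (d - j.2) ∧ w.2 j ∈ polyDeg U (p - 1) (d - j.2)}
  add_mem' hv hw j := ⟨add_mem (hv j).1 (hw j).1, add_mem (hv j).2 (hw j).2⟩
  zero_mem' _ := ⟨zero_mem _, zero_mem _⟩
  smul_mem' c _ hw j := ⟨Submodule.smul_mem _ c (hw j).1, Submodule.smul_mem _ c (hw j).2⟩

/-- The variational one-forms of super degree `p` and differential degree `d`. -/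
def varFormDeg (p d : ℤ) : Submodule ℝ (VarForm U) :=
  (formDeg U p d).map (LinearMap.range (formD U)).mkQ

/-- The local functional `½ ∫ ∑ g^{ij} θ_i θ_j^1 + Γ^{ij}_k u^{k,1} θ_i θ_j`. -/
def hydroFunctional (g : Fin n → Fin n → SmoothFun U) (Γ : Fin n → Fin n → Fin n → SmoothFun U) :
    LocalFunctional U :=
  (1 / 2 : ℝ) • integral U (∑ i, ∑ j, (ofFun U (g i j) * jetTh U (i, 0) * jetTh U (j, 1) +
    ∑ k, ofFun U (Γ i j k) * jetU U (k, 1) * jetTh U (i, 0) * jetTh U (j, 0)))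

/-- `P` is a (nondegenerate) Hamiltonian structure of hydrodynamic type: a local functional of
super degree `2` and differential degree `1` with `[P, P] = 0` whose leading coefficient, a
symmetric matrix of smooth functions, is invertible at every point. -/
structure IsHydroHamiltonian (P : LocalFunctional U) : Prop where
  mem : P ∈ functionalDeg U 2 1
  schouten_eq_zero : schouten U 2 P P = 0
  nondegenerate : ∃ (g : Fin n → Fin n → SmoothFun U) (Γ : Fin n → Fin n → Fin n → SmoothFun U),
    (∀ i j, g i j = g j i) ∧ (∀ x : U, (Matrix.of fun i j => (g i j).1 x).det ≠ 0) ∧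
      P = hydroFunctional U g Γ

/-- The cohomology of an operator `D` in the homogeneous part `G`: the quotient of `G ∩ ker D` by
the elements of `G` that lie in the image of `D` (for a differential these lie in the kernel). -/
abbrev Cohomology {V : Type*} [AddCommGroup V] [Module ℝ V] (G : Submodule ℝ V)
    (D : V →ₗ[ℝ] V) : Type _ :=
  ↥(G ⊓ LinearMap.ker D) ⧸ (G ⊓ LinearMap.range D).submoduleOf (G ⊓ LinearMap.ker D)

end VarHam
end

noncomputable section
namespace VarHam
variable {n : ℕ}

/-! ### Sign rules in the superalgebra of differential polynomials. -/

section Supercommutativity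

/-! The operator D_P squares to zero because [P, P] = 0. The proof finds odd coordinates ζ in which
D_P has constant coefficients: u^{i,s} ↦ ζ_{i,s+1} and ζ_{i,s} ↦ 0.

For positive levels put ζ_{i,s+1} = D_P u^{i,s} = ∂_x^s(δP/δθ_i). Its coefficient at θ_k^{s+1} is
g^{ik}, and no θ of higher level occurs. As g is invertible, these elements can replace the
θ_i^{s+1}. At level zero D_P θ_k = δP/δu^k, which can be written in terms of the δP/δθ_m and the
u^{q,1}. The identity D_P(δP/δu^k) = 0 removes the u^{q,1}, so that D_P θ_k = ∑ B^i_{km} θ_i δP/δθ_m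
(`HydroMetric.exists_connection`). One more application of D_P shows that the connection B is flat
(`HydroMetric.connection_flat`). Over a star-shaped domain a flat connection has a parallel frame e
(`exists_parallel_frame`, by Picard iteration along the segments from the centre), and ζ_{a,0} = ∑
e_a^k θ_k is then closed. This is the coframe of `IsHydroHamiltonian.exists_coframe`.

In these coordinates D_P is a de Rham differential in the variables u^{i,s}: ζ_{i,s+1} plays the
role of du^{i,s}, and the ζ_{i,0} are inert. A contraction with suitable weights anticommutes with
it to the Euler field plus the operator that multiplies by the x-degree. In positive x-degree this
sum is inverted by integration along rays, so the differential is exact there (`exists_modelD_eq`,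
`HamCoframe.exists_hamD_eq`).

One-forms are written in the basis δu^{i,s}, δζ_{i,s}. There the Lie derivative sends δu^{i,s} to
δζ_{i,s+1} and δζ_{i,s} to 0. Hence δu^{i,s} cancels against δζ_{i,s+1}, and only the coefficients
of the δζ_{i,0} remain. These have the full x-degree d > 0 and are handled by the exactness of D_P
(`HamCoframe.exists_formLie_eq`).

For the quotient, ∂_x is injective on Ω and commutes with the Lie derivative, which gives a short
exact sequence of complexes Ω → Ω → Ω/∂_xΩ. Exactness of Ω in the degrees (p, d) and (p + 1, d)
yields exactness of the quotient in degree (p, d). -/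

theorem exterior_supercomm {M : Type*} [AddCommGroup M] [Module ℝ M] (e k : ExteriorAlgebra ℝ M) :
    (e + CliffordAlgebra.involute e) * k = k * (e + CliffordAlgebra.involute e) ∧
      (e - CliffordAlgebra.involute e) * k =
        CliffordAlgebra.involute k * (e - CliffordAlgebra.involute e) := by
  induction k using CliffordAlgebra.left_induction with
  | algebraMap r => constructor <;> simp [Algebra.commutes]
  | add x y hx hy => exact ⟨by rw [mul_add, hx.1, hy.1, ← add_mul],
      by rw [mul_add, map_add, hx.2, hy.2, ← add_mul]⟩
  | ι_mul x m hx =>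
    have h1 : CliffordAlgebra.ι (0 : QuadraticForm ℝ M) m * e =
      CliffordAlgebra.involute e * CliffordAlgebra.ι (0 : QuadraticForm ℝ M) m := ι_mul_eq m e
    have h2 : CliffordAlgebra.ι (0 : QuadraticForm ℝ M) m * CliffordAlgebra.involute e =
      e * CliffordAlgebra.ι (0 : QuadraticForm ℝ M) m := by
      rw [show CliffordAlgebra.ι (0 : QuadraticForm ℝ M) m * CliffordAlgebra.involute e = _ from
        ι_mul_eq m (CliffordAlgebra.involute e), CliffordAlgebra.involute_involute]
    constructor
    · rw [← mul_assoc, add_mul, ← h1, ← h2, add_comm, ← mul_add, mul_assoc, hx.1, mul_assoc]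
    · rw [← mul_assoc, sub_mul, ← h1, ← h2, ← mul_sub, map_mul, CliffordAlgebra.involute_ι,
        mul_assoc, neg_mul, neg_mul, mul_assoc, ← hx.2, ← mul_neg, ← neg_mul, neg_sub]

variable (U : TopologicalSpace.Opens (Fin n → ℝ))

/-- The elements x ± `parity U x` are twice the even and the odd part of x. This states
supercommutativity without a decomposition into homogeneous parts; the factor 2 is later cancelled
by `eq_of_two_smul`. -/
theorem supercomm (x b : DiffPoly U) : (x + parity U x) * b = b * (x + parity U x) ∧
    (x - parity U x) * b = parity U b * (x - parity U x) := by
  induction x using diffPoly_induction with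
  | zero => simp
  | add x y hx hy =>
    constructor
    · rw [map_add, add_add_add_comm, add_mul, mul_add, hx.1, hy.1]
    · rw [map_add, add_sub_add_comm, add_mul, mul_add, hx.2, hy.2]
  | tmul f p =>
    induction b using diffPoly_induction with
    | zero => simp
    | add x y hx hy => exact ⟨by rw [mul_add, hx.1, hy.1, ← add_mul],
        by rw [mul_add, map_add, hx.2, hy.2, ← add_mul]⟩
    | tmul g q =>
      have h1 : jetTmul f p + parity U (jetTmul f p) =
          jetTmul f (p + CliffordAlgebra.involute p) := by rw [parity_tmul, jetTmul_add]
      have h2 : jetTmul f p - parity U (jetTmul f p) =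
          jetTmul f (p - CliffordAlgebra.involute p) := by
        rw [parity_tmul, sub_eq_add_neg, sub_eq_add_neg, jetTmul_add, jetTmul_neg]
      rw [h1, h2, parity_tmul]
      simp only [jetTmul_mul]
      rw [(exterior_supercomm p q).1, (exterior_supercomm p q).2, mul_comm f g]
      exact ⟨rfl, rfl⟩

theorem eq_of_two_smul {V : Type*} [AddCommGroup V] [Module ℝ V] {x y : V}
    (h : x + x = y + y) : x = y := by
  have : (2 : ℝ) • x = (2 : ℝ) • y := by rw [two_smul, two_smul, h]
  exact (smul_right_injective V (two_ne_zero' ℝ)) this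

theorem even_mul_comm {x : DiffPoly U} (hx : parity U x = x) (b : DiffPoly U) :
    x * b = b * x := by
  have h := (supercomm U x b).1
  rw [hx, add_mul, mul_add] at h
  exact eq_of_two_smul h

theorem odd_mul_comm {x : DiffPoly U} (hx : parity U x = -x) (b : DiffPoly U) :
    x * b = parity U b * x := by
  have h := (supercomm U x b).2
  rw [hx, sub_neg_eq_add, add_mul, mul_add] at h
  exact eq_of_two_smul h

end Supercommutativity

variable (U : TopologicalSpace.Opens (Fin n → ℝ))

/-! ### Functions and jet variables as generators of the algebra. -/

section Generators

theorem jetTmul_eq_mul (a : EvenJet U) (e : OddJet n) :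
    jetTmul a e = jetTmul a 1 * jetTmul 1 e := by rw [jetTmul_mul, mul_one, one_mul]

theorem jetTmul_smul (c : ℝ) (a : EvenJet U) (e : OddJet n) :
    jetTmul a (c • e) = c • jetTmul a e := TensorProduct.tmul_smul _ _ _

theorem smul_jetTmul (c : ℝ) (a : EvenJet U) (e : OddJet n) :
    jetTmul (c • a) e = c • jetTmul a e := rfl

theorem evenTmul_smul (c : ℝ) (f : SmoothFun U) (p : MvPolynomial (JetIdx n) ℝ) :
    evenTmul f (c • p) = c • evenTmul f p := TensorProduct.tmul_smul _ _ _

theorem smul_evenTmul (c : ℝ) (f : SmoothFun U) (p : MvPolynomial (JetIdx n) ℝ) :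
    evenTmul (c • f) p = c • evenTmul f p := rfl

theorem ofFun_mul (f g : SmoothFun U) : ofFun U (f * g) = ofFun U f * ofFun U g := by
  simp only [ofFun, jetTmul_mul, evenTmul_mul, mul_one]

theorem ofFun_add (f g : SmoothFun U) : ofFun U (f + g) = ofFun U f + ofFun U g := by
  simp only [ofFun, add_evenTmul, add_jetTmul]

theorem ofFun_one : ofFun U 1 = 1 := rfl

theorem ofFun_zero : ofFun U 0 = 0 := by
  simp only [ofFun, zero_evenTmul, zero_jetTmul]

theorem ofFun_smul (c : ℝ) (f : SmoothFun U) : ofFun U (c • f) = c • ofFun U f := by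
  simp only [ofFun, smul_evenTmul, smul_jetTmul]

/-- The embedding of the smooth functions into the differential polynomials. -/
def ofFunHom : SmoothFun U →ₐ[ℝ] DiffPoly U :=
  AlgHom.ofLinearMap
    { toFun := ofFun U, map_add' := ofFun_add U, map_smul' := ofFun_smul U }
    (ofFun_one U) (ofFun_mul U)

theorem ofFun_sum {ι : Type*} (s : Finset ι) (f : ι → SmoothFun U) :
    ofFun U (∑ i ∈ s, f i) = ∑ i ∈ s, ofFun U (f i) := map_sum (ofFunHom U) f s

theorem ofFun_injective : Function.Injective (ofFun U) := by
  intro f g h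
  have h1 : Function.Injective (Algebra.TensorProduct.includeLeft :
      EvenJet U →ₐ[ℝ] EvenJet U ⊗[ℝ] OddJet n) :=
    Algebra.TensorProduct.includeLeft_injective (S := ℝ) (FaithfulSMul.algebraMap_injective ℝ _)
  have h2 : Function.Injective (Algebra.TensorProduct.includeLeft :
      SmoothFun U →ₐ[ℝ] SmoothFun U ⊗[ℝ] MvPolynomial (JetIdx n) ℝ) :=
    Algebra.TensorProduct.includeLeft_injective (S := ℝ) (FaithfulSMul.algebraMap_injective ℝ _)
  exact h2 (h1 h)

theorem ofFun_mul_comm (f : SmoothFun U) (a : DiffPoly U) : ofFun U f * a = a * ofFun U f :=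
  tmul_one_mul U _ a

theorem parity_ofFun (f : SmoothFun U) : parity U (ofFun U f) = ofFun U f := by
  simp [ofFun, parity_tmul]

theorem smul_eq_ofFun_mul (c : ℝ) (a : DiffPoly U) :
    c • a = ofFun U (algebraMap ℝ _ c) * a := by
  rw [Algebra.algebraMap_eq_smul_one, ofFun_smul, ofFun_one, smul_mul_assoc, one_mul]

theorem jetU_zero (i : Fin n) : jetU U (i, 0) = ofFun U (coordFun U i) := rfl

/-- The differential polynomials are generated by the functions and the jet variables. -/
theorem diffPoly_generators {C : DiffPoly U → Prop} (fn : ∀ f, C (ofFun U f))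
    (even : ∀ i s, C (jetU U (i, s + 1))) (odd : ∀ j, C (jetTh U j))
    (add : ∀ a b, C a → C b → C (a + b)) (mul : ∀ a b, C a → C b → C (a * b)) (a : DiffPoly U) :
    C a := by
  have smul : ∀ (c : ℝ) a, C a → C (c • a) := fun c a ha => by
    rw [smul_eq_ofFun_mul]; exact mul _ _ (fn _) ha
  have zero : C 0 := by rw [← ofFun_zero]; exact fn 0
  induction a using diffPoly_induction with
  | zero => exact zero
  | add x y hx hy => exact add _ _ hx hy
  | tmul b e =>
    rw [jetTmul_eq_mul]
    refine mul _ _ ?_ ?_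
    · induction b using evenJet_induction with
      | zero => rw [zero_jetTmul]; exact zero
      | add x y hx hy => rw [add_jetTmul]; exact add _ _ hx hy
      | tmul f p =>
        have h : jetTmul (evenTmul f p) (1 : OddJet n) =
            ofFun U f * jetTmul (evenTmul 1 p) 1 := by
          rw [ofFun, jetTmul_mul, evenTmul_mul]; simp
        rw [h]
        refine mul _ _ (fn f) ?_
        induction p using MvPolynomial.induction_on with
        | C r =>
          rw [← MvPolynomial.algebraMap_eq, Algebra.algebraMap_eq_smul_one, evenTmul_smul,
            smul_jetTmul]
          exact smul _ _ (fn 1)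
        | add p q hp hq => rw [evenTmul_add, add_jetTmul]; exact add _ _ (hp (by
            rw [ofFun, jetTmul_mul, evenTmul_mul]; simp)) (hq (by
            rw [ofFun, jetTmul_mul, evenTmul_mul]; simp))
        | mul_X p j hp =>
          have : jetTmul (evenTmul (1 : SmoothFun U) (p * MvPolynomial.X j)) (1 : OddJet n) =
              jetTmul (evenTmul 1 p) 1 * jetU U (j.1, j.2 + 1) := by
            rw [jetU, jetTmul_mul, evenTmul_mul]; simp
          rw [this]
          exact mul _ _ (hp (by rw [ofFun, jetTmul_mul, evenTmul_mul]; simp)) (even _ _)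
    · induction e using CliffordAlgebra.left_induction with
      | algebraMap r =>
        rw [Algebra.algebraMap_eq_smul_one, jetTmul_smul]
        exact smul _ _ (fn 1)
      | add x y hx hy => rw [jetTmul_add]; exact add _ _ hx hy
      | ι_mul x m hx =>
        have : jetTmul (1 : EvenJet U) (CliffordAlgebra.ι (0 : QuadraticForm ℝ _) m * x) =
          jetTmul 1 (ExteriorAlgebra.ι ℝ m) * jetTmul 1 x := by
          rw [jetTmul_mul, mul_one]
        rw [this]
        refine mul _ _ ?_ hx
        clear this hx
        induction m using Finsupp.induction_linear with
        | zero => rw [map_zero, jetTmul_zero]; exact zero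
        | add x y hx hy => rw [map_add, jetTmul_add]; exact add _ _ hx hy
        | single j r =>
          have : (Finsupp.single j r : JetIdx n →₀ ℝ) = r • Finsupp.single j 1 := by simp
          rw [this, map_smul, jetTmul_smul]
          exact smul _ _ (odd j)

end Generators

/-! ### Leibniz rules for vector fields and their values on generators. -/

section Derivations

variable {U}

theorem vectorField_mul_odd {X Y : JetIdx n → DiffPoly U} (hX : ∀ j, parity U (X j) = -X j)
    (hY : ∀ j, parity U (Y j) = Y j) (a b : DiffPoly U) :
    vectorField U X Y (a * b) = vectorField U X Y a * b + parity U a * vectorField U X Y b := by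
  obtain ⟨S, hS⟩ := exists_support U [a, b, a * b]
  simp only [List.mem_cons, List.not_mem_nil, or_false, forall_eq_or_imp, forall_eq] at hS
  obtain ⟨ha, hb, hab⟩ := hS
  rw [vectorField_eq_sum U _ _ _ S (fun j h => (ha j h).1) (fun j h => (ha j h).2),
    vectorField_eq_sum U _ _ _ S (fun j h => (hb j h).1) (fun j h => (hb j h).2),
    vectorField_eq_sum U _ _ _ S (fun j h => (hab j h).1) (fun j h => (hab j h).2),
    Finset.sum_mul, Finset.mul_sum, ← Finset.sum_add_distrib]
  refine Finset.sum_congr rfl fun j _ => ?_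
  rw [dU_mul, dTh_mul, mul_add, mul_add, ← mul_assoc (X j) a, odd_mul_comm U (hX j) a,
    ← mul_assoc (Y j) (parity U a), even_mul_comm U (hY j) (parity U a)]
  noncomm_ring

theorem vectorField_mul_even {X Y : JetIdx n → DiffPoly U} (hX : ∀ j, parity U (X j) = X j)
    (hY : ∀ j, parity U (Y j) = -Y j) (a b : DiffPoly U) :
    vectorField U X Y (a * b) = vectorField U X Y a * b + a * vectorField U X Y b := by
  obtain ⟨S, hS⟩ := exists_support U [a, b, a * b]
  simp only [List.mem_cons, List.not_mem_nil, or_false, forall_eq_or_imp, forall_eq] at hS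
  obtain ⟨ha, hb, hab⟩ := hS
  rw [vectorField_eq_sum U _ _ _ S (fun j h => (ha j h).1) (fun j h => (ha j h).2),
    vectorField_eq_sum U _ _ _ S (fun j h => (hb j h).1) (fun j h => (hb j h).2),
    vectorField_eq_sum U _ _ _ S (fun j h => (hab j h).1) (fun j h => (hab j h).2),
    Finset.sum_mul, Finset.mul_sum, ← Finset.sum_add_distrib]
  refine Finset.sum_congr rfl fun j _ => ?_
  have h : Y j * (parity U a * dTh U j b) = a * (Y j * dTh U j b) := by
    rw [← mul_assoc, odd_mul_comm U (hY j), parity_parity, mul_assoc]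
  rw [dU_mul, dTh_mul, mul_add, mul_add, ← mul_assoc (X j) a, even_mul_comm U (hX j) a, h]
  noncomm_ring

theorem parity_vectorField_odd {X Y : JetIdx n → DiffPoly U} (hX : ∀ j, parity U (X j) = -X j)
    (hY : ∀ j, parity U (Y j) = Y j) (a : DiffPoly U) :
    parity U (vectorField U X Y a) = -vectorField U X Y (parity U a) := by
  obtain ⟨S, hS⟩ := exists_support U [a, parity U a]
  simp only [List.mem_cons, List.not_mem_nil, or_false, forall_eq_or_imp, forall_eq] at hS
  obtain ⟨ha, hb⟩ := hS
  rw [vectorField_eq_sum U _ _ _ S (fun j h => (ha j h).1) (fun j h => (ha j h).2),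
    vectorField_eq_sum U _ _ _ S (fun j h => (hb j h).1) (fun j h => (hb j h).2), map_sum,
    ← Finset.sum_neg_distrib]
  refine Finset.sum_congr rfl fun j _ => ?_
  rw [map_add, map_mul, map_mul, hX, hY, parity_dU, parity_dTh]
  noncomm_ring

theorem vectorField_jetU (X Y : JetIdx n → DiffPoly U) (j : JetIdx n) :
    vectorField U X Y (jetU U j) = X j := by
  classical
  rw [vectorField_eq_sum U _ _ _ {j}]
  · simp [dU_jetU, dTh_jetU]
  · intro k hk; rw [dU_jetU, if_neg (by simpa using hk)]
  · intro k hk; rw [dTh_jetU]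

theorem vectorField_jetTh (X Y : JetIdx n → DiffPoly U) (j : JetIdx n) :
    vectorField U X Y (jetTh U j) = Y j := by
  classical
  rw [vectorField_eq_sum U _ _ _ {j}]
  · simp [dU_jetTh, dTh_jetTh]
  · intro k hk; rw [dU_jetTh]
  · intro k hk; rw [dTh_jetTh, if_neg (by simpa using hk)]

theorem dU_ofFun_zero (i : Fin n) (f : SmoothFun U) :
    dU U (i, 0) (ofFun U f) = ofFun U (coordPartial U i f) := rfl

theorem dU_ofFun_succ (i : Fin n) (s : ℕ) (f : SmoothFun U) :
    dU U (i, s + 1) (ofFun U f) = 0 := by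
  rw [ofFun, dU_tmul, evenPartial_succ_tmul]
  simp [evenTmul_zero, zero_jetTmul]

theorem dTh_ofFun (j : JetIdx n) (f : SmoothFun U) : dTh U j (ofFun U f) = 0 := by
  simp [ofFun, dTh_tmul, jetTmul_zero]

theorem vectorField_ofFun (X Y : JetIdx n → DiffPoly U) (f : SmoothFun U) :
    vectorField U X Y (ofFun U f) = ∑ i, X (i, 0) * ofFun U (coordPartial U i f) := by
  classical
  rw [vectorField_eq_sum U _ _ _ (Finset.univ.image fun i : Fin n => ((i, 0) : JetIdx n)),
    Finset.sum_image (fun _ _ _ _ h => (Prod.ext_iff.1 h).1)]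
  · simp [dU_ofFun_zero, dTh_ofFun]
  · rintro ⟨i, _ | s⟩ h
    · simp at h
    · exact dU_ofFun_succ i s f
  · intro j _; exact dTh_ofFun j f

end Derivations

/-! ### The bigrading by super degree and differential degree. -/

section Degrees

variable {U}

theorem prod_map_jetU_comm (L : List (JetIdx n)) (a : DiffPoly U) :
    (L.map (jetU U)).prod * a = a * (L.map (jetU U)).prod := by
  induction L with
  | nil => simp
  | cons j L ih => rw [List.map_cons, List.prod_cons, mul_assoc, ih, ← mul_assoc, jetU_mul,
      mul_assoc]

theorem monomial_mem_polyDeg (f : SmoothFun U) (L K : List (JetIdx n)) :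
    ofFun U f * (L.map (jetU U)).prod * (K.map (jetTh U)).prod ∈
      polyDeg U K.length ((L.map Prod.snd).sum + (K.map Prod.snd).sum : ℕ) :=
  Submodule.subset_span ⟨f, L, K, rfl, rfl, rfl⟩

theorem ofFun_mem (f : SmoothFun U) : ofFun U f ∈ polyDeg U 0 0 := by
  simpa using monomial_mem_polyDeg f [] []

theorem jetU_mem (j : JetIdx n) : jetU U j ∈ polyDeg U 0 j.2 := by
  simpa [ofFun_one] using monomial_mem_polyDeg (U := U) 1 [j] []

theorem jetTh_mem (j : JetIdx n) : jetTh U j ∈ polyDeg U 1 j.2 := by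
  simpa [ofFun_one] using monomial_mem_polyDeg (U := U) 1 [] [j]

theorem one_mem_polyDeg : (1 : DiffPoly U) ∈ polyDeg U 0 0 := ofFun_mem 1

theorem mul_mem_polyDeg {p q d e : ℤ} {a b : DiffPoly U} (ha : a ∈ polyDeg U p d)
    (hb : b ∈ polyDeg U q e) : a * b ∈ polyDeg U (p + q) (d + e) := by
  induction ha using Submodule.span_induction with
  | zero => rw [zero_mul]; exact zero_mem _
  | add x y _ _ hx hy => rw [add_mul]; exact add_mem hx hy
  | smul c x _ hx => rw [smul_mul_assoc]; exact Submodule.smul_mem _ c hx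
  | mem x hx =>
    induction hb using Submodule.span_induction with
    | zero => rw [mul_zero]; exact zero_mem _
    | add x y _ _ hx hy => rw [mul_add]; exact add_mem hx hy
    | smul c x _ hx => rw [mul_smul_comm]; exact Submodule.smul_mem _ c hx
    | mem y hy =>
      obtain ⟨f, L, K, rfl, rfl, rfl⟩ := hx
      obtain ⟨g, M, N, rfl, rfl, rfl⟩ := hy
      have h : ofFun U f * (L.map (jetU U)).prod * (K.map (jetTh U)).prod *
          (ofFun U g * (M.map (jetU U)).prod * (N.map (jetTh U)).prod) =
          ofFun U (f * g) * ((L ++ M).map (jetU U)).prod * ((K ++ N).map (jetTh U)).prod := by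
        simp only [List.map_append, List.prod_append, ofFun_mul]
        simp only [mul_assoc]
        congr 1
        rw [← mul_assoc _ (ofFun U g), ← ofFun_mul_comm, mul_assoc,
          ← mul_assoc _ (List.map (jetU U) M).prod, ← prod_map_jetU_comm M, mul_assoc,
          ← mul_assoc _ (ofFun U g), ← ofFun_mul_comm, mul_assoc]
      rw [h]
      convert monomial_mem_polyDeg (f * g) (L ++ M) (K ++ N) using 2
      · simp
      · simp; ring

theorem mul_mem_polyDeg' {p q d e r m : ℤ} {a b : DiffPoly U} (ha : a ∈ polyDeg U p d)
    (hb : b ∈ polyDeg U q e) (hr : p + q = r) (hm : d + e = m) : a * b ∈ polyDeg U r m := by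
  subst hr hm; exact mul_mem_polyDeg ha hb

/-- The clause for products carries the memberships of both factors. They are needed for twisted
Leibniz rules and for discarding factors of negative degree. Scalars need no clause of their own,
since they act as constant functions of bidegree (0, 0). -/
theorem polyDeg_induction {C : ℤ → ℤ → DiffPoly U → Prop} (fn : ∀ f, C 0 0 (ofFun U f))
    (even : ∀ j, C 0 j.2 (jetU U j)) (odd : ∀ j, C 1 j.2 (jetTh U j))
    (zero : ∀ p d, C p d 0) (add : ∀ p d a b, C p d a → C p d b → C p d (a + b))
    (mul : ∀ p q d e a b, a ∈ polyDeg U p d → b ∈ polyDeg U q e → C p d a → C q e b →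
      C (p + q) (d + e) (a * b))
    {p d : ℤ} {a : DiffPoly U} (ha : a ∈ polyDeg U p d) : C p d a := by
  induction ha using Submodule.span_induction with
  | zero => exact zero _ _
  | add x y _ _ hx hy => exact add _ _ _ _ hx hy
  | smul c x hxm hx =>
    rw [smul_eq_ofFun_mul, ← zero_add p, ← zero_add d]
    exact mul _ _ _ _ _ _ (ofFun_mem _) hxm (fn _) hx
  | mem x hx =>
    obtain ⟨f, L, K, rfl, rfl, rfl⟩ := hx
    have hL : ∀ L : List (JetIdx n), (L.map (jetU U)).prod ∈
        polyDeg U 0 ((L.map Prod.snd).sum : ℕ) ∧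
        C 0 ((L.map Prod.snd).sum : ℕ) (L.map (jetU U)).prod := by
      intro L
      induction L with
      | nil => exact ⟨one_mem_polyDeg, fn 1⟩
      | cons j L ih =>
        have h1 := mul_mem_polyDeg (jetU_mem j) ih.1
        have h2 := mul _ _ _ _ _ _ (jetU_mem j) ih.1 (even j) ih.2
        rw [zero_add] at h1 h2
        simp only [List.map_cons, List.prod_cons, List.sum_cons, Nat.cast_add]
        exact ⟨h1, h2⟩
    have hK : ∀ K : List (JetIdx n), (K.map (jetTh U)).prod ∈
        polyDeg U K.length ((K.map Prod.snd).sum : ℕ) ∧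
        C K.length ((K.map Prod.snd).sum : ℕ) (K.map (jetTh U)).prod := by
      intro K
      induction K with
      | nil => exact ⟨one_mem_polyDeg, fn 1⟩
      | cons j L ih =>
        have h1 := mul_mem_polyDeg (jetTh_mem j) ih.1
        have h2 := mul _ _ _ _ _ _ (jetTh_mem j) ih.1 (odd j) ih.2
        simp only [List.map_cons, List.prod_cons, List.sum_cons, Nat.cast_add, List.length_cons,
          Nat.cast_one]
        rw [add_comm _ (1 : ℤ)]
        exact ⟨h1, h2⟩
    have h1 := mul_mem_polyDeg (ofFun_mem f) (hL L).1
    have h2 := mul _ _ _ _ _ _ (ofFun_mem f) (hL L).1 (fn f) (hL L).2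
    have h3 := mul _ _ _ _ _ _ h1 (hK K).1 h2 (hK K).2
    simpa using h3

theorem polyDeg_eq_bot {p d : ℤ} (h : p < 0 ∨ d < 0) : polyDeg U p d = ⊥ := by
  rw [polyDeg, Submodule.span_eq_bot]
  rintro _ ⟨f, L, K, rfl, rfl, rfl⟩
  omega

theorem eq_zero_of_mem_polyDeg {p d : ℤ} (h : p < 0 ∨ d < 0) {a : DiffPoly U}
    (ha : a ∈ polyDeg U p d) : a = 0 := by
  rwa [polyDeg_eq_bot h, Submodule.mem_bot] at ha

theorem parity_of_mem {p d : ℤ} {a : DiffPoly U} (ha : a ∈ polyDeg U p d) :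
    parity U a = ((p.negOnePow : ℤˣ) : ℤ) • a := by
  refine polyDeg_induction (C := fun p _ a => parity U a = ((p.negOnePow : ℤˣ) : ℤ) • a)
    (fun f => by simp [parity_ofFun]) (fun j => by simp [parity_jetU])
    (fun j => by simp [parity_jetTh]) (fun p d => by simp)
    (fun p d a b ha hb => by rw [map_add, ha, hb, smul_add])
    (fun p q d e a b _ _ ha hb => ?_) ha
  rw [map_mul, ha, hb, Int.negOnePow_add, smul_mul_smul_comm, Units.val_mul]

theorem parity_mem {p d : ℤ} {a : DiffPoly U} (ha : a ∈ polyDeg U p d) :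
    parity U a ∈ polyDeg U p d := by
  rw [parity_of_mem ha]; exact (polyDeg U p d).toAddSubgroup.zsmul_mem ha _

theorem parity_zero {d : ℤ} {a : DiffPoly U} (ha : a ∈ polyDeg U 0 d) : parity U a = a := by
  simpa using parity_of_mem ha

theorem parity_one {d : ℤ} {a : DiffPoly U} (ha : a ∈ polyDeg U 1 d) : parity U a = -a := by
  simpa using parity_of_mem ha

theorem parity_two {d : ℤ} {a : DiffPoly U} (ha : a ∈ polyDeg U 2 d) : parity U a = a := by
  have := parity_of_mem ha
  rwa [Int.negOnePow_even 2 even_two, Units.val_one, one_smul] at this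

/-- A twisted derivation is homogeneous if it is so on the generators. -/
theorem derivation_mem_polyDeg {q e : ℤ} {V : DiffPoly U →ₗ[ℝ] DiffPoly U}
    {s : DiffPoly U → DiffPoly U} (hs : ∀ p d a, a ∈ polyDeg U p d → s a ∈ polyDeg U p d)
    (hV : ∀ a b, V (a * b) = V a * b + s a * V b) (fn : ∀ f, V (ofFun U f) ∈ polyDeg U q e)
    (even : ∀ j, V (jetU U j) ∈ polyDeg U q (e + j.2))
    (odd : ∀ j, V (jetTh U j) ∈ polyDeg U (1 + q) (e + j.2)) {p d : ℤ} {a : DiffPoly U}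
    (ha : a ∈ polyDeg U p d) : V a ∈ polyDeg U (p + q) (d + e) := by
  refine polyDeg_induction (C := fun p d a => V a ∈ polyDeg U (p + q) (d + e))
    (fun f => by simpa using fn f) (fun j => by simpa [add_comm] using even j)
    (fun j => by simpa [add_comm] using odd j) (fun p d => by rw [map_zero]; exact zero_mem _)
    (fun p d a b ha hb => by rw [map_add]; exact add_mem ha hb)
    (fun p p' d d' a b ha hb hVa hVb => ?_) ha
  rw [hV]
  exact add_mem (mul_mem_polyDeg' hVa hb (by ring) (by ring))
    (mul_mem_polyDeg' (hs _ _ _ ha) hVb (by ring) (by ring))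

theorem dU_mem {p d : ℤ} {a : DiffPoly U} (ha : a ∈ polyDeg U p d) (j : JetIdx n) :
    dU U j a ∈ polyDeg U p (d - j.2) := by
  have := derivation_mem_polyDeg (q := 0) (e := -j.2) (V := dU U j) (s := id)
    (fun _ _ _ h => h) (dU_mul U j) (fun f => ?_) (fun k => ?_) (fun k => ?_) ha
  · rwa [add_zero, ← sub_eq_add_neg] at this
  · obtain ⟨i, _ | s⟩ := j
    · rw [dU_ofFun_zero]; simpa using ofFun_mem (coordPartial U i f)
    · rw [dU_ofFun_succ]; exact zero_mem _
  · rw [dU_jetU]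
    split_ifs with h
    · subst h; simpa using one_mem_polyDeg
    · exact zero_mem _
  · rw [dU_jetTh]; exact zero_mem _

theorem dTh_mem {p d : ℤ} {a : DiffPoly U} (ha : a ∈ polyDeg U p d) (j : JetIdx n) :
    dTh U j a ∈ polyDeg U (p - 1) (d - j.2) := by
  have := derivation_mem_polyDeg (q := -1) (e := -j.2) (V := dTh U j) (s := parity U)
    (fun _ _ _ h => parity_mem h) (dTh_mul U j) (fun f => ?_) (fun k => ?_) (fun k => ?_) ha
  · rwa [← sub_eq_add_neg, ← sub_eq_add_neg] at this
  · rw [dTh_ofFun]; exact zero_mem _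
  · rw [dTh_jetU]; exact zero_mem _
  · rw [dTh_jetTh]
    split_ifs with h
    · subst h; simpa using one_mem_polyDeg
    · exact zero_mem _

theorem totalD_mem {p d : ℤ} {a : DiffPoly U} (ha : a ∈ polyDeg U p d) :
    totalD U a ∈ polyDeg U p (d + 1) := by
  have := derivation_mem_polyDeg (q := 0) (e := 1) (V := totalD U) (s := id)
    (fun _ _ _ h => h) (totalD_mul U) (fun f => ?_) (fun k => ?_) (fun k => ?_) ha
  · rwa [add_zero] at this
  · rw [totalD, vectorField_ofFun]
    exact sum_mem fun i _ => mul_mem_polyDeg' (jetU_mem _) (ofFun_mem _) (by simp) (by simp [shift])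
  · rw [totalD_jetU]
    simpa [shift, add_comm] using jetU_mem (U := U) (shift k)
  · rw [totalD_jetTh]
    simpa [shift, add_comm] using jetTh_mem (U := U) (shift k)

theorem totalD_pow_mem {p d : ℤ} {a : DiffPoly U} (ha : a ∈ polyDeg U p d) (s : ℕ) :
    (totalD U ^ s) a ∈ polyDeg U p (d + s) := by
  induction s with
  | zero => simpa using ha
  | succ s ih =>
    rw [pow_succ', Module.End.mul_apply]
    have := totalD_mem ih
    rwa [add_assoc] at this

theorem prolong_mem {p d : ℤ} {a : Fin n → DiffPoly U} (ha : ∀ i, a i ∈ polyDeg U p d)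
    (j : JetIdx n) : prolong U a j ∈ polyDeg U p (d + j.2) := totalD_pow_mem (ha j.1) j.2

/-- A vector field that rescales the jet variables by additive weights multiplies a monomial by
its total weight. -/
theorem weightField_of_mem (a b : ℕ) {p d : ℤ} {x : DiffPoly U} (hx : x ∈ polyDeg U p d) :
    vectorField U (fun j => ((a * j.2 : ℕ) : ℤ) • jetU U j)
      (fun j => ((a * j.2 + b : ℕ) : ℤ) • jetTh U j) x = (a * d + b * p) • x := by
  refine polyDeg_induction (C := fun p d x => vectorField U (fun j => ((a * j.2 : ℕ) : ℤ) • jetU U j)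
      (fun j => ((a * j.2 + b : ℕ) : ℤ) • jetTh U j) x = (a * d + b * p) • x)
    (fun f => by simp [vectorField_ofFun]) (fun j => by rw [vectorField_jetU]; simp)
    (fun j => by rw [vectorField_jetTh]; simp) (fun p d => by simp)
    (fun p d a b ha hb => by rw [map_add, ha, hb, smul_add])
    (fun p q d e x y _ _ hx hy => ?_) hx
  rw [vectorField_mul_even (fun j => by rw [map_zsmul, parity_jetU])
    (fun j => by rw [map_zsmul, parity_jetTh, smul_neg]), hx, hy, smul_mul_assoc, mul_smul_comm,
    ← add_smul]
  congr 1
  ring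

theorem mem_polyDeg_zero {a : DiffPoly U} (ha : a ∈ polyDeg U 0 0) : ∃ f, a = ofFun U f := by
  refine polyDeg_induction (C := fun p d a => p = 0 → d = 0 → ∃ f, a = ofFun U f)
    (fun f _ _ => ⟨f, rfl⟩) (fun j _ h => ?_) (fun j h => by omega)
    (fun p d _ _ => ⟨0, (ofFun_zero U).symm⟩)
    (fun p d a b ha hb h1 h2 => ?_) (fun p q d e a b ham hbm ha hb h1 h2 => ?_) ha rfl rfl
  · obtain ⟨i, s⟩ := j
    obtain rfl : s = 0 := by simpa using h
    exact ⟨_, rfl⟩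
  · obtain ⟨f, rfl⟩ := ha h1 h2
    obtain ⟨g, rfl⟩ := hb h1 h2
    exact ⟨f + g, (ofFun_add U f g).symm⟩
  -- The degrees of the factors are only known to add up to zero. If one of them is negative, the
  -- corresponding factor vanishes; otherwise all of them are zero.
  · by_cases hneg : (p < 0 ∨ d < 0)
    · exact ⟨0, by rw [eq_zero_of_mem_polyDeg hneg ham, zero_mul, ofFun_zero]⟩
    by_cases hneg' : (q < 0 ∨ e < 0)
    · exact ⟨0, by rw [eq_zero_of_mem_polyDeg hneg' hbm, mul_zero, ofFun_zero]⟩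
    obtain ⟨f, rfl⟩ := ha (by omega) (by omega)
    obtain ⟨g, rfl⟩ := hb (by omega) (by omega)
    exact ⟨f * g, (ofFun_mul U f g).symm⟩

end Degrees

end VarHam
end

noncomputable section
namespace VarHam
variable {n : ℕ} {U : TopologicalSpace.Opens (Fin n → ℝ)}

/-! ### Odd vector fields acting on one-forms. -/

section LieDerivative

theorem delta_fst_apply (a : DiffPoly U) (k : JetIdx n) : (delta U a).1 k = dU U k a := rfl

theorem delta_snd_apply (a : DiffPoly U) (k : JetIdx n) :
    (delta U a).2 k = parity U (dTh U k a) := rfl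

theorem neg_smul_form (c : DiffPoly U) (w : JetForm U) : (-c) • w = -(c • w) := neg_smul c w

/-- Coefficients stand on the left. Moving b past δx, which is odd when x is odd, costs exactly the
sign recorded by `parity U b`. -/
theorem delta_odd_mul {x : DiffPoly U} (hx : parity U x = -x) (b : DiffPoly U) :
    delta U (x * b) = parity U b • delta U x + x • delta U b := by
  refine Prod.ext (Finsupp.ext fun k => ?_) (Finsupp.ext fun k => ?_)
  · have h : parity U (dU U k x) = -dU U k x := by rw [parity_dU, hx, map_neg]
    change dU U k (x * b) = parity U b * dU U k x + x * dU U k b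
    rw [dU_mul, odd_mul_comm U h]
  · have h : parity U (dTh U k x) = dTh U k x := by rw [parity_dTh, hx, map_neg, neg_neg]
    change parity U (dTh U k (x * b)) = parity U b * parity U (dTh U k x) +
      x * parity U (dTh U k b)
    rw [dTh_mul, map_add, map_mul, map_mul, parity_parity, h, even_mul_comm U h]

theorem delta_even_mul {x : DiffPoly U} (hx : parity U x = x) (b : DiffPoly U) :
    delta U (x * b) = b • delta U x + x • delta U b := by
  refine Prod.ext (Finsupp.ext fun k => ?_) (Finsupp.ext fun k => ?_)
  · have h : parity U (dU U k x) = dU U k x := by rw [parity_dU, hx]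
    change dU U k (x * b) = b * dU U k x + x * dU U k b
    rw [dU_mul, even_mul_comm U h]
  · have h : parity U (dTh U k x) = -dTh U k x := by rw [parity_dTh, hx]
    change parity U (dTh U k (x * b)) = b * parity U (dTh U k x) + x * parity U (dTh U k b)
    have h' : parity U (-dTh U k x) = -(-dTh U k x) := by rw [map_neg, h]
    rw [dTh_mul, map_add, map_mul, map_mul, parity_parity, h, odd_mul_comm U h', parity_parity]

variable {X Y : JetIdx n → DiffPoly U}

theorem lieForm_one_apply (w : JetForm U) : lieForm U 1 X Y w =
    (Finsupp.mapRange.linearMap (vectorField U X Y) w.1,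
      Finsupp.mapRange.linearMap (vectorField U X Y) w.2) +
    ((w.1.sum fun j c => parity U c • delta U (X j)) +
      w.2.sum fun j c => parity U c • delta U (Y j)) := by
  simp only [lieForm, LinearMap.add_apply, LinearMap.prodMap_apply, LinearMap.coprod_apply,
    Finsupp.lsum_apply, signedSmul, pow_one]
  rfl

theorem lieForm_smul (hX : ∀ j, parity U (X j) = -X j) (hY : ∀ j, parity U (Y j) = Y j)
    (c : DiffPoly U) (w : JetForm U) : lieForm U 1 X Y (c • w) =
      vectorField U X Y c • w + parity U c • lieForm U 1 X Y w := by
  have hadd : ∀ w v : JetForm U, lieForm U 1 X Y (c • w) =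
      vectorField U X Y c • w + parity U c • lieForm U 1 X Y w →
      lieForm U 1 X Y (c • v) = vectorField U X Y c • v + parity U c • lieForm U 1 X Y v →
      lieForm U 1 X Y (c • (w + v)) =
        vectorField U X Y c • (w + v) + parity U c • lieForm U 1 X Y (w + v) := fun w v hw hv => by
    rw [smul_add, map_add, hw, hv, map_add, smul_add, smul_add, add_add_add_comm]
  have h1 : ∀ f : JetIdx n →₀ DiffPoly U, lieForm U 1 X Y (c • (f, 0)) =
      vectorField U X Y c • (f, 0) + parity U c • lieForm U 1 X Y (f, 0) := fun f => by
    induction f using Finsupp.induction_linear with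
    | zero =>
      change lieForm U 1 X Y (c • 0) = vectorField U X Y c • 0 + parity U c • lieForm U 1 X Y 0
      simp
    | add f g hf hg => simpa using hadd _ _ hf hg
    | single j b =>
      rw [Prod.smul_mk, Finsupp.smul_single, smul_zero, lieForm_single_fst, lieForm_single_fst,
        smul_eq_mul, vectorField_mul_odd hX hY, Finsupp.single_add, smul_add, ← add_assoc]
      simp [signedSmul, smul_smul]
  have h2 : ∀ f : JetIdx n →₀ DiffPoly U, lieForm U 1 X Y (c • (0, f)) =
      vectorField U X Y c • (0, f) + parity U c • lieForm U 1 X Y (0, f) := fun f => by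
    induction f using Finsupp.induction_linear with
    | zero =>
      change lieForm U 1 X Y (c • 0) = vectorField U X Y c • 0 + parity U c • lieForm U 1 X Y 0
      simp
    | add f g hf hg => simpa using hadd _ _ hf hg
    | single j b =>
      rw [Prod.smul_mk, Finsupp.smul_single, smul_zero, lieForm_single_snd, lieForm_single_snd,
        smul_eq_mul, vectorField_mul_odd hX hY, Finsupp.single_add, smul_add, ← add_assoc]
      simp [signedSmul, smul_smul]
  simpa using hadd _ _ (h1 w.1) (h2 w.2)

/-- Expanding δ(Va) by the product rule gives two groups of terms. Those containing δX_j and δY_j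
are the substitution part of the Lie derivative. The remaining ones are V applied to the
coefficients of δa, because second partial derivatives supercommute; this is `key`. -/
theorem lieForm_delta (hX : ∀ j, parity U (X j) = -X j) (hY : ∀ j, parity U (Y j) = Y j)
    (a : DiffPoly U) : lieForm U 1 X Y (delta U a) = delta U (vectorField U X Y a) := by
  obtain ⟨S, hS'⟩ := exists_support U [a]
  have hS := hS' a (by simp)
  rw [vectorField_eq_sum U _ _ a S (fun j h => (hS j h).1) (fun j h => (hS j h).2), map_sum]
  simp only [map_add, delta_odd_mul (hX _), delta_even_mul (hY _)]
  rw [lieForm_one_apply,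
    Finsupp.sum_of_support_subset (s := S) (delta U a).1 (fun k hk => by
      by_contra hne
      exact (Finsupp.mem_support_iff.1 hk) (hS k hne).1) _ (by simp),
    Finsupp.sum_of_support_subset (s := S) (delta U a).2 (fun k hk => by
      by_contra hne
      exact (Finsupp.mem_support_iff.1 hk) (by rw [delta_snd_apply, (hS k hne).2, map_zero])) _
      (by simp)]
  simp only [delta_fst_apply, delta_snd_apply, parity_parity, Finset.sum_add_distrib]
  have key : (Finsupp.mapRange.linearMap (vectorField U X Y) (delta U a).1,
      Finsupp.mapRange.linearMap (vectorField U X Y) (delta U a).2) =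
      ∑ j ∈ S, X j • delta U (dU U j a) + ∑ j ∈ S, Y j • delta U (dTh U j a) := by
    rw [← Finset.sum_add_distrib]
    refine Prod.ext (Finsupp.ext fun k => ?_) (Finsupp.ext fun k => ?_)
    · rw [Prod.fst_sum, Finsupp.finsetSum_apply]
      change vectorField U X Y (dU U k a) = ∑ j ∈ S, (X j * dU U k (dU U j a) +
        Y j * dU U k (dTh U j a))
      rw [vectorField_eq_sum U _ _ _ S (fun j h => by rw [dU_comm, (hS j h).1, map_zero])
        (fun j h => by rw [dTh_dU, (hS j h).2, map_zero])]
      exact Finset.sum_congr rfl fun j _ => by rw [dU_comm U j k, dTh_dU]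
    · rw [Prod.snd_sum, Finsupp.finsetSum_apply]
      change vectorField U X Y (parity U (dTh U k a)) = ∑ j ∈ S,
        (X j * parity U (dTh U k (dU U j a)) + Y j * parity U (dTh U k (dTh U j a)))
      rw [vectorField_eq_sum U _ _ _ S
        (fun j h => by rw [← parity_dU, ← dTh_dU, (hS j h).1, map_zero, map_zero])
        (fun j h => by rw [← neg_eq_zero, ← parity_dTh, dTh_dTh, (hS j h).2, map_zero, neg_zero,
          map_zero])]
      refine Finset.sum_congr rfl fun j _ => ?_
      rw [dTh_dTh U k j, map_neg, parity_dTh U j, neg_neg, ← parity_dU, ← dTh_dU]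
  rw [key]
  abel

/-- The square of an odd derivation is an ordinary derivation, so vanishing on generators suffices.
On a function of u it contracts the symmetric second derivatives with the antisymmetric products X_i
X_k. -/
theorem vectorField_sq (hX : ∀ j, parity U (X j) = -X j) (hY : ∀ j, parity U (Y j) = Y j)
    (hVX : ∀ j, vectorField U X Y (X j) = 0) (hVY : ∀ j, vectorField U X Y (Y j) = 0)
    (a : DiffPoly U) : vectorField U X Y (vectorField U X Y a) = 0 := by
  induction a using diffPoly_generators with
  | fn f =>
    rw [vectorField_ofFun, map_sum]
    simp only [vectorField_mul_odd hX hY, hVX, zero_mul, zero_add, hX, vectorField_ofFun,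
      Finset.mul_sum]
    have h : ∀ i k : Fin n, -X (i, 0) * (X (k, 0) * ofFun U (coordPartial U k (coordPartial U i f)))
        = -(-X (k, 0) * (X (i, 0) * ofFun U (coordPartial U i (coordPartial U k f)))) := by
      intro i k
      rw [neg_mul, neg_mul, neg_neg, ← mul_assoc, ← mul_assoc, odd_mul_comm U (hX (i, 0)), hX,
        coordPartial_comm, neg_mul, neg_mul, neg_neg]
    -- The double sum is added to a copy of itself with the two indices interchanged; the terms then
    -- cancel in pairs.
    refine eq_of_two_smul ?_
    rw [add_zero]
    nth_rewrite 2 [Finset.sum_comm]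
    rw [← Finset.sum_add_distrib]
    refine Finset.sum_eq_zero fun i _ => ?_
    rw [← Finset.sum_add_distrib]
    refine Finset.sum_eq_zero fun k _ => ?_
    rw [h i k, neg_add_cancel]
  | even i s => rw [vectorField_jetU, hVX]
  | odd j => rw [vectorField_jetTh, hVY]
  | add a b ha hb => rw [map_add, map_add, ha, hb, add_zero]
  | mul a b ha hb =>
    rw [vectorField_mul_odd hX hY, map_add, vectorField_mul_odd hX hY, vectorField_mul_odd hX hY,
      ha, hb, parity_vectorField_odd hX hY]
    noncomm_ring

theorem lieForm_sq (hX : ∀ j, parity U (X j) = -X j) (hY : ∀ j, parity U (Y j) = Y j)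
    (hVX : ∀ j, vectorField U X Y (X j) = 0) (hVY : ∀ j, vectorField U X Y (Y j) = 0)
    (w : JetForm U) : lieForm U 1 X Y (lieForm U 1 X Y w) = 0 := by
  have h : lieForm U 1 X Y ∘ₗ lieForm U 1 X Y = 0 := by
    refine jetForm_ext U (fun j c => ?_) (fun j c => ?_)
    · have e : ((Finsupp.single j c, 0) : JetForm U) = c • delta U (jetU U j) := by
        rw [delta_jetU]; simp
      rw [e, LinearMap.comp_apply, lieForm_smul hX hY, map_add, lieForm_smul hX hY,
        lieForm_smul hX hY, lieForm_delta hX hY, lieForm_delta hX hY, vectorField_jetU, hVX,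
        vectorField_sq hX hY hVX hVY, parity_vectorField_odd hX hY, map_zero]
      simp [neg_smul_form]
    · have e : ((0, Finsupp.single j c) : JetForm U) = c • delta U (jetTh U j) := by
        rw [delta_jetTh]; simp
      rw [e, LinearMap.comp_apply, lieForm_smul hX hY, map_add, lieForm_smul hX hY,
        lieForm_smul hX hY, lieForm_delta hX hY, lieForm_delta hX hY, vectorField_jetTh, hVY,
        vectorField_sq hX hY hVX hVY, parity_vectorField_odd hX hY, map_zero]
      simp [neg_smul_form]
  exact LinearMap.congr_fun h w

end LieDerivative

/-! ### One-forms modulo total derivatives. -/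

section NormalForm

variable (U) in
/-- The action of `∂_x` on the coefficient families of one-forms. -/
def coefD : (JetIdx n →₀ DiffPoly U) →ₗ[ℝ] (JetIdx n →₀ DiffPoly U) :=
  Finsupp.mapRange.linearMap (totalD U) + Finsupp.lmapDomain (DiffPoly U) ℝ shift

theorem formD_apply (w : JetForm U) : formD U w = (coefD U w.1, coefD U w.2) := by
  rw [formD_eq]; rfl

theorem shift_injective : Function.Injective (shift : JetIdx n → JetIdx n) := by
  rintro ⟨i, s⟩ ⟨k, t⟩ h
  simpa [shift] using h

theorem coefD_apply_succ (v : JetIdx n →₀ DiffPoly U) (i : Fin n) (s : ℕ) :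
    coefD U v (i, s + 1) = totalD U (v (i, s + 1)) + v (i, s) := by
  have : Finsupp.mapDomain shift v (i, s + 1) = v (i, s) :=
    Finsupp.mapDomain_apply shift_injective v (i, s)
  simp [coefD, this]

theorem coefD_single (j : JetIdx n) (a : DiffPoly U) :
    coefD U (Finsupp.single j a) = Finsupp.single j (totalD U a) + Finsupp.single (shift j) a := by
  simp [coefD, Finsupp.mapRange_single, Finsupp.mapDomain_single]

theorem exists_level_bound {A : Type*} [Zero A] (v : JetIdx n →₀ A) :
    ∃ N, ∀ j, N ≤ j.2 → v j = 0 := by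
  refine ⟨v.support.sup Prod.snd + 1, fun j h => ?_⟩
  by_contra hne
  have := Finset.le_sup (f := Prod.snd) (Finsupp.mem_support_iff.2 hne)
  omega

/-- The coefficient of v at level s is that of ∂_x v at level s + 1 minus ∂_x of the coefficient of
v at level s + 1. Since v has finite support, descending induction on the level recovers v from ∂_x
v. Taking G = 0 gives injectivity, and taking graded pieces gives reflection of degrees. -/
theorem coefD_reflects {G : ℕ → Submodule ℝ (DiffPoly U)}
    (hG : ∀ s, ∀ x ∈ G (s + 1), totalD U x ∈ G s) {v : JetIdx n →₀ DiffPoly U}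
    (hv : ∀ i s, coefD U v (i, s + 1) ∈ G s) (j : JetIdx n) : v j ∈ G j.2 := by
  obtain ⟨N, hN⟩ := exists_level_bound v
  have key : ∀ m s i, N ≤ s + m → v (i, s) ∈ G s := by
    intro m
    induction m with
    | zero => intro s i h; rw [hN _ h]; exact zero_mem _
    | succ m ih =>
      intro s i h
      rw [show v (i, s) = coefD U v (i, s + 1) - totalD U (v (i, s + 1)) by
        rw [coefD_apply_succ]; abel]
      exact sub_mem (hv i s) (hG _ _ (ih (s + 1) i (by omega)))
  exact key N j.2 j.1 (by omega)

/-- Only the levels s + 1 enter. Hence a form concentrated in level zero is a total derivative only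
if it vanishes, so level-zero representatives modulo ∂_x are unique. -/
theorem eq_zero_of_formD {w : JetForm U} (h1 : ∀ i s, (formD U w).1 (i, s + 1) = 0)
    (h2 : ∀ i s, (formD U w).2 (i, s + 1) = 0) : w = 0 := by
  rw [formD_apply] at h1 h2
  refine Prod.ext (Finsupp.ext fun j => ?_) (Finsupp.ext fun j => ?_)
  · exact (Submodule.mem_bot ℝ).1 (coefD_reflects (G := fun _ => ⊥) (by simp) (by simpa using h1) j)
  · exact (Submodule.mem_bot ℝ).1 (coefD_reflects (G := fun _ => ⊥) (by simp) (by simpa using h2) j)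

theorem formD_injective : Function.Injective (formD U) := by
  rw [injective_iff_map_eq_zero]
  intro w hw
  exact eq_zero_of_formD (by simp [hw]) (by simp [hw])

theorem mem_formDeg_of_formD {p d : ℤ} {w : JetForm U} (hw : formD U w ∈ formDeg U p (d + 1)) :
    w ∈ formDeg U p d := by
  rw [formD_apply] at hw
  intro j
  constructor
  · refine coefD_reflects (G := fun s => polyDeg U p (d - s)) (fun s x hx => ?_) (fun i s => ?_) j
    · convert totalD_mem hx using 2; push_cast; ring
    · convert (hw (i, s + 1)).1 using 2; push_cast; ring
  · refine coefD_reflects (G := fun s => polyDeg U (p - 1) (d - s)) (fun s x hx => ?_)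
      (fun i s => ?_) j
    · convert totalD_mem hx using 2; push_cast; ring
    · convert (hw (i, s + 1)).2 using 2; push_cast; ring

theorem formD_mem {p d : ℤ} {w : JetForm U} (hw : w ∈ formDeg U p d) :
    formD U w ∈ formDeg U p (d + 1) := by
  have key : ∀ (p : ℤ) (v : JetIdx n →₀ DiffPoly U), (∀ j, v j ∈ polyDeg U p (d - j.2)) →
      ∀ j, coefD U v j ∈ polyDeg U p (d + 1 - j.2) := by
    intro p v hv
    rintro ⟨i, _ | s⟩
    · have : Finsupp.mapDomain shift v (i, 0) = 0 :=
        Finsupp.mapDomain_of_notMem_range _ _ (by rintro ⟨k, hk⟩; simp [shift] at hk)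
      have h2 : coefD U v (i, 0) = totalD U (v (i, 0)) := by simp [coefD, this]
      rw [h2]
      convert totalD_mem (hv (i, 0)) using 2
      push_cast; ring
    · rw [coefD_apply_succ]
      refine add_mem ?_ ?_
      · convert totalD_mem (hv (i, s + 1)) using 2; push_cast; ring
      · convert hv (i, s) using 2; push_cast; ring
  rw [formD_apply]
  exact fun j => ⟨key p _ (fun k => (hw k).1) j, key (p - 1) _ (fun k => (hw k).2) j⟩

theorem eulerSum_single_self (i : Fin n) (s : ℕ) (a : DiffPoly U) :
    eulerSum U i (Finsupp.single (i, s) a) = ((-totalD U) ^ s) a := by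
  have h : Finsupp.comapDomain (fun s : ℕ => ((i, s) : JetIdx n)) (Finsupp.single (i, s) a)
      (fun _ _ _ _ h => (Prod.ext_iff.1 h).2) = Finsupp.single s a := by
    ext t
    change Finsupp.single (i, s) a (i, t) = Finsupp.single s a t
    simp [Finsupp.single_apply]
  change (Finsupp.comapDomain _ _ _).sum (fun s x => ((-totalD U) ^ s) x) = _
  rw [h]
  simp

theorem eulerSum_single_ne {i k : Fin n} (hik : k ≠ i) (s : ℕ) (a : DiffPoly U) :
    eulerSum U i (Finsupp.single (k, s) a) = 0 := by
  have h : Finsupp.comapDomain (fun s : ℕ => ((i, s) : JetIdx n)) (Finsupp.single (k, s) a)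
      (fun _ _ _ _ h => (Prod.ext_iff.1 h).2) = 0 := by
    ext t
    change Finsupp.single (k, s) a (i, t) = 0
    simp [hik]
  change (Finsupp.comapDomain _ _ _).sum (fun s x => ((-totalD U) ^ s) x) = _
  rw [h]
  simp

/-- Integration by parts lowers the level one step at a time, with a minus sign and a ∂_x on the
coefficient. What accumulates at level zero is the Euler operator. -/
theorem sub_euler_mem_range (c : JetIdx n →₀ DiffPoly U) :
    c - ∑ i, Finsupp.single (i, 0) (eulerSum U i c) ∈ LinearMap.range (coefD U) := by
  induction c using Finsupp.induction_linear with
  | zero => simp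
  | add c d hc hd =>
    convert add_mem hc hd using 1
    simp only [map_add, Finsupp.single_add, Finset.sum_add_distrib]
    abel
  | single j a =>
    obtain ⟨k, s⟩ := j
    rw [Finset.sum_eq_single k (fun i _ h => by
      rw [eulerSum_single_ne h.symm, Finsupp.single_zero]) (by simp), eulerSum_single_self]
    induction s generalizing a with
    | zero => simp
    | succ s ih =>
      have h := sub_mem (LinearMap.mem_range_self (coefD U) (Finsupp.single (k, s) a))
        (ih (totalD U a))
      rw [coefD_single] at h
      convert h using 1
      rw [pow_succ (-totalD U), Module.End.mul_apply, LinearMap.neg_apply, map_neg,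
        Finsupp.single_neg]
      simp only [shift]
      abel

/-- The same integration by parts, now inside the algebra: it turns the action of an evolutionary
field on a density into a pairing with variational derivatives. -/
theorem sub_prolong_mem_range (a : Fin n → DiffPoly U) (c : JetIdx n →₀ DiffPoly U) :
    Finsupp.lsum ℝ (fun j => LinearMap.mulLeft ℝ (prolong U a j)) c - ∑ i, a i * eulerSum U i c ∈
      LinearMap.range (totalD U) := by
  induction c using Finsupp.induction_linear with
  | zero => simp
  | add c d hc hd =>
    convert add_mem hc hd using 1
    simp only [map_add, mul_add, Finset.sum_add_distrib]
    abel
  | single j x =>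
    obtain ⟨k, s⟩ := j
    rw [Finset.sum_eq_single k (fun i _ h => by
      rw [eulerSum_single_ne h.symm, mul_zero]) (by simp), eulerSum_single_self,
      Finsupp.lsum_single, LinearMap.mulLeft_apply]
    induction s generalizing x with
    | zero => simp [prolong]
    | succ s ih =>
      have h := sub_mem (LinearMap.mem_range_self (totalD U) (prolong U a (k, s) * x))
        (ih (totalD U x))
      rw [totalD_mul, totalD_prolong] at h
      convert h using 1
      rw [pow_succ (-totalD U), Module.End.mul_apply, LinearMap.neg_apply, map_neg, mul_neg]
      simp only [shift]
      abel

theorem eulerSum_parity (i : Fin n) (c : JetIdx n →₀ DiffPoly U) :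
    eulerSum U i (Finsupp.mapRange.linearMap (parity U).toLinearMap c) =
      parity U (eulerSum U i c) := by
  induction c using Finsupp.induction_linear with
  | zero => simp
  | add c d hc hd => simp only [map_add, hc, hd]
  | single j x =>
    obtain ⟨k, s⟩ := j
    rw [Finsupp.mapRange.linearMap_apply, Finsupp.mapRange_single]
    by_cases h : k = i
    · subst h
      rw [eulerSum_single_self, eulerSum_single_self]
      induction s generalizing x with
      | zero => rfl
      | succ s ih =>
        rw [pow_succ, Module.End.mul_apply, Module.End.mul_apply, ← ih]
        congr 1
        simp [parity_totalD]
    · rw [eulerSum_single_ne h, eulerSum_single_ne h, map_zero]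

theorem eulerSum_mem {p d : ℤ} (i : Fin n) {c : JetIdx n →₀ DiffPoly U}
    (hc : ∀ j, c j ∈ polyDeg U p (d - j.2)) : eulerSum U i c ∈ polyDeg U p d := by
  change (Finsupp.comapDomain (fun s : ℕ => ((i, s) : JetIdx n)) c _).sum
      (fun s x => ((-totalD U) ^ s) x) ∈ _
  refine sum_mem fun s _ => ?_
  have key : ∀ (s : ℕ) (e : ℤ) (x : DiffPoly U), x ∈ polyDeg U p e →
      ((-totalD U) ^ s) x ∈ polyDeg U p (e + s) := by
    intro s
    induction s with
    | zero => intro e x hx; simpa using hx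
    | succ s ih =>
      intro e x hx
      rw [pow_succ, Module.End.mul_apply]
      have := ih (e + 1) _ (neg_mem (totalD_mem hx))
      rw [LinearMap.neg_apply]
      convert this using 2
      push_cast; ring
  have := key s _ _ (hc (i, s))
  rw [sub_add_cancel] at this
  rwa [Finsupp.comapDomain_apply]

end NormalForm

/-! ### The field D_P and its square. -/

section Hamiltonian

variable {P : LocalFunctional U}

theorem varTh_mem (hP : P ∈ functionalDeg U 2 1) (i : Fin n) : varTh U i P ∈ polyDeg U 1 1 := by
  obtain ⟨f, hf, rfl⟩ := hP
  exact eulerSum_mem i fun j => dTh_mem hf j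

theorem varU_mem (hP : P ∈ functionalDeg U 2 1) (i : Fin n) : varU U i P ∈ polyDeg U 2 1 := by
  obtain ⟨f, hf, rfl⟩ := hP
  exact eulerSum_mem i fun j => dU_mem hf j

variable (P) in
/-- The vector field `D_P` on differential polynomials. -/
def hamD : DiffPoly U →ₗ[ℝ] DiffPoly U :=
  vectorField U (prolong U fun i => varTh U i P) (prolong U fun i => varU U i P)

variable (P) in
theorem formLie_eq : formLie U P =
    lieForm U 1 (prolong U fun i => varTh U i P) (prolong U fun i => varU U i P) := by
  simp [formLie]

theorem parity_prolong_varTh (hP : P ∈ functionalDeg U 2 1) (j : JetIdx n) :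
    parity U (prolong U (fun i => varTh U i P) j) = -prolong U (fun i => varTh U i P) j :=
  parity_one (prolong_mem (fun i => varTh_mem hP i) j)

theorem parity_prolong_varU (hP : P ∈ functionalDeg U 2 1) (j : JetIdx n) :
    parity U (prolong U (fun i => varU U i P) j) = prolong U (fun i => varU U i P) j :=
  parity_two (prolong_mem (fun i => varU_mem hP i) j)

/-- The δP/δu^i are even, so the two terms of the bracket coincide and [P, P] is twice the class of
the first sum. Integration by parts identifies D_P f with the same integrand modulo ∂_x. -/
theorem hamD_integrand_mem_range (hP : P ∈ functionalDeg U 2 1) (hS : schouten U 2 P P = 0)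
    {f : DiffPoly U} (hf : integral U f = P) :
    ∑ i, varTh U i P * varU U i P ∈ LinearMap.range (totalD U) ∧
      hamD P f ∈ LinearMap.range (totalD U) := by
  have h0 : ∑ i, varTh U i P * varU U i P + ∑ i, varTh U i P * varU U i P ∈
      LinearMap.range (totalD U) := by
    have := (Submodule.Quotient.mk_eq_zero _).1 hS
    rw [← Finset.sum_add_distrib]
    convert this using 2 with i
    rw [even_mul_comm U (parity_two (varU_mem hP i)) (varTh U i P)]
    simp
  have h1 : ∑ i, varTh U i P * varU U i P ∈ LinearMap.range (totalD U) := by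
    rw [← two_smul ℝ] at h0
    simpa using Submodule.smul_mem _ (1 / 2 : ℝ) h0
  refine ⟨h1, ?_⟩
  have a := sub_prolong_mem_range (fun i => varTh U i P) (gradU U f)
  have b := sub_prolong_mem_range (fun i => varU U i P) (gradTh U f)
  have e1 : ∀ i, eulerSum U i (gradU U f) = varU U i P := fun i => by rw [← hf]; rfl
  have e2 : ∀ i, eulerSum U i (gradTh U f) = varTh U i P := fun i => by rw [← hf]; rfl
  simp only [e1] at a
  simp only [e2, fun i => even_mul_comm U (parity_two (varU_mem hP i)) (varTh U i P)] at b
  have h := add_mem (add_mem a b) h0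
  convert h using 1
  simp only [hamD, vectorField, LinearMap.add_apply, LinearMap.comp_apply]
  abel

theorem formLie_delta (hP : P ∈ functionalDeg U 2 1) (a : DiffPoly U) :
    formLie U P (delta U a) = delta U (hamD P a) := by
  rw [formLie_eq]
  exact lieForm_delta (parity_prolong_varTh hP) (parity_prolong_varU hP) a

theorem formLie_smul (hP : P ∈ functionalDeg U 2 1) (c : DiffPoly U) (w : JetForm U) :
    formLie U P (c • w) = hamD P c • w + parity U c • formLie U P w := by
  rw [formLie_eq]
  exact lieForm_smul (parity_prolong_varTh hP) (parity_prolong_varU hP) c w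

theorem hamD_jetU (i : Fin n) (s : ℕ) :
    hamD P (jetU U (i, s)) = (totalD U ^ s) (varTh U i P) := vectorField_jetU _ _ _

theorem hamD_jetTh (i : Fin n) (s : ℕ) :
    hamD P (jetTh U (i, s)) = (totalD U ^ s) (varU U i P) := vectorField_jetTh _ _ _

/-- A Hamiltonian vector field with `[P, P] = 0` annihilates its own components. -/
theorem hamD_variational (hP : P ∈ functionalDeg U 2 1) (hS : schouten U 2 P P = 0) (i : Fin n) :
    hamD P (varTh U i P) = 0 ∧ hamD P (varU U i P) = 0 := by
  obtain ⟨f, hf⟩ := Submodule.mkQ_surjective _ P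
  change integral U f = P at hf
  obtain ⟨⟨h, hh⟩, ⟨k, hk⟩⟩ := hamD_integrand_mem_range hP hS hf
  obtain ⟨v1, hv1⟩ := sub_euler_mem_range (gradU U f)
  obtain ⟨v2, hv2⟩ := sub_euler_mem_range
    (Finsupp.mapRange.linearMap (parity U).toLinearMap (gradTh U f))
  have e1 : ∀ i, eulerSum U i (gradU U f) = varU U i P := fun i => by rw [← hf]; rfl
  have e2 : ∀ i, eulerSum U i (gradTh U f) = varTh U i P := fun i => by rw [← hf]; rfl
  simp only [e1] at hv1
  simp only [eulerSum_parity, e2, parity_one (varTh_mem hP _)] at hv2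
  -- The first variation formula: δf is its level-zero Euler form up to a total derivative. The
  -- minus sign appears because δP/δθ_i is odd and stands to the left of δθ_i.
  have hν : delta U f = ∑ i, varU U i P • delta U (jetU U (i, 0)) -
      ∑ i, varTh U i P • delta U (jetTh U (i, 0)) + formD U (v1, v2) := by
    rw [formD_apply, hv1, hv2]
    simp only [delta_jetU, delta_jetTh, Prod.smul_mk, Finsupp.smul_single, smul_zero]
    refine Prod.ext ?_ ?_
    · simp only [Prod.fst_add, Prod.fst_sub, Prod.fst_sum, Finset.sum_const_zero, smul_eq_mul,
        mul_one, sub_zero]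
      rw [add_sub_cancel]; rfl
    · simp only [Prod.snd_add, Prod.snd_sub, Prod.snd_sum, Finset.sum_const_zero, smul_eq_mul,
        mul_one, Finsupp.single_neg, Finset.sum_neg_distrib, sub_neg_eq_add]
      rw [zero_sub, add_comm, add_assoc, add_neg_cancel, add_zero]; rfl
  have hLν := congrArg (formLie U P) hν
  simp only [formLie_delta hP, map_add, map_sub, map_sum, formLie_smul hP, formLie_formD,
    hamD_jetU, hamD_jetTh, pow_zero, Module.End.one_apply, parity_one (varTh_mem hP _),
    parity_two (varU_mem hP _), ← hk, ← formD_delta, Finset.sum_add_distrib, neg_smul_form,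
    Finset.sum_neg_distrib] at hLν
  -- In the Lie derivative of the Euler form, the terms where δu^i and δθ_i are replaced add up to
  -- δ(∑ δP/δθ_i · δP/δu^i). By [P, P] = 0 this is a total derivative.
  have hT : ∑ i, varU U i P • delta U (varTh U i P) + ∑ i, varTh U i P • delta U (varU U i P) =
      formD U (delta U h) := by
    rw [formD_delta, hh, map_sum, ← Finset.sum_add_distrib]
    exact Finset.sum_congr rfl fun i _ => by
      rw [delta_odd_mul (parity_one (varTh_mem hP i)), parity_two (varU_mem hP i)]
  -- The terms left over have the coefficients D_P(δP/δu^i) and -D_P(δP/δθ_i) at level zero. Being a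
  -- total derivative, they vanish by `eq_zero_of_formD`.
  have hfin : formD U (delta U k - formLie U P (v1, v2) - delta U h) =
      ∑ i, hamD P (varU U i P) • delta U (jetU U (i, 0)) -
        ∑ i, hamD P (varTh U i P) • delta U (jetTh U (i, 0)) := by
    rw [map_sub, map_sub, hLν, ← hT]
    abel
  simp only [delta_jetU, delta_jetTh, Prod.smul_mk, Finsupp.smul_single, smul_zero, smul_eq_mul,
    mul_one] at hfin
  have hz := eq_zero_of_formD (w := delta U k - formLie U P (v1, v2) - delta U h)
    (fun i s => by rw [hfin]; simp [Prod.fst_sum, Finsupp.finsetSum_apply])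
    (fun i s => by rw [hfin]; simp [Prod.snd_sum])
  rw [hz, map_zero] at hfin
  constructor
  · have := DFunLike.congr_fun (congrArg Prod.snd hfin) (i, 0)
    simpa [Prod.snd_sum, Finsupp.finsetSum_apply, Finsupp.single_apply] using this
  · have := DFunLike.congr_fun (congrArg Prod.fst hfin) (i, 0)
    simpa [Prod.fst_sum, Finsupp.finsetSum_apply, Finsupp.single_apply] using this.symm

theorem hamD_totalD (a : DiffPoly U) : hamD P (totalD U a) = totalD U (hamD P a) :=
  vectorField_totalD U _ _ a

theorem hamD_totalD_pow (s : ℕ) (a : DiffPoly U) :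
    hamD P ((totalD U ^ s) a) = (totalD U ^ s) (hamD P a) := by
  induction s with
  | zero => rfl
  | succ s ih => rw [pow_succ', Module.End.mul_apply, hamD_totalD, ih, Module.End.mul_apply]

theorem formLie_formLie (hP : P ∈ functionalDeg U 2 1) (hS : schouten U 2 P P = 0)
    (w : JetForm U) : formLie U P (formLie U P w) = 0 := by
  rw [formLie_eq]
  refine lieForm_sq (parity_prolong_varTh hP) (parity_prolong_varU hP) (fun j => ?_) (fun j => ?_) w
  · exact (hamD_totalD_pow j.2 _).trans (by rw [(hamD_variational hP hS j.1).1, map_zero])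
  · exact (hamD_totalD_pow j.2 _).trans (by rw [(hamD_variational hP hS j.1).2, map_zero])

end Hamiltonian

end VarHam
end

noncomputable section
namespace VarHam
variable {n : ℕ} {U : TopologicalSpace.Opens (Fin n → ℝ)}

/-! ### Invertible matrices of smooth functions. -/

section Invertibility

theorem isUnit_smoothFun {f : SmoothFun U} (hf : ∀ x, f.1 x ≠ 0) : IsUnit f := by
  have hmem : (fun x => (f.1 x)⁻¹) ∈ SmoothFun U := by
    have h : ContDiffOn ℝ ∞ (fun x => (Function.extend Subtype.val f.1 0 x)⁻¹)
        (U : Set (Fin n → ℝ)) :=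
      ContDiffOn.inv f.2 fun x hx => by rw [extend_val U _ hx]; exact hf _
    exact h.congr fun x hx => by rw [extend_val U _ hx, extend_val U _ hx]
  exact IsUnit.of_mul_eq_one ⟨_, hmem⟩ (Subtype.ext (funext fun x => mul_inv_cancel₀ (hf x)))

theorem exists_inverse_matrix {g : Fin n → Fin n → SmoothFun U}
    (hg : ∀ x : U, (Matrix.of fun i j => (g i j).1 x).det ≠ 0) :
    ∃ h : Fin n → Fin n → SmoothFun U, (∀ i j, ∑ k, g i k * h k j = if i = j then 1 else 0) ∧
      ∀ i j, ∑ k, h i k * g k j = if i = j then 1 else 0 := by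
  have hdet : IsUnit (Matrix.of g).det := isUnit_smoothFun fun x => by
    let ev : SmoothFun U →+* ℝ := (Pi.evalRingHom (fun _ : U => ℝ) x).comp (SmoothFun U).val
    have : ev (Matrix.of g).det = (Matrix.of fun i j => (g i j).1 x).det := by
      rw [RingHom.map_det]; rfl
    intro h0
    exact hg x (this.symm.trans h0)
  refine ⟨fun i j => (Matrix.of g)⁻¹ i j, fun i j => ?_, fun i j => ?_⟩
  · have := congrFun (congrFun (Matrix.mul_nonsing_inv _ hdet) i) j
    rwa [Matrix.mul_apply, Matrix.one_apply] at this
  · have := congrFun (congrFun (Matrix.nonsing_inv_mul _ hdet) i) j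
    rwa [Matrix.mul_apply, Matrix.one_apply] at this

end Invertibility

/-! ### Euler identities in low degree. -/

section Euler

theorem dU_eq_zero_of_lt {p d : ℤ} {a : DiffPoly U} (ha : a ∈ polyDeg U p d) {j : JetIdx n}
    (hj : d < j.2) : dU U j a = 0 :=
  eq_zero_of_mem_polyDeg (Or.inr (by omega)) (dU_mem ha j)

theorem dTh_eq_zero_of_lt {p d : ℤ} {a : DiffPoly U} (ha : a ∈ polyDeg U p d) {j : JetIdx n}
    (hj : d < j.2) : dTh U j a = 0 :=
  eq_zero_of_mem_polyDeg (Or.inr (by omega)) (dTh_mem ha j)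

/-- Euler's identity for the x-degree. Variables of level zero have weight zero, those of level one
weight one, and higher levels cannot occur in degree one. -/
theorem euler_degree_one {p : ℤ} {a : DiffPoly U} (ha : a ∈ polyDeg U p 1) :
    a = ∑ i, (jetU U (i, 1) * dU U (i, 1) a + jetTh U (i, 1) * dTh U (i, 1) a) := by
  classical
  have h := weightField_of_mem 1 0 ha
  rw [vectorField_eq_sum U _ _ _ (Finset.univ ×ˢ {0, 1})] at h
  · rw [Finset.sum_product] at h
    simpa using h.symm
  · rintro ⟨i, s⟩ hs
    refine dU_eq_zero_of_lt ha ?_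
    simp at hs ⊢
    omega
  · rintro ⟨i, s⟩ hs
    refine dTh_eq_zero_of_lt ha ?_
    simp at hs ⊢
    omega

theorem gradTh_sum_of_mem {d : ℤ} {a : DiffPoly U} (ha : a ∈ polyDeg U 1 d) :
    a = (gradTh U a).sum fun j c => c * jetTh U j := by
  obtain ⟨S, hS'⟩ := exists_support U [a]
  have hS := hS' a (by simp)
  have h := weightField_of_mem 0 1 ha
  rw [vectorField_eq_sum U _ _ _ S (fun j h => (hS j h).1) (fun j h => (hS j h).2)] at h
  rw [Finsupp.sum_of_support_subset (s := S) _ (fun k hk => by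
      by_contra hne
      exact (Finsupp.mem_support_iff.1 hk) (hS k hne).2) _ (by simp)]
  have hj : ∀ j, gradTh U a j * jetTh U j = jetTh U j * dTh U j a := fun j => by
    have := dTh_mem ha j
    rw [sub_self] at this
    rw [gradTh_apply, even_mul_comm U (parity_zero this)]
  simp only [hj]
  simpa using h.symm

theorem exists_coeff_of_mem {a : DiffPoly U} (ha : a ∈ polyDeg U 1 0) :
    ∃ c : Fin n → SmoothFun U, a = ∑ i, ofFun U (c i) * jetTh U (i, 0) := by
  classical
  have h1 : ∀ i : Fin n, ∃ f, dTh U (i, 0) a = ofFun U f := fun i =>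
    mem_polyDeg_zero (by simpa using dTh_mem ha (i, 0))
  choose c hc using h1
  refine ⟨c, ?_⟩
  conv_lhs => rw [gradTh_sum_of_mem ha]
  rw [Finsupp.sum_of_support_subset (s := Finset.univ ×ˢ {0}) _ ?_ _ (by simp), Finset.sum_product]
  · simp [gradTh_apply, hc]
  · rintro ⟨i, s⟩ hk
    simp only [Finset.mem_product, Finset.mem_univ, Finset.mem_singleton, true_and]
    by_contra hne
    exact (Finsupp.mem_support_iff.1 hk)
      (dTh_eq_zero_of_lt (j := (i, s)) ha (by simp only; omega))

end Euler

/-! ### The flat connection of a Hamiltonian structure of hydrodynamic type. -/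

section Hydro

variable {P : LocalFunctional U}

/-- The variable θ_k^1 arises twice in δP/δθ_i: from ∂f/∂θ_i with coefficient g^{ik}, and from
-∂_x(∂f/∂θ_i^1) with coefficient g^{ki}. Symmetry of g makes them equal and the prefactor 1/2
compensates. The Γ terms contain no θ^1 and are not differentiated by ∂_x. -/
theorem hydro_dTh_varTh {g : Fin n → Fin n → SmoothFun U} {Γ : Fin n → Fin n → Fin n → SmoothFun U}
    (hg : ∀ i j, g i j = g j i) (i k : Fin n) :
    dTh U (k, 1) (varTh U i (hydroFunctional U g Γ)) = ofFun U (g i k) := by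
  classical
  set F : DiffPoly U := ∑ i, ∑ j, (ofFun U (g i j) * jetTh U (i, 0) * jetTh U (j, 1) +
    ∑ k, ofFun U (Γ i j k) * jetU U (k, 1) * jetTh U (i, 0) * jetTh U (j, 0)) with hF
  have hFm : F ∈ polyDeg U 2 1 := by
    refine sum_mem fun i _ => sum_mem fun j _ => add_mem ?_ (sum_mem fun k _ => ?_)
    · exact mul_mem_polyDeg' (mul_mem_polyDeg (ofFun_mem _) (jetTh_mem _)) (jetTh_mem _)
        (by norm_num) (by norm_num)
    · exact mul_mem_polyDeg' (mul_mem_polyDeg (mul_mem_polyDeg (ofFun_mem _) (jetU_mem _))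
        (jetTh_mem _)) (jetTh_mem _) (by norm_num) (by norm_num)
  have h1 : ∀ k, dTh U (k, 1) F = -∑ a, ofFun U (g a k) * jetTh U (a, 0) := by
    intro k
    simp only [hF, map_sum, map_add, dTh_mul, dTh_ofFun, dTh_jetTh, dTh_jetU, map_mul, parity_ofFun,
      parity_jetTh, ← Finset.sum_neg_distrib]
    refine Finset.sum_congr rfl fun a _ => ?_
    rw [Finset.sum_eq_single k]
    · simp
    · intro b _ hb
      simp [hb.symm]
    · simp
  have h2 : ∀ i k, dTh U (i, 0) (dTh U (k, 1) F) = -ofFun U (g i k) := by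
    intro i k
    rw [h1, map_neg, map_sum, Finset.sum_eq_single i]
    · simp [dTh_mul, dTh_ofFun, dTh_jetTh, parity_ofFun]
    · intro a _ ha
      simp [dTh_mul, dTh_ofFun, dTh_jetTh, ha.symm]
    · simp
  have h3 : eulerSum U i (gradTh U F) = dTh U (i, 0) F - totalD U (dTh U (i, 1) F) := by
    change (Finsupp.comapDomain (fun s : ℕ => ((i, s) : JetIdx n)) (gradTh U F) _).sum
      (fun s x => ((-totalD U) ^ s) x) = _
    rw [Finsupp.sum_of_support_subset (s := Finset.range 2) _ (fun s hs => ?_) _ (by simp),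
      Finset.sum_range_succ, Finset.sum_range_one]
    · simp only [pow_zero, pow_one, Module.End.one_apply, LinearMap.neg_apply, ← sub_eq_add_neg]
      rfl
    · rw [Finset.mem_range]
      by_contra h
      exact (Finsupp.mem_support_iff.1 hs) (dTh_eq_zero_of_lt hFm (j := (i, s))
        (by simp only; omega))
  have h4 : varTh U i (hydroFunctional U g Γ) = (1 / 2 : ℝ) • eulerSum U i (gradTh U F) := by
    rw [hydroFunctional, map_smul]; rfl
  have h5 : dTh U (k, 1) (dTh U (i, 1) F) = 0 :=
    eq_zero_of_mem_polyDeg (Or.inr (by norm_num)) (dTh_mem (dTh_mem hFm (i, 1)) (k, 1))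
  rw [h4, h3, map_smul, map_sub, dTh_dTh, h2, dTh_succ_totalD, h5, map_zero, zero_add, h2, hg k i,
    neg_neg, sub_neg_eq_add, ← two_smul ℝ, smul_smul]
  norm_num

theorem hamD_mul (hP : P ∈ functionalDeg U 2 1) (a b : DiffPoly U) :
    hamD P (a * b) = hamD P a * b + parity U a * hamD P b :=
  vectorField_mul_odd (parity_prolong_varTh hP) (parity_prolong_varU hP) a b

theorem hamD_ofFun (f : SmoothFun U) :
    hamD P (ofFun U f) = ∑ i, varTh U i P * ofFun U (coordPartial U i f) :=
  vectorField_ofFun _ _ f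

theorem hamD_mem (hP : P ∈ functionalDeg U 2 1) {p d : ℤ} {a : DiffPoly U}
    (ha : a ∈ polyDeg U p d) : hamD P a ∈ polyDeg U (p + 1) (d + 1) := by
  refine derivation_mem_polyDeg (s := parity U) (fun _ _ _ => parity_mem) (hamD_mul hP)
    (fun f => ?_) (fun j => ?_) (fun j => ?_) ha
  · rw [hamD_ofFun]
    exact sum_mem fun i _ => mul_mem_polyDeg' (varTh_mem hP i) (ofFun_mem _) (by norm_num)
      (by norm_num)
  · obtain ⟨i, s⟩ := j
    rw [hamD_jetU]
    exact totalD_pow_mem (varTh_mem hP i) s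
  · obtain ⟨i, s⟩ := j
    rw [hamD_jetTh]
    exact totalD_pow_mem (varU_mem hP i) s

theorem dTh_two_totalD {p : ℤ} {a : DiffPoly U} (ha : a ∈ polyDeg U p 1) (k : Fin n) :
    dTh U (k, 2) (totalD U a) = dTh U (k, 1) a := by
  rw [dTh_succ_totalD, dTh_eq_zero_of_lt ha (by norm_num), map_zero, zero_add]

/-- Contraction with the dual of the odd coordinate `δP/δθ_r`. -/
def nablaTh (h : Fin n → Fin n → SmoothFun U) (r : Fin n) : DiffPoly U →ₗ[ℝ] DiffPoly U :=
  ∑ b, LinearMap.mulLeft ℝ (ofFun U (h b r)) ∘ₗ dTh U (b, 1)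

theorem nablaTh_apply (h : Fin n → Fin n → SmoothFun U) (r : Fin n) (a : DiffPoly U) :
    nablaTh h r a = ∑ b, ofFun U (h b r) * dTh U (b, 1) a := by
  simp [nablaTh]

theorem nablaTh_mul_of_mem (h : Fin n → Fin n → SmoothFun U) (r : Fin n) {a : DiffPoly U}
    (ha : a ∈ polyDeg U 1 0) (b : DiffPoly U) : nablaTh h r (a * b) = -(a * nablaTh h r b) := by
  rw [nablaTh_apply, nablaTh_apply, Finset.mul_sum, ← Finset.sum_neg_distrib]
  refine Finset.sum_congr rfl fun k _ => ?_
  rw [dTh_mul, dTh_eq_zero_of_lt ha (by norm_num), parity_one ha, zero_mul, zero_add, neg_mul,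
    mul_neg, ← mul_assoc, ← mul_assoc, ofFun_mul_comm]

/-- The matrix `g` of a Hamiltonian structure of hydrodynamic type and its inverse `h`. -/
structure HydroMetric (P : LocalFunctional U) (g h : Fin n → Fin n → SmoothFun U) : Prop where
  dTh_varTh : ∀ i k, dTh U (k, 1) (varTh U i P) = ofFun U (g i k)
  mul_inv : ∀ i j, ∑ k, g i k * h k j = if i = j then 1 else 0
  inv_mul : ∀ i j, ∑ k, h i k * g k j = if i = j then 1 else 0

theorem IsHydroHamiltonian.exists_metric (hP : IsHydroHamiltonian U P) :
    ∃ g h, HydroMetric P g h := by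
  obtain ⟨g, Γ, hsymm, hdet, rfl⟩ := hP.nondegenerate
  obtain ⟨h, h1, h2⟩ := exists_inverse_matrix hdet
  exact ⟨g, h, hydro_dTh_varTh hsymm, h1, h2⟩

variable {g h : Fin n → Fin n → SmoothFun U}

theorem HydroMetric.nablaTh_varTh (H : HydroMetric P g h) (r m : Fin n) :
    nablaTh h r (varTh U m P) = if m = r then 1 else 0 := by
  rw [nablaTh_apply]
  simp only [H.dTh_varTh]
  rw [show ∑ b, ofFun U (h b r) * ofFun U (g m b) = ofFun U (∑ b, g m b * h b r) by
    rw [ofFun_sum]; exact Finset.sum_congr rfl fun b _ => by rw [← ofFun_mul, mul_comm]]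
  rw [H.mul_inv]
  split_ifs
  · exact ofFun_one U
  · exact ofFun_zero U

theorem HydroMetric.nablaTh_varTh_mul (hP : P ∈ functionalDeg U 2 1) (H : HydroMetric P g h)
    (s r m : Fin n) : nablaTh h s (varTh U r P * varTh U m P) =
      (if r = s then varTh U m P else 0) - if m = s then varTh U r P else 0 := by
  have : nablaTh h s (varTh U r P * varTh U m P) =
      nablaTh h s (varTh U r P) * varTh U m P - varTh U r P * nablaTh h s (varTh U m P) := by
    simp only [nablaTh_apply, Finset.sum_mul, Finset.mul_sum, ← Finset.sum_sub_distrib]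
    refine Finset.sum_congr rfl fun k _ => ?_
    rw [dTh_mul, parity_one (varTh_mem hP r), mul_add, neg_mul, mul_neg, ← sub_eq_add_neg,
      ← mul_assoc, ← mul_assoc (ofFun U _), ofFun_mul_comm U (h k s) (varTh U r P), mul_assoc]
    simp only [mul_assoc]
  rw [this, H.nablaTh_varTh, H.nablaTh_varTh]
  split_ifs <;> simp

theorem sum_ofFun_mul_sum (h : Fin n → Fin n → SmoothFun U) (g : Fin n → Fin n → SmoothFun U)
    (hgh : ∀ i j, ∑ k, h i k * g k j = if i = j then 1 else 0) (x : Fin n → DiffPoly U)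
    (i : Fin n) : ∑ k, ofFun U (h i k) * ∑ j, ofFun U (g k j) * x j = x i := by
  simp only [Finset.mul_sum, ← mul_assoc, ← ofFun_mul]
  rw [Finset.sum_comm]
  simp only [← Finset.sum_mul, ← ofFun_sum, hgh]
  rw [Finset.sum_eq_single i]
  · simp [ofFun_one]
  · intro j _ hj; simp [hj.symm, ofFun_zero]
  · simp

/-- By the Euler identity δP/δθ_m is the sum of g^{mj} θ_j^1 and terms with a factor u^{q,1}.
Inverting g lets the δP/δθ_m serve as odd coordinates in place of the θ_j^1. -/
theorem HydroMetric.jetTh_one (hP : P ∈ functionalDeg U 2 1) (H : HydroMetric P g h) (j : Fin n) :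
    jetTh U (j, 1) = ∑ m, ofFun U (h j m) *
      (varTh U m P - ∑ q, jetU U (q, 1) * dU U (q, 1) (varTh U m P)) := by
  have h1 : ∀ m, varTh U m P - ∑ q, jetU U (q, 1) * dU U (q, 1) (varTh U m P) =
      ∑ j, ofFun U (g m j) * jetTh U (j, 1) := by
    intro m
    conv_lhs => enter [1]; rw [euler_degree_one (varTh_mem hP m)]
    rw [Finset.sum_add_distrib, add_sub_cancel_left]
    exact Finset.sum_congr rfl fun j _ => by rw [H.dTh_varTh, ofFun_mul_comm]
  simp only [h1]
  exact (sum_ofFun_mul_sum h g H.inv_mul (fun j => jetTh U (j, 1)) j).symm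

/-- The components of `D_P θ_k` with respect to the odd coordinates `δP/δθ_m`. -/
theorem HydroMetric.exists_expansion (hP : P ∈ functionalDeg U 2 1) (H : HydroMetric P g h)
    (k : Fin n) : ∃ (β W : Fin n → DiffPoly U), (∀ m, β m ∈ polyDeg U 1 0) ∧
      (∀ m, W m ∈ polyDeg U 2 0) ∧
      varU U k P = ∑ m, β m * varTh U m P + ∑ q, jetU U (q, 1) * W q := by
  have hd : ∀ j, dTh U (j, 1) (varU U k P) ∈ polyDeg U 1 0 := fun j => by
    simpa using dTh_mem (varU_mem hP k) (j, 1)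
  have hdU : ∀ q, dU U (q, 1) (varU U k P) ∈ polyDeg U 2 0 := fun q => by
    simpa using dU_mem (varU_mem hP k) (q, 1)
  have hdU' : ∀ m q, dU U (q, 1) (varTh U m P) ∈ polyDeg U 1 0 := fun m q => by
    simpa using dU_mem (varTh_mem hP m) (q, 1)
  -- Both witnesses come from inserting `HydroMetric.jetTh_one` into the Euler identity for δP/δu^k.
  -- The minus sign in β is the cost of moving the odd δP/δθ_m to the right.
  refine ⟨fun m => -∑ j, ofFun U (h j m) * dTh U (j, 1) (varU U k P),
    fun q => dU U (q, 1) (varU U k P) - ∑ j, ∑ m, ofFun U (h j m) *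
      (dU U (q, 1) (varTh U m P) * dTh U (j, 1) (varU U k P)), fun m => ?_, fun q => ?_, ?_⟩
  · exact neg_mem (sum_mem fun j _ => mul_mem_polyDeg' (ofFun_mem _) (hd j) (by norm_num)
      (by norm_num))
  · refine sub_mem (hdU q) (sum_mem fun j _ => sum_mem fun m _ => mul_mem_polyDeg' (ofFun_mem _)
      (mul_mem_polyDeg (hdU' m q) (hd j)) (by norm_num) (by norm_num))
  · conv_lhs => rw [euler_degree_one (varU_mem hP k)]
    have e : ∀ j, jetTh U (j, 1) * dTh U (j, 1) (varU U k P) =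
        (∑ m, (-(ofFun U (h j m) * dTh U (j, 1) (varU U k P))) * varTh U m P) -
        ∑ q, jetU U (q, 1) * ∑ m, ofFun U (h j m) *
          (dU U (q, 1) (varTh U m P) * dTh U (j, 1) (varU U k P)) := by
      intro j
      conv_lhs => enter [1]; rw [H.jetTh_one hP j]
      simp only [Finset.sum_mul, Finset.mul_sum, sub_mul, mul_sub, Finset.sum_sub_distrib]
      congr 1
      · refine Finset.sum_congr rfl fun m _ => ?_
        rw [mul_assoc, odd_mul_comm U (parity_one (varTh_mem hP m)), parity_one (hd j), neg_mul,
          neg_mul, mul_neg, mul_assoc]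
      · rw [Finset.sum_comm]
        refine Finset.sum_congr rfl fun q _ => Finset.sum_congr rfl fun m _ => ?_
        rw [← mul_assoc (ofFun U _), ofFun_mul_comm, mul_assoc, mul_assoc]
    rw [Finset.sum_add_distrib, Finset.sum_congr rfl fun j _ => e j, Finset.sum_sub_distrib]
    simp only [mul_sub, Finset.sum_sub_distrib]
    rw [Finset.sum_comm (γ := Fin n) (f := fun j m =>
      -(ofFun U (h j m) * dTh U (j, 1) (varU U k P)) * varTh U m P)]
    simp only [← Finset.sum_mul, Finset.sum_neg_distrib]
    rw [Finset.sum_comm (γ := Fin n) (f := fun j q => jetU U (q, 1) * ∑ m, ofFun U (h j m) *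
          (dU U (q, 1) (varTh U m P) * dTh U (j, 1) (varU U k P)))]
    simp only [← Finset.mul_sum]
    abel

/-- The u^{q,1} terms W_q of the expansion vanish because D_P annihilates δP/δu^k. Then D_P θ_k is
linear in the δP/δθ_m, with coefficients linear in θ_i, which defines B. -/
theorem HydroMetric.exists_connection (hP : P ∈ functionalDeg U 2 1)
    (hS : schouten U 2 P P = 0) (H : HydroMetric P g h) :
    ∃ B : Fin n → Fin n → Fin n → SmoothFun U,
      ∀ k, varU U k P = ∑ m, (∑ i, ofFun U (B k m i) * jetTh U (i, 0)) * varTh U m P := by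
  have main : ∀ k, ∃ b : Fin n → Fin n → SmoothFun U,
      varU U k P = ∑ m, (∑ i, ofFun U (b m i) * jetTh U (i, 0)) * varTh U m P := by
    intro k
    obtain ⟨β, W, hβ, hW, hk⟩ := H.exists_expansion hP k
    have h0 : ∀ m, ∑ q, ofFun U (g q m) * W q = 0 := by
      intro m
      have hD := (hamD_variational hP hS k).2
      rw [hk, map_add, map_sum, map_sum] at hD
      -- Variables of level two enter D_P(δP/δu^k) only through D_P u^{q,1} = ∂_x(δP/δθ_q), where
      -- θ_m^2 has coefficient g^{qm}. This isolates ∑ g^{qm} W_q.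
      have hD2 := congrArg (dTh U (m, 2)) hD
      rw [map_zero, map_add, map_sum, map_sum, Finset.sum_eq_zero, zero_add] at hD2
      · rw [← hD2]
        refine Finset.sum_congr rfl fun q _ => ?_
        rw [hamD_mul hP, hamD_jetU, pow_one, parity_jetU, map_add, dTh_mul, dTh_mul,
          dTh_two_totalD (varTh_mem hP q), H.dTh_varTh, dTh_jetU,
          dTh_eq_zero_of_lt (hW q) (by norm_num),
          dTh_eq_zero_of_lt (hamD_mem hP (hW q)) (by norm_num)]
        simp
      · intro r _
        rw [hamD_mul hP, (hamD_variational hP hS r).1, mul_zero, add_zero, dTh_mul,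
          dTh_eq_zero_of_lt (hamD_mem hP (hβ r)) (by norm_num),
          dTh_eq_zero_of_lt (varTh_mem hP r) (by norm_num)]
        simp
    have hW0 : ∀ q, W q = 0 := by
      intro q
      have := sum_ofFun_mul_sum (fun i j => h j i) (fun i j => g j i) (fun i j => by
        have := H.mul_inv j i
        simp only [eq_comm (a := j)] at this
        rw [← this]
        exact Finset.sum_congr rfl fun k _ => mul_comm _ _) W q
      rw [← this]
      simp [h0]
    choose b hb using fun m => exists_coeff_of_mem (hβ m)
    refine ⟨b, ?_⟩
    rw [hk]
    simp [hW0, ← hb]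
  choose B hB using main
  exact ⟨B, hB⟩

/-- The connection of a Hamiltonian structure of hydrodynamic type is flat. -/
theorem HydroMetric.connection_flat (hP : P ∈ functionalDeg U 2 1)
    (hS : schouten U 2 P P = 0) (H : HydroMetric P g h)
    {B : Fin n → Fin n → Fin n → SmoothFun U}
    (hB : ∀ k, varU U k P = ∑ m, (∑ i, ofFun U (B k m i) * jetTh U (i, 0)) * varTh U m P)
    (k s t j : Fin n) : coordPartial U s (B k t j) - coordPartial U t (B k s j) =
      ∑ i, B k t i * B i s j - ∑ i, B k s i * B i t j := by
  -- For β_m the coefficient of δP/δθ_m in D_P θ_k, one has D_P β_m = ∑ γ_{mr} δP/δθ_r, and Q holds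
  -- the coefficients of γ. Its antisymmetric part in m, r is the curvature.
  let Q : Fin n → Fin n → Fin n → SmoothFun U := fun m r j =>
    ∑ i, B k m i * B i r j - coordPartial U r (B k m j)
  let γ : Fin n → Fin n → DiffPoly U := fun m r => ∑ j, ofFun U (Q m r j) * jetTh U (j, 0)
  have hγ : ∀ m r, γ m r ∈ polyDeg U 1 0 := fun m r => sum_mem fun j _ =>
    mul_mem_polyDeg' (ofFun_mem _) (jetTh_mem _) (by norm_num) (by norm_num)
  have hDβ : ∀ m, hamD P (∑ i, ofFun U (B k m i) * jetTh U (i, 0)) =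
      ∑ r, γ m r * varTh U r P := by
    intro m
    have e1 : ∀ i, hamD P (ofFun U (B k m i) * jetTh U (i, 0)) =
        ∑ r, (-(ofFun U (coordPartial U r (B k m i)) * jetTh U (i, 0)) +
          ∑ j, ofFun U (B k m i * B i r j) * jetTh U (j, 0)) * varTh U r P := by
      intro i
      rw [hamD_mul hP, hamD_ofFun, hamD_jetTh, pow_zero, Module.End.one_apply, parity_ofFun, hB i,
        Finset.sum_mul, Finset.mul_sum, ← Finset.sum_add_distrib]
      refine Finset.sum_congr rfl fun r _ => ?_
      rw [add_mul, ← ofFun_mul_comm, mul_assoc, odd_mul_comm U (parity_one (varTh_mem hP r)),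
        parity_jetTh, neg_mul, neg_mul, mul_neg, mul_assoc, ← mul_assoc _ _ (varTh U r P),
        ← mul_assoc (ofFun U (B k m i)), Finset.mul_sum]
      congr 2
      exact Finset.sum_congr rfl fun j _ => by rw [ofFun_mul, mul_assoc]
    rw [map_sum, Finset.sum_congr rfl fun i _ => e1 i, Finset.sum_comm]
    refine Finset.sum_congr rfl fun r _ => ?_
    rw [← Finset.sum_mul, Finset.sum_add_distrib, Finset.sum_comm]
    congr 1
    rw [← Finset.sum_add_distrib]
    refine Finset.sum_congr rfl fun j _ => ?_
    rw [← Finset.sum_mul, ← ofFun_sum]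
    simp only [Q, sub_eq_add_neg, ofFun_add, add_mul]
    rw [add_comm, show ofFun U (-coordPartial U r (B k m j)) =
      -ofFun U (coordPartial U r (B k m j)) from map_neg (ofFunHom U) _, neg_mul]
  have hD : ∑ m, ∑ r, γ m r * (varTh U r P * varTh U m P) = 0 := by
    rw [← (hamD_variational hP hS k).2, hB k, map_sum]
    refine Finset.sum_congr rfl fun m _ => ?_
    rw [hamD_mul hP, (hamD_variational hP hS m).1, mul_zero, add_zero, hDβ, Finset.sum_mul]
    simp only [mul_assoc]
  -- The relation ∑ γ_{mr} δP/δθ_r δP/δθ_m = 0 only sees the antisymmetric part of γ. Contracting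
  -- with the duals of δP/δθ_s and δP/δθ_t in turn shows that this part is zero.
  have h1 : ∀ s, ∑ m, (γ m s - γ s m) * varTh U m P = 0 := by
    intro s
    have := congrArg (nablaTh h s) hD
    simp only [map_sum, nablaTh_mul_of_mem h s (hγ _ _), H.nablaTh_varTh_mul hP, map_zero,
      Finset.sum_neg_distrib, neg_eq_zero, mul_sub, Finset.sum_sub_distrib, mul_ite, mul_zero] at this
    rw [Finset.sum_congr rfl fun m _ => Finset.sum_ite_eq' Finset.univ s _, Finset.sum_comm
      (f := fun m r => if m = s then γ m r * varTh U r P else 0),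
      Finset.sum_congr (f := fun r => ∑ m, if m = s then γ m r * varTh U r P else 0) rfl
        fun m _ => Finset.sum_ite_eq' Finset.univ s _] at this
    simpa [sub_mul] using this
  have h2 : ∀ s t, γ t s = γ s t := by
    intro s t
    have := congrArg (nablaTh h t) (h1 s)
    simp only [map_sum, nablaTh_mul_of_mem h t (sub_mem (hγ _ _) (hγ _ _)), H.nablaTh_varTh,
      map_zero, Finset.sum_neg_distrib, neg_eq_zero, mul_ite, mul_zero, mul_one,
      Finset.sum_ite_eq', Finset.mem_univ, if_true] at this
    exact sub_eq_zero.1 this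
  have h3 : ∀ m r j, dTh U (j, 0) (γ m r) = ofFun U (Q m r j) := by
    intro m r j
    simp only [γ, map_sum]
    rw [Finset.sum_eq_single j]
    · simp [dTh_mul, dTh_ofFun, dTh_jetTh, parity_ofFun]
    · intro a _ ha
      simp [dTh_mul, dTh_ofFun, dTh_jetTh, ha.symm]
    · simp
  have h4 : Q t s j = Q s t j := ofFun_injective U (by rw [← h3, h2, h3])
  simp only [Q] at h4
  linear_combination -h4

end Hydro

end VarHam
end

noncomputable section
namespace VarHam
variable {n : ℕ} {U : TopologicalSpace.Opens (Fin n → ℝ)}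

/-! ### Integrals along the segments from the centre of a star-shaped set. -/

section RayIntegral

/-- The point at time `t` on the segment from `c` to `x`. -/
def ray {E : Type*} [AddCommGroup E] [Module ℝ E] (c : E) (t : ℝ) (x : E) : E := c + t • (x - c)

variable {E : Type} [NormedAddCommGroup E] [NormedSpace ℝ E] {c : E} {S : Set E}

theorem ray_mem (hS : StarConvex ℝ c S) {x : E} (hx : x ∈ S) {t : ℝ} (ht : t ∈ Set.Icc (0 : ℝ) 1) :
    ray c t x ∈ S := hS.add_smul_sub_mem hx ht.1 ht.2

theorem ray_ray (s t : ℝ) (x : E) : ray c s (ray c t x) = ray c (t * s) x := by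
  simp only [ray, add_sub_cancel_left, smul_smul, mul_comm]

theorem continuous_ray : Continuous fun p : ℝ × E => ray c p.1 p.2 := by
  unfold ray; fun_prop

theorem hasFDerivAt_ray (t : ℝ) (x : E) :
    HasFDerivAt (ray c t) (t • ContinuousLinearMap.id ℝ E) x := by
  unfold ray
  exact (((hasFDerivAt_id x).sub_const c).const_smul t).const_add c

/-- The segments from `c` to the points near `x` lie in a compact subset of `S`. -/
theorem exists_compact_rays [FiniteDimensional ℝ E] (hS : StarConvex ℝ c S) (hO : IsOpen S)
    {x : E} (hx : x ∈ S) : ∃ ε > 0, ∃ C ⊆ S, IsCompact C ∧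
      ∀ y ∈ Metric.closedBall x ε, ∀ t ∈ Set.Icc (0 : ℝ) 1, ray c t y ∈ C := by
  obtain ⟨ε, hε, hsub⟩ := Metric.nhds_basis_closedBall.mem_iff.1 (hO.mem_nhds hx)
  have : ProperSpace E := FiniteDimensional.proper ℝ E
  refine ⟨ε, hε, (fun p : ℝ × E => ray c p.1 p.2) '' (Set.Icc 0 1 ×ˢ Metric.closedBall x ε), ?_,
    (isCompact_Icc.prod (isCompact_closedBall x ε)).image continuous_ray, fun y hy t ht =>
      ⟨(t, y), ⟨ht, hy⟩, rfl⟩⟩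
  rintro _ ⟨⟨t, y⟩, ⟨ht, hy⟩, rfl⟩
  exact ray_mem hS (hsub hy) ht

variable {V : Type} [NormedAddCommGroup V] [NormedSpace ℝ V]

theorem continuousOn_ray_integrand (hS : StarConvex ℝ c S) {F : E → V} (hF : ContinuousOn F S)
    (m : ℕ) {x : E} (hx : x ∈ S) :
    ContinuousOn (fun t : ℝ => t ^ m • F (ray c t x)) (Set.uIcc 0 1) := by
  rw [Set.uIcc_of_le zero_le_one]
  refine ContinuousOn.smul (by fun_prop) (hF.comp ?_ fun t ht => ray_mem hS hx ht)
  exact (continuous_ray.comp (Continuous.prodMk_left x)).continuousOn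

/-- Differentiation under the integral sign. The dominating constant is a bound of the derivative of
F on a compact set of rays, and the chain rule contributes the factor that raises t^m to t^{m+1}. -/
theorem hasFDerivAt_rayIntegral [FiniteDimensional ℝ E] (hS : StarConvex ℝ c S) (hO : IsOpen S)
    {F : E → V} (hF : ContDiffOn ℝ 1 F S) (m : ℕ) {x : E} (hx : x ∈ S) :
    HasFDerivAt (fun x => ∫ t in (0 : ℝ)..1, t ^ m • F (ray c t x))
      (∫ t in (0 : ℝ)..1, t ^ (m + 1) • fderiv ℝ F (ray c t x)) x := by
  obtain ⟨ε, hε, C, hCS, hC, hray⟩ := exists_compact_rays hS hO hx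
  have hF' : ContinuousOn (fderiv ℝ F) S := hF.continuousOn_fderiv_of_isOpen hO le_rfl
  obtain ⟨M, hM⟩ := hC.exists_bound_of_continuousOn (hF'.mono hCS)
  have hmeas : ∀ {W : Type} [NormedAddCommGroup W] [NormedSpace ℝ W] {G : E → W} (k : ℕ)
      {y : E}, ContinuousOn G S → y ∈ S → MeasureTheory.AEStronglyMeasurable
        (fun t : ℝ => t ^ k • G (ray c t y))
        (MeasureTheory.volume.restrict (Set.uIoc (0 : ℝ) 1)) := fun k y hG hy =>
    ((continuousOn_ray_integrand hS hG k hy).mono Set.uIoc_subset_uIcc).aestronglyMeasurable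
      measurableSet_uIoc
  refine intervalIntegral.hasFDerivAt_integral_of_dominated_of_fderiv_le
    (F := fun x t => t ^ m • F (ray c t x)) (F' := fun x t => t ^ (m + 1) • fderiv ℝ F (ray c t x))
    (bound := fun _ => M) (s := Metric.closedBall x ε) (Metric.closedBall_mem_nhds x hε) ?_ ?_ ?_ ?_
    (by simp) ?_
  · filter_upwards [hO.mem_nhds hx] with y hy using hmeas m hF.continuousOn hy
  · exact (continuousOn_ray_integrand hS hF.continuousOn m hx).intervalIntegrable
  · exact hmeas (m + 1) hF' hx
  · refine Filter.Eventually.of_forall fun t ht y hy => ?_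
    rw [Set.uIoc_of_le zero_le_one] at ht
    have ht' : t ∈ Set.Icc (0 : ℝ) 1 := ⟨ht.1.le, ht.2⟩
    rw [norm_smul, norm_pow, Real.norm_eq_abs, abs_of_nonneg ht.1.le]
    have h1 := hM _ (hray y hy t ht')
    calc t ^ (m + 1) * ‖fderiv ℝ F (ray c t y)‖ ≤ 1 * ‖fderiv ℝ F (ray c t y)‖ := by
          gcongr; exact pow_le_one₀ ht.1.le ht.2
      _ ≤ M := by rwa [one_mul]
  · refine Filter.Eventually.of_forall fun t ht y hy => ?_
    rw [Set.uIoc_of_le zero_le_one] at ht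
    have ht' : t ∈ Set.Icc (0 : ℝ) 1 := ⟨ht.1.le, ht.2⟩
    have h1 : HasFDerivAt F (fderiv ℝ F (ray c t y)) (ray c t y) :=
      ((hF.contDiffAt (hO.mem_nhds (hCS (hray y hy t ht')))).differentiableAt
        (by simp)).hasFDerivAt
    convert (h1.comp y (hasFDerivAt_ray t y)).const_smul (t ^ m) using 1
    · rfl
    · rw [ContinuousLinearMap.comp_smul, ContinuousLinearMap.comp_id, smul_smul, pow_succ]

/-- The derivative of the integral is another such integral, of the derivative of F with exponent m
+ 1. The target space V therefore has to vary in the induction. The loss of one derivative is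
harmless for smooth F. -/
theorem contDiffOn_rayIntegral [FiniteDimensional ℝ E] (hS : StarConvex ℝ c S) (hO : IsOpen S)
    (k : ℕ) : ∀ (V : Type) [NormedAddCommGroup V] [NormedSpace ℝ V] {F : E → V} (m : ℕ),
    ContDiffOn ℝ (k + 1) F S →
      ContDiffOn ℝ k (fun x => ∫ t in (0 : ℝ)..1, t ^ m • F (ray c t x)) S := by
  induction k with
  | zero =>
    intro V _ _ F m hF
    rw [Nat.cast_zero, contDiffOn_zero]
    intro x hx
    exact (hasFDerivAt_rayIntegral hS hO (by simpa using hF) m hx).continuousAt.continuousWithinAt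
  | succ k ih =>
    intro V _ _ F m hF
    have hF1 : ContDiffOn ℝ 1 F S := hF.of_le (by
      have : ((1 : ℕ) : WithTop ℕ∞) ≤ ((k + 1 + 1 : ℕ) : WithTop ℕ∞) := by
        exact_mod_cast Nat.le_add_left 1 (k + 1)
      exact this)
    rw [Nat.cast_succ, contDiffOn_succ_iff_fderiv_of_isOpen hO]
    refine ⟨fun x hx => (hasFDerivAt_rayIntegral hS hO hF1 m hx).differentiableAt
      |>.differentiableWithinAt, by simp, ?_⟩
    have := ih (E →L[ℝ] V) (m + 1) (F := fderiv ℝ F)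
      ((contDiffOn_succ_iff_fderiv_of_isOpen hO).1 (by exact_mod_cast hF)).2.2
    exact this.congr fun x hx => (hasFDerivAt_rayIntegral hS hO hF1 m hx).fderiv

end RayIntegral

/-! ### Ray integrals as inverses of the shifted radial derivation. -/

section RayOperator

/-- A smooth function on `U`, extended by zero. -/
abbrev extFun (f : SmoothFun U) : (Fin n → ℝ) → ℝ := Function.extend Subtype.val f.1 0

theorem extFun_apply (f : SmoothFun U) {x : Fin n → ℝ} (hx : x ∈ U) :
    extFun f x = f.1 ⟨x, hx⟩ := extend_val U _ hx

theorem contDiffOn_extFun (f : SmoothFun U) : ContDiffOn ℝ ∞ (extFun f) U := f.2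

theorem extFun_contDiffOn_one (f : SmoothFun U) : ContDiffOn ℝ 1 (extFun f) U :=
  (contDiffOn_extFun f).of_le (by exact_mod_cast le_top)

theorem coordPartial_apply (i : Fin n) (f : SmoothFun U) (x : U) :
    (coordPartial U i f).1 x = fderiv ℝ (extFun f) x.1 (Pi.single i 1) := rfl

theorem fderiv_extFun_apply (f : SmoothFun U) (x : U) (v : Fin n → ℝ) :
    fderiv ℝ (extFun f) x.1 v = ∑ i, v i * (coordPartial U i f).1 x := by
  conv_lhs => rw [← Finset.univ_sum_single v]
  rw [map_sum]
  refine Finset.sum_congr rfl fun i _ => ?_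
  rw [coordPartial_apply, show (Pi.single i (v i) : Fin n → ℝ) = v i • Pi.single i 1 by
    rw [← Pi.single_smul, smul_eq_mul, mul_one], map_smul, smul_eq_mul]

variable {c : Fin n → ℝ} (hU : StarConvex ℝ c (U : Set (Fin n → ℝ)))

/-- The operator `f ↦ ∫₀¹ t^m f(c + t (x - c)) dt` on smooth functions. -/
def rayInt (m : ℕ) : SmoothFun U →ₗ[ℝ] SmoothFun U where
  toFun f := ⟨fun x => ∫ t in (0 : ℝ)..1, t ^ m • extFun f (ray c t x.1), by
    have h : ContDiffOn ℝ ∞ (fun x => ∫ t in (0 : ℝ)..1, t ^ m • extFun f (ray c t x))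
        (U : Set (Fin n → ℝ)) := contDiffOn_infty.2 fun k =>
      contDiffOn_rayIntegral hU U.isOpen k ℝ m
        ((contDiffOn_extFun f).of_le (by exact_mod_cast le_top))
    exact h.congr fun x hx => extend_val U _ hx⟩
  map_add' f g := by
    ext x
    have hi := fun f : SmoothFun U => (continuousOn_ray_integrand hU
      (contDiffOn_extFun f).continuousOn m x.2).intervalIntegrable (μ := MeasureTheory.volume)
    change ∫ t in (0 : ℝ)..1, t ^ m • extFun (f + g) (ray c t x.1) =
      (∫ t in (0 : ℝ)..1, t ^ m • extFun f (ray c t x.1)) +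
        ∫ t in (0 : ℝ)..1, t ^ m • extFun g (ray c t x.1)
    rw [← intervalIntegral.integral_add (hi f) (hi g)]
    refine intervalIntegral.integral_congr fun t ht => ?_
    rw [Set.uIcc_of_le zero_le_one] at ht
    have hm := ray_mem hU x.2 ht
    simp only [extFun_apply _ hm, ← smul_add]
    rfl
  map_smul' r f := by
    ext x
    change ∫ t in (0 : ℝ)..1, t ^ m • extFun (r • f) (ray c t x.1) =
      r * ∫ t in (0 : ℝ)..1, t ^ m • extFun f (ray c t x.1)
    rw [← intervalIntegral.integral_const_mul]
    refine intervalIntegral.integral_congr fun t ht => ?_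
    rw [Set.uIcc_of_le zero_le_one] at ht
    have hm := ray_mem hU x.2 ht
    simp only [extFun_apply _ hm, smul_eq_mul]
    change t ^ m * (r * f.1 _) = _
    ring

theorem rayInt_apply (m : ℕ) (f : SmoothFun U) (x : U) :
    (rayInt hU m f).1 x = ∫ t in (0 : ℝ)..1, t ^ m • extFun f (ray c t x.1) := rfl

theorem fderiv_rayInt (m : ℕ) (f : SmoothFun U) (x : U) (v : Fin n → ℝ) :
    fderiv ℝ (extFun (rayInt hU m f)) x.1 v =
      ∫ t in (0 : ℝ)..1, t ^ (m + 1) • fderiv ℝ (extFun f) (ray c t x.1) v := by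
  have h := fderiv_extend_congr U (f := (rayInt hU m f).1)
    (F := fun x => ∫ t in (0 : ℝ)..1, t ^ m • extFun f (ray c t x)) (fun _ => rfl) x
  rw [extFun, h,
    (hasFDerivAt_rayIntegral hU U.isOpen (extFun_contDiffOn_one f) m x.2).fderiv,
    ContinuousLinearMap.intervalIntegral_apply]
  · rfl
  · exact (continuousOn_ray_integrand hU ((extFun_contDiffOn_one f).continuousOn_fderiv_of_isOpen
      U.isOpen le_rfl) (m + 1) x.2).intervalIntegrable

theorem coordPartial_rayInt (i : Fin n) (m : ℕ) (f : SmoothFun U) :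
    coordPartial U i (rayInt hU m f) = rayInt hU (m + 1) (coordPartial U i f) := by
  ext x
  rw [coordPartial_apply, fderiv_rayInt, rayInt_apply]
  refine intervalIntegral.integral_congr fun t ht => ?_
  rw [Set.uIcc_of_le zero_le_one] at ht
  simp only [extFun_apply _ (ray_mem hU x.2 ht)]
  rfl

/-- The coordinates centred at `c`. -/
def centred (c : Fin n → ℝ) (i : Fin n) : SmoothFun U := coordFun U i - algebraMap ℝ _ (c i)

theorem centred_apply (i : Fin n) (x : U) : (centred c i).1 x = x.1 i - c i := rfl

variable (U) in
/-- The radial derivation `∑ (u^i - c^i) ∂/∂u^i`. -/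
def radial (c : Fin n → ℝ) : SmoothFun U →ₗ[ℝ] SmoothFun U :=
  ∑ i, LinearMap.mulLeft ℝ (centred c i) ∘ₗ (coordPartial U i).toLinearMap

theorem radial_eq (f : SmoothFun U) : radial U c f = ∑ i, centred c i * coordPartial U i f := by
  simp [radial]

theorem smoothFun_sum_apply {ι : Type*} (s : Finset ι) (f : ι → SmoothFun U) (x : U) :
    (∑ i ∈ s, f i).1 x = ∑ i ∈ s, (f i).1 x :=
  map_sum ((Pi.evalRingHom (fun _ : U => ℝ) x).comp (SmoothFun U).val.toRingHom) f s

theorem smoothFun_mul_apply (f g : SmoothFun U) (x : U) : (f * g).1 x = f.1 x * g.1 x := rfl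

theorem radial_apply (f : SmoothFun U) (x : U) :
    (radial U c f).1 x = fderiv ℝ (extFun f) x.1 (x.1 - c) := by
  rw [radial_eq, smoothFun_sum_apply, fderiv_extFun_apply]
  rfl

/-- The fundamental theorem of calculus for t ↦ t^{m+1} f(c + t(x - c)), which is f(x) at t = 1 and
vanishes at t = 0. -/
theorem integral_ray_deriv (hU : StarConvex ℝ c (U : Set (Fin n → ℝ))) (m : ℕ) (f : SmoothFun U) (x : U) :
    (∫ t in (0 : ℝ)..1, t ^ (m + 1) • fderiv ℝ (extFun f) (ray c t x.1) (x.1 - c)) +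
      (m + 1) * ∫ t in (0 : ℝ)..1, t ^ m • extFun f (ray c t x.1) = f.1 x := by
  have hf' := (extFun_contDiffOn_one f).continuousOn_fderiv_of_isOpen U.isOpen le_rfl
  have hi1 : IntervalIntegrable
      (fun t : ℝ => t ^ (m + 1) • fderiv ℝ (extFun f) (ray c t x.1) (x.1 - c))
      MeasureTheory.volume 0 1 := (continuousOn_ray_integrand hU
        (F := fun y => fderiv ℝ (extFun f) y (x.1 - c)) (hf'.clm_apply continuousOn_const)
        (m + 1) x.2).intervalIntegrable
  have hi2 : IntervalIntegrable (fun t : ℝ => (m + 1 : ℝ) * t ^ m • extFun f (ray c t x.1))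
      MeasureTheory.volume 0 1 := ((continuousOn_ray_integrand hU
        (contDiffOn_extFun f).continuousOn m x.2).intervalIntegrable).const_mul _
  rw [← intervalIntegral.integral_const_mul, ← intervalIntegral.integral_add hi1 hi2,
    intervalIntegral.integral_eq_sub_of_hasDerivAt
      (f := fun t => t ^ (m + 1) * extFun f (ray c t x.1)) _ (hi1.add hi2)]
  · simp [ray]
  · intro t ht
    rw [Set.uIcc_of_le zero_le_one] at ht
    have h1 : HasFDerivAt (extFun f) (fderiv ℝ (extFun f) (ray c t x.1)) (ray c t x.1) :=
      (((extFun_contDiffOn_one f).contDiffAt (U.isOpen.mem_nhds (ray_mem hU x.2 ht))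
        ).differentiableAt (by simp)).hasFDerivAt
    have h2 : HasDerivAt (fun t : ℝ => ray c t x.1) (x.1 - c) t := by
      unfold ray
      simpa using ((hasDerivAt_id t).smul_const (x.1 - c)).const_add c
    have h3 := (hasDerivAt_pow (m + 1) t).mul (h1.comp_hasDerivAt t h2)
    refine h3.congr_deriv ?_
    simp only [smul_eq_mul, Function.comp_apply, Nat.add_sub_cancel]
    push_cast
    ring

/-- Together with `rayInt_radial`, this makes `rayInt hU m` a two-sided inverse of the radial
derivation plus m + 1. One side produces primitives, the other supplies the injectivity needed to
show that they are correct. -/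
theorem radial_rayInt (m : ℕ) (f : SmoothFun U) :
    radial U c (rayInt hU m f) + ((m + 1 : ℕ) : ℝ) • rayInt hU m f = f := by
  ext x
  change (radial U c (rayInt hU m f)).1 x + ((m + 1 : ℕ) : ℝ) * (rayInt hU m f).1 x = f.1 x
  rw [radial_apply, fderiv_rayInt, rayInt_apply]
  exact_mod_cast integral_ray_deriv hU m f x

theorem rayInt_radial (m : ℕ) (f : SmoothFun U) :
    rayInt hU m (radial U c f + ((m + 1 : ℕ) : ℝ) • f) = f := by
  ext x
  rw [map_add, map_smul]
  change (rayInt hU m (radial U c f)).1 x + ((m + 1 : ℕ) : ℝ) * (rayInt hU m f).1 x = f.1 x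
  rw [rayInt_apply, rayInt_apply]
  refine Eq.trans (congrArg₂ _ ?_ ?_) (integral_ray_deriv hU m f x)
  · refine intervalIntegral.integral_congr fun t ht => ?_
    rw [Set.uIcc_of_le zero_le_one] at ht
    have hm := ray_mem hU x.2 ht
    simp only [extFun_apply _ hm, radial_apply]
    rw [show ray c t x.1 - c = t • (x.1 - c) by simp [ray], map_smul, smul_smul, pow_succ]
  · push_cast; rfl

end RayOperator

end VarHam
end

noncomputable section
namespace VarHam
variable {n : ℕ} {U : TopologicalSpace.Opens (Fin n → ℝ)}

/-! ### Picard iteration for parallel sections. -/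

section Picard

/-- The contraction `∑ y_k B^k_{m i}` of a connection with a section. -/
def connApply (B : Fin n → Fin n → Fin n → SmoothFun U) (y : Fin n → SmoothFun U) (m i : Fin n) :
    SmoothFun U := ∑ k, y k * B k m i

theorem connApply_sub (B : Fin n → Fin n → Fin n → SmoothFun U) (y z : Fin n → SmoothFun U)
    (m i : Fin n) : connApply B (y - z) m i = connApply B y m i - connApply B z m i := by
  simp only [connApply, Pi.sub_apply, sub_mul, Finset.sum_sub_distrib]

variable {c : Fin n → ℝ} (hU : StarConvex ℝ c (U : Set (Fin n → ℝ)))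
  (B : Fin n → Fin n → Fin n → SmoothFun U)

/-- The Volterra operator of the parallel transport along the segments from `c`. -/
def volterra (y : Fin n → SmoothFun U) (i : Fin n) : SmoothFun U :=
  ∑ m, centred c m * rayInt hU 0 (connApply B y m i)

theorem volterra_sub (y z : Fin n → SmoothFun U) (i : Fin n) :
    volterra hU B (y - z) i = volterra hU B y i - volterra hU B z i := by
  simp only [volterra, connApply_sub, map_sub, mul_sub, Finset.sum_sub_distrib]

/-- The Picard iterates for a parallel section with value `c₀` at `c`. -/
def picard (c₀ : Fin n → ℝ) : ℕ → Fin n → SmoothFun U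
  | 0 => fun i => algebraMap ℝ _ (c₀ i)
  | l + 1 => fun i => algebraMap ℝ _ (c₀ i) + volterra hU B (picard c₀ l) i

/-- The failure of a section to be parallel. -/
def connDefect (y : Fin n → SmoothFun U) (s i : Fin n) : SmoothFun U :=
  coordPartial U s (y i) - connApply B y s i

theorem coordPartial_centred (s m : Fin n) :
    coordPartial U s (centred c m) = if s = m then 1 else 0 := by
  rw [centred, map_sub, coordPartial_coordFun, Derivation.map_algebraMap, sub_zero]

/-- The Poincaré homotopy formula for the one-forms with components (yB)_{m i}. The Volterra
operator is their radial primitive, and the error is the ray integral of their exterior derivative.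
-/
theorem coordPartial_volterra (y : Fin n → SmoothFun U) (s i : Fin n) :
    coordPartial U s (volterra hU B y i) = connApply B y s i + ∑ m, centred c m *
      rayInt hU 1 (coordPartial U s (connApply B y m i) - coordPartial U m (connApply B y s i)) := by
  have h := radial_rayInt hU 0 (connApply B y s i)
  rw [radial_eq] at h
  simp only [coordPartial_rayInt, zero_add, Nat.cast_one, one_smul] at h
  simp only [volterra, map_sum, Derivation.leibniz, smul_eq_mul, coordPartial_rayInt,
    coordPartial_centred, map_sub, mul_sub, Finset.sum_sub_distrib, Finset.sum_add_distrib, zero_add]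
  have h2 : ∑ m, rayInt hU 0 (connApply B y m i) * (if s = m then 1 else 0) =
      rayInt hU 0 (connApply B y s i) := by
    rw [Finset.sum_eq_single s (fun m _ hm => by rw [if_neg hm.symm, mul_zero])
      (fun hs => absurd (Finset.mem_univ s) hs), if_pos rfl, mul_one]
  linear_combination h + h2

/-- By flatness, the exterior derivative of the one-form yB involves y only through its defect. The
defect of an iterate is thus controlled by the previous defect and the difference of successive
iterates. -/
theorem connDefect_picard_succ (hB : ∀ k s t j, coordPartial U s (B k t j) -
      coordPartial U t (B k s j) = ∑ i, B k t i * B i s j - ∑ i, B k s i * B i t j)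
    (c₀ : Fin n → ℝ) (l : ℕ) (s i : Fin n) :
    connDefect B (picard hU B c₀ (l + 1)) s i =
      connApply B (picard hU B c₀ l - picard hU B c₀ (l + 1)) s i +
      ∑ m, centred c m * rayInt hU 1 (connApply B (connDefect B (picard hU B c₀ l) s) m i -
        connApply B (connDefect B (picard hU B c₀ l) m) s i) := by
  set y := picard hU B c₀ l
  have h1 : ∀ m, coordPartial U s (connApply B y m i) - coordPartial U m (connApply B y s i) =
      connApply B (connDefect B y s) m i - connApply B (connDefect B y m) s i := by
    intro m
    have e1 : ∀ s m, coordPartial U s (connApply B y m i) =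
        ∑ k, y k * coordPartial U s (B k m i) + ∑ k, coordPartial U s (y k) * B k m i := by
      intro s m
      simp only [connApply, map_sum, Derivation.leibniz, smul_eq_mul, Finset.sum_add_distrib]
      congr 1
      exact Finset.sum_congr rfl fun k _ => mul_comm _ _
    have e2 : ∀ s m, connApply B (connDefect B y s) m i =
        ∑ k, coordPartial U s (y k) * B k m i - ∑ k, y k * ∑ j, B k s j * B j m i := by
      intro s m
      simp only [connApply, connDefect, sub_mul, Finset.sum_sub_distrib, Finset.sum_mul,
        Finset.mul_sum]
      congr 1
      rw [Finset.sum_comm]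
      simp only [mul_assoc]
    have e3 : ∑ k, y k * coordPartial U s (B k m i) - ∑ k, y k * coordPartial U m (B k s i) =
        ∑ k, y k * ∑ j, B k m j * B j s i - ∑ k, y k * ∑ j, B k s j * B j m i := by
      rw [← Finset.sum_sub_distrib, ← Finset.sum_sub_distrib]
      exact Finset.sum_congr rfl fun k _ => by rw [← mul_sub, ← mul_sub, hB]
    rw [e1, e1, e2, e2]
    linear_combination e3
  rw [connDefect, show picard hU B c₀ (l + 1) i = algebraMap ℝ _ (c₀ i) + volterra hU B y i from rfl,
    map_add, Derivation.map_algebraMap, zero_add, coordPartial_volterra, connApply_sub]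
  simp only [h1]
  ring

end Picard

/-! ### Factorial estimates for the iterates and their defects. -/

section RayBounds

/-- A bound of order `l` along the segments from `c` to the points of `K`. -/
def RayBound (c : Fin n → ℝ) (K : Set (Fin n → ℝ)) (a : ℝ) (l : ℕ) (φ : SmoothFun U) : Prop :=
  ∀ y ∈ K, ∀ t ∈ Set.Icc (0 : ℝ) 1, |extFun φ (ray c t y)| ≤ a * t ^ l

variable {c : Fin n → ℝ} {K : Set (Fin n → ℝ)}

theorem extFun_add (f g : SmoothFun U) {x : Fin n → ℝ} (hx : x ∈ U) :
    extFun (f + g) x = extFun f x + extFun g x := by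
  rw [extFun_apply _ hx, extFun_apply _ hx, extFun_apply _ hx]; rfl

theorem extFun_mul (f g : SmoothFun U) {x : Fin n → ℝ} (hx : x ∈ U) :
    extFun (f * g) x = extFun f x * extFun g x := by
  rw [extFun_apply _ hx, extFun_apply _ hx, extFun_apply _ hx]; rfl

theorem extFun_neg (f : SmoothFun U) {x : Fin n → ℝ} (hx : x ∈ U) :
    extFun (-f) x = -extFun f x := by
  rw [extFun_apply _ hx, extFun_apply _ hx]; rfl

theorem extFun_sub (f g : SmoothFun U) {x : Fin n → ℝ} (hx : x ∈ U) :
    extFun (f - g) x = extFun f x - extFun g x := by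
  rw [extFun_apply _ hx, extFun_apply _ hx, extFun_apply _ hx]; rfl

theorem extFun_sum {ι : Type*} (s : Finset ι) (f : ι → SmoothFun U) {x : Fin n → ℝ} (hx : x ∈ U) :
    extFun (∑ i ∈ s, f i) x = ∑ i ∈ s, extFun (f i) x := by
  rw [extFun_apply _ hx, smoothFun_sum_apply]
  exact Finset.sum_congr rfl fun i _ => (extFun_apply _ hx).symm

theorem RayBound.mono {a b : ℝ} {l : ℕ} {φ : SmoothFun U} (h : RayBound c K a l φ) (hab : a ≤ b) :
    RayBound c K b l φ := fun y hy t ht =>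
  (h y hy t ht).trans (mul_le_mul_of_nonneg_right hab (pow_nonneg ht.1 l))

variable (hK : ∀ y ∈ K, ∀ t ∈ Set.Icc (0 : ℝ) 1, ray c t y ∈ U)

theorem RayBound.add (hK : ∀ y ∈ K, ∀ t ∈ Set.Icc (0 : ℝ) 1, ray c t y ∈ U) {a b : ℝ} {l : ℕ}
    {φ ψ : SmoothFun U} (h : RayBound c K a l φ) (h' : RayBound c K b l ψ) :
    RayBound c K (a + b) l (φ + ψ) := fun y hy t ht => by
  rw [extFun_add _ _ (hK y hy t ht), add_mul]
  exact (abs_add_le _ _).trans (add_le_add (h y hy t ht) (h' y hy t ht))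

theorem RayBound.neg (hK : ∀ y ∈ K, ∀ t ∈ Set.Icc (0 : ℝ) 1, ray c t y ∈ U) {a : ℝ} {l : ℕ}
    {φ : SmoothFun U} (h : RayBound c K a l φ) : RayBound c K a l (-φ) := fun y hy t ht => by
  rw [extFun_neg _ (hK y hy t ht), abs_neg]
  exact h y hy t ht

theorem RayBound.sub (hK : ∀ y ∈ K, ∀ t ∈ Set.Icc (0 : ℝ) 1, ray c t y ∈ U) {a b : ℝ} {l : ℕ}
    {φ ψ : SmoothFun U} (h : RayBound c K a l φ) (h' : RayBound c K b l ψ) :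
    RayBound c K (a + b) l (φ - ψ) := by
  rw [sub_eq_add_neg]
  exact h.add hK (h'.neg hK)

theorem RayBound.sum (hK : ∀ y ∈ K, ∀ t ∈ Set.Icc (0 : ℝ) 1, ray c t y ∈ U) {a : ℝ} {l : ℕ}
    {φ : Fin n → SmoothFun U} (h : ∀ i, RayBound c K a l (φ i)) :
    RayBound c K (n * a) l (∑ i, φ i) := fun y hy t ht => by
  rw [extFun_sum _ _ (hK y hy t ht)]
  refine (Finset.abs_sum_le_sum_abs _ _).trans
    ((Finset.sum_le_sum fun i _ => h i y hy t ht).trans (le_of_eq ?_))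
  simp [mul_assoc]

theorem RayBound.mul (hK : ∀ y ∈ K, ∀ t ∈ Set.Icc (0 : ℝ) 1, ray c t y ∈ U) {a M : ℝ} {l : ℕ}
    {φ ψ : SmoothFun U} (h : RayBound c K a l φ) (h' : RayBound c K M 0 ψ) :
    RayBound c K (a * M) l (φ * ψ) := fun y hy t ht => by
  rw [extFun_mul _ _ (hK y hy t ht), abs_mul]
  have h1 := h y hy t ht
  have h2 := h' y hy t ht
  rw [pow_zero, mul_one] at h2
  calc _ ≤ (a * t ^ l) * M := mul_le_mul h1 h2 (abs_nonneg _) ((abs_nonneg _).trans h1)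
    _ = a * M * t ^ l := by ring

theorem RayBound.connApply (hK : ∀ y ∈ K, ∀ t ∈ Set.Icc (0 : ℝ) 1, ray c t y ∈ U) {a M : ℝ} {l : ℕ}
    {B : Fin n → Fin n → Fin n → SmoothFun U} (hB : ∀ k m i, RayBound c K M 0 (B k m i))
    {y : Fin n → SmoothFun U} (h : ∀ k, RayBound c K a l (y k)) (m i : Fin n) :
    RayBound c K (n * (a * M)) l (connApply B y m i) :=
  RayBound.sum hK fun k => (h k).mul hK (hB k m i)

/-- A bound of order t^l integrates along the ray to the factor 1/(l + 1), and the centred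
coordinate, vanishing at c, supplies another power of t. Repetition produces the factorials that
make the iteration converge. -/
theorem RayBound.centred_mul_rayInt (hU : StarConvex ℝ c (U : Set (Fin n → ℝ)))
    (hK : ∀ y ∈ K, ∀ t ∈ Set.Icc (0 : ℝ) 1, ray c t y ∈ U) {a ρ : ℝ} {l : ℕ}
    (hρ : ∀ y ∈ K, ∀ i, |y i - c i| ≤ ρ) {φ : SmoothFun U} (h : RayBound c K a l φ) (i : Fin n)
    (m : ℕ) : RayBound c K (ρ * (a / (l + 1))) (l + 1) (centred c i * rayInt hU m φ) := by
  intro y hy t ht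
  have hx := hK y hy t ht
  rw [extFun_mul _ _ hx, abs_mul, extFun_apply _ hx, extFun_apply _ hx, centred_apply, rayInt_apply]
  have h1 : |ray c t y i - c i| ≤ t * ρ := by
    have : ray c t y i - c i = t * (y i - c i) := by simp [ray]
    rw [this, abs_mul, abs_of_nonneg ht.1]
    exact mul_le_mul_of_nonneg_left (hρ y hy i) ht.1
  have h2 : |∫ s in (0 : ℝ)..1, s ^ m • extFun φ (ray c s (ray c t y))| ≤
      a * t ^ l / (l + 1) := by
    have hint : ∫ s in (0 : ℝ)..1, a * t ^ l * s ^ l = a * t ^ l / (l + 1) := by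
      rw [intervalIntegral.integral_const_mul, integral_pow]
      simp [div_eq_mul_inv]
    rw [← hint, ← Real.norm_eq_abs]
    refine intervalIntegral.norm_integral_le_of_norm_le zero_le_one
      (Filter.Eventually.of_forall fun s hs => ?_)
      (Continuous.intervalIntegrable (by fun_prop) _ _)
    have hts : t * s ∈ Set.Icc (0 : ℝ) 1 :=
      ⟨mul_nonneg ht.1 hs.1.le, mul_le_one₀ ht.2 hs.1.le hs.2⟩
    rw [ray_ray, norm_smul, norm_pow, Real.norm_eq_abs, Real.norm_eq_abs, abs_of_nonneg hs.1.le]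
    calc s ^ m * |extFun φ (ray c (t * s) y)| ≤ 1 * |extFun φ (ray c (t * s) y)| :=
          mul_le_mul_of_nonneg_right (pow_le_one₀ hs.1.le hs.2) (abs_nonneg _)
      _ ≤ a * (t * s) ^ l := by rw [one_mul]; exact h y hy _ hts
      _ = a * t ^ l * s ^ l := by ring
  calc _ ≤ (t * ρ) * (a * t ^ l / (l + 1)) :=
        mul_le_mul h1 h2 (abs_nonneg _) ((abs_nonneg _).trans h1)
    _ = ρ * (a / (l + 1)) * t ^ (l + 1) := by ring

variable (hU : StarConvex ℝ c (U : Set (Fin n → ℝ))) {B : Fin n → Fin n → Fin n → SmoothFun U}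

theorem RayBound.volterra (hK : ∀ y ∈ K, ∀ t ∈ Set.Icc (0 : ℝ) 1, ray c t y ∈ U) {a M ρ : ℝ}
    {l : ℕ} (hB : ∀ k m i, RayBound c K M 0 (B k m i)) (hρ : ∀ y ∈ K, ∀ i, |y i - c i| ≤ ρ)
    {y : Fin n → SmoothFun U} (h : ∀ k, RayBound c K a l (y k)) (i : Fin n) :
    RayBound c K (a * (n * n * ρ * M) / (l + 1)) (l + 1) (volterra hU B y i) := by
  refine (RayBound.sum hK fun m => (RayBound.connApply hK hB h m i).centred_mul_rayInt hU hK hρ m 0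
    ).mono (le_of_eq ?_)
  ring

theorem picard_step_bound (hK : ∀ y ∈ K, ∀ t ∈ Set.Icc (0 : ℝ) 1, ray c t y ∈ U) {M ρ a : ℝ}
    (hB : ∀ k m i, RayBound c K M 0 (B k m i)) (hρ : ∀ y ∈ K, ∀ i, |y i - c i| ≤ ρ)
    {c₀ : Fin n → ℝ} (hc : ∀ i, |c₀ i| ≤ a) (l : ℕ) (i : Fin n) :
    RayBound c K (a * (n * n * ρ * M) ^ (l + 1) / (l + 1).factorial) (l + 1)
      (picard hU B c₀ (l + 1) i - picard hU B c₀ l i) := by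
  induction l generalizing i with
  | zero =>
    have h0 : ∀ k, RayBound c K a 0 (picard hU B c₀ 0 k) := fun k y hy t ht => by
      rw [extFun_apply _ (hK y hy t ht)]
      simpa [picard] using hc k
    have := RayBound.volterra hU hK hB hρ h0 i
    rw [show picard hU B c₀ (0 + 1) i - picard hU B c₀ 0 i = volterra hU B (picard hU B c₀ 0) i by
      simp [picard]]
    simpa using this
  | succ l ih =>
    have h1 : ∀ k, RayBound c K (a * (n * n * ρ * M) ^ (l + 1) / (l + 1).factorial) (l + 1)
      ((picard hU B c₀ (l + 1) - picard hU B c₀ l) k) := ih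
    have := RayBound.volterra hU hK hB hρ h1 i
    rw [show picard hU B c₀ (l + 1 + 1) i - picard hU B c₀ (l + 1) i =
      volterra hU B (picard hU B c₀ (l + 1) - picard hU B c₀ l) i by
        rw [volterra_sub]; simp [picard]]
    refine this.mono (le_of_eq ?_)
    rw [Nat.factorial_succ (l + 1)]
    push_cast
    field_simp
    ring

/-- With L = n²ρM, the recursion for the defect leads from (3L)^l to L·L^l + 2L(3L)^l, where 2
counts the two defect terms. This is at most (3L)^{l+1}, which is the reason for the constant 3. -/
theorem connDefect_bound (hK : ∀ y ∈ K, ∀ t ∈ Set.Icc (0 : ℝ) 1, ray c t y ∈ U) {M ρ a : ℝ}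
    (ha : 0 ≤ a) (hM : 0 ≤ M) (hρ0 : 0 ≤ ρ)
    (hB : ∀ k m i, RayBound c K M 0 (B k m i)) (hρ : ∀ y ∈ K, ∀ i, |y i - c i| ≤ ρ)
    (hflat : ∀ k s t j, coordPartial U s (B k t j) - coordPartial U t (B k s j) =
      ∑ i, B k t i * B i s j - ∑ i, B k s i * B i t j)
    {c₀ : Fin n → ℝ} (hc : ∀ i, |c₀ i| ≤ a) (l : ℕ) (s i : Fin n) :
    RayBound c K (n * (a * M) * (3 * (n * n * ρ * M)) ^ l / l.factorial) l
      (connDefect B (picard hU B c₀ l) s i) := by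
  induction l generalizing s i with
  | zero =>
    have h0 : ∀ k, RayBound c K a 0 (picard hU B c₀ 0 k) := fun k y hy t ht => by
      rw [extFun_apply _ (hK y hy t ht)]
      simpa [picard] using hc k
    have := (RayBound.connApply hK hB h0 s i).neg hK
    rw [show connDefect B (picard hU B c₀ 0) s i = -connApply B (picard hU B c₀ 0) s i by
      simp [connDefect, picard]]
    simpa using this
  | succ l ih =>
    set L : ℝ := n * n * ρ * M with hL
    have hL0 : 0 ≤ L := by positivity
    rw [connDefect_picard_succ hU B hflat]
    have h1 : ∀ k, RayBound c K (a * L ^ (l + 1) / (l + 1).factorial) (l + 1)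
        ((picard hU B c₀ l - picard hU B c₀ (l + 1)) k) := fun k => by
      have := (picard_step_bound hU hK hB hρ hc l k).neg hK
      rwa [neg_sub] at this
    have h2 : ∀ m, RayBound c K _ l (connApply B (connDefect B (picard hU B c₀ l) s) m i -
        connApply B (connDefect B (picard hU B c₀ l) m) s i) := fun m =>
      (RayBound.connApply hK hB (fun k => ih s k) m i).sub hK
        (RayBound.connApply hK hB (fun k => ih m k) s i)
    refine ((RayBound.connApply hK hB h1 s i).add hK (RayBound.sum hK fun m =>
      (h2 m).centred_mul_rayInt hU hK hρ m 1)).mono ?_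
    rw [Nat.factorial_succ]
    push_cast
    have e : (n : ℝ) * (a * L ^ (l + 1) / ((l + 1) * l.factorial) * M) +
        n * (ρ * ((n * (n * (a * M) * (3 * L) ^ l / l.factorial * M) +
          n * (n * (a * M) * (3 * L) ^ l / l.factorial * M)) / (l + 1))) =
        n * (a * M) * (L * L ^ l + 2 * L * (3 * L) ^ l) / ((l + 1) * l.factorial) := by
      rw [hL]; field_simp; ring
    rw [e]
    gcongr
    have : L * L ^ l ≤ L * (3 * L) ^ l := by gcongr; linarith
    calc L * L ^ l + 2 * L * (3 * L) ^ l ≤ L * (3 * L) ^ l + 2 * L * (3 * L) ^ l := by gcongr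
      _ = (3 * L) ^ (l + 1) := by ring

/-- The ray estimates at t = 1 become uniform estimates near x: summable increments, defects tending
to zero, and bounded connection coefficients. -/
theorem picard_local_bounds (hU : StarConvex ℝ c (U : Set (Fin n → ℝ)))
    (hflat : ∀ k s t j, coordPartial U s (B k t j) - coordPartial U t (B k s j) =
      ∑ i, B k t i * B i s j - ∑ i, B k s i * B i t j) (c₀ : Fin n → ℝ) {x : Fin n → ℝ}
    (hx : x ∈ U) : ∃ ε > 0, Metric.ball x ε ⊆ U ∧ ∃ (a b : ℕ → ℝ) (M : ℝ), Summable a ∧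
      Filter.Tendsto b Filter.atTop (nhds 0) ∧ ∀ y ∈ Metric.ball x ε,
        (∀ l i, dist (extFun (picard hU B c₀ l i) y) (extFun (picard hU B c₀ (l + 1) i) y) ≤ a l) ∧
        (∀ l s i, |extFun (connDefect B (picard hU B c₀ l) s i) y| ≤ b l) ∧
        ∀ k m i, |extFun (B k m i) y| ≤ M := by
  obtain ⟨ε, hε, C, hCU, hC, hray⟩ := exists_compact_rays hU U.isOpen hx
  have hbd : ∀ k m i, ∃ M, ∀ y ∈ C, ‖extFun (B k m i) y‖ ≤ M := fun k m i =>
    hC.exists_bound_of_continuousOn ((contDiffOn_extFun (B k m i)).continuousOn.mono hCU)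
  choose M₀ hM₀ using hbd
  have hK : ∀ y ∈ Metric.closedBall x ε, ∀ t ∈ Set.Icc (0 : ℝ) 1, ray c t y ∈ U :=
    fun y hy t ht => hCU (hray y hy t ht)
  set M : ℝ := ∑ k, ∑ m, ∑ i, |M₀ k m i| with hM
  have hB : ∀ k m i, RayBound c (Metric.closedBall x ε) M 0 (B k m i) := fun k m i y hy t ht => by
    rw [pow_zero, mul_one, hM]
    calc |extFun (B k m i) (ray c t y)| ≤ |M₀ k m i| :=
          (hM₀ k m i _ (hray y hy t ht)).trans (le_abs_self _)
      _ ≤ ∑ i, |M₀ k m i| := Finset.single_le_sum (f := fun i => |M₀ k m i|)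
          (fun i _ => abs_nonneg _) (Finset.mem_univ i)
      _ ≤ ∑ m, ∑ i, |M₀ k m i| := Finset.single_le_sum (f := fun m => ∑ i, |M₀ k m i|)
          (fun m _ => Finset.sum_nonneg fun i _ => abs_nonneg _) (Finset.mem_univ m)
      _ ≤ _ := Finset.single_le_sum (f := fun k => ∑ m, ∑ i, |M₀ k m i|)
          (fun k _ => Finset.sum_nonneg fun m _ => Finset.sum_nonneg fun i _ => abs_nonneg _)
          (Finset.mem_univ k)
  have hM0 : 0 ≤ M := Finset.sum_nonneg fun k _ => Finset.sum_nonneg fun m _ =>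
    Finset.sum_nonneg fun i _ => abs_nonneg _
  set ρ : ℝ := ε + ‖x - c‖
  have hρ0 : 0 ≤ ρ := by positivity
  have hρ : ∀ y ∈ Metric.closedBall x ε, ∀ i, |y i - c i| ≤ ρ := fun y hy i => by
    calc |y i - c i| = ‖(y - c) i‖ := rfl
      _ ≤ ‖y - c‖ := norm_le_pi_norm _ i
      _ = ‖(y - x) + (x - c)‖ := by rw [sub_add_sub_cancel]
      _ ≤ ‖y - x‖ + ‖x - c‖ := norm_add_le _ _
      _ ≤ ρ := add_le_add_left (by simpa [dist_eq_norm] using hy) _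
  set a : ℝ := ‖c₀‖
  have hc : ∀ i, |c₀ i| ≤ a := fun i => norm_le_pi_norm c₀ i
  have hone : ∀ y : Fin n → ℝ, ray c 1 y = y := fun y => by simp [ray]
  have hsub : Metric.ball x ε ⊆ U := fun y hy => by
    have := hK y (Metric.ball_subset_closedBall hy) 1 ⟨zero_le_one, le_rfl⟩
    rwa [hone] at this
  refine ⟨ε, hε, hsub, fun l => a * (n * n * ρ * M) ^ (l + 1) / (l + 1).factorial,
    fun l => n * (a * M) * (3 * (n * n * ρ * M)) ^ l / l.factorial, M, ?_, ?_, fun y hy =>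
    ⟨fun l i => ?_, fun l s i => ?_, fun k m i => ?_⟩⟩
  · have := ((summable_nat_add_iff 1).2 (Real.summable_pow_div_factorial (n * n * ρ * M))).mul_left a
    simpa [mul_div_assoc] using this
  · have := (FloorSemiring.tendsto_pow_div_factorial_atTop (3 * (n * n * ρ * M))).const_mul
      (n * (a * M))
    simpa [mul_div_assoc] using this
  · have := picard_step_bound hU hK hB hρ hc l i y (Metric.ball_subset_closedBall hy) 1
      ⟨zero_le_one, le_rfl⟩
    rw [hone, extFun_sub _ _ (hsub hy), one_pow, mul_one] at this
    rwa [dist_comm, Real.dist_eq]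
  · have := connDefect_bound hU hK (norm_nonneg _) hM0 hρ0 hB hρ hflat hc l s i y
      (Metric.ball_subset_closedBall hy) 1 ⟨zero_le_one, le_rfl⟩
    rwa [hone, one_pow, mul_one] at this
  · have := hB k m i y (Metric.ball_subset_closedBall hy) 1 ⟨zero_le_one, le_rfl⟩
    rwa [hone, one_pow, mul_one] at this

end RayBounds

/-! ### Parallel sections and parallel frames of a flat connection. -/

section ParallelSections

variable {c : Fin n → ℝ} {B : Fin n → Fin n → Fin n → SmoothFun U}

theorem hasFDerivAt_extFun (f : SmoothFun U) {x : Fin n → ℝ} (hx : x ∈ U) :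
    HasFDerivAt (extFun f) (∑ m, extFun (coordPartial U m f) x •
      ContinuousLinearMap.proj (R := ℝ) (φ := fun _ : Fin n => ℝ) m) x := by
  refine (smoothFun_differentiableAt U f ⟨x, hx⟩).hasFDerivAt.congr_fderiv
    (ContinuousLinearMap.ext fun v => ?_)
  have h := fderiv_extFun_apply f ⟨x, hx⟩ v
  refine h.trans ?_
  simp [mul_comm, extFun_apply _ hx]

/-- The iterates converge locally uniformly and their defects tend uniformly to zero. Their
derivatives therefore converge locally uniformly to the right-hand side of the parallel equation,
and the limit may be differentiated. -/
theorem exists_parallel_hasFDerivAt (hU : StarConvex ℝ c (U : Set (Fin n → ℝ))) (hcU : c ∈ U)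
    (hflat : ∀ k s t j, coordPartial U s (B k t j) - coordPartial U t (B k s j) =
      ∑ i, B k t i * B i s j - ∑ i, B k s i * B i t j) (c₀ : Fin n → ℝ) :
    ∃ F : Fin n → (Fin n → ℝ) → ℝ, (∀ i, F i c = c₀ i) ∧ ∀ i, ∀ x ∈ U,
      HasFDerivAt (F i) (∑ m, (∑ k, F k x * extFun (B k m i) x) •
        ContinuousLinearMap.proj (R := ℝ) (φ := fun _ : Fin n => ℝ) m) x := by
  have hlim : ∀ x ∈ U, ∀ i, ∃ z, Filter.Tendsto (fun l => extFun (picard hU B c₀ l i) x)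
      Filter.atTop (nhds z) := fun x hx i => by
    obtain ⟨ε, hε, -, a, b, M, ha, hb, h⟩ := picard_local_bounds hU hflat c₀ hx
    exact cauchySeq_tendsto_of_complete (cauchySeq_of_dist_le_of_summable a
      (fun l => (h x (Metric.mem_ball_self hε)).1 l i) ha)
  let F : Fin n → (Fin n → ℝ) → ℝ := fun i x =>
    Filter.atTop.limUnder fun l => extFun (picard hU B c₀ l i) x
  have hF : ∀ x ∈ U, ∀ i, Filter.Tendsto (fun l => extFun (picard hU B c₀ l i) x) Filter.atTop
      (nhds (F i x)) := fun x hx i => tendsto_nhds_limUnder (hlim x hx i)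
  refine ⟨F, fun i => ?_, fun i x hx => ?_⟩
  -- The centred coordinates vanish at c, so every iterate already has the value c₀ there.
  · refine tendsto_nhds_unique (hF c hcU i) ((Filter.tendsto_congr fun l => ?_).2 tendsto_const_nhds)
    rw [extFun_apply _ hcU]
    cases l with
    | zero => rfl
    | succ l =>
      change c₀ i + (volterra hU B (picard hU B c₀ l) i).1 ⟨c, hcU⟩ = c₀ i
      rw [volterra, smoothFun_sum_apply, Finset.sum_eq_zero, add_zero]
      intro m _
      rw [smoothFun_mul_apply, centred_apply, sub_self, zero_mul]
  · obtain ⟨ε, hε, hsub, a, b, M, ha, hb, h⟩ := picard_local_bounds hU hflat c₀ hx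
    let T : ℕ → ℝ := fun l => ∑' m, a (m + l)
    have hT : Filter.Tendsto T Filter.atTop (nhds 0) := tendsto_sum_nat_add a
    have hFT : ∀ y ∈ Metric.ball x ε, ∀ l k,
        |extFun (picard hU B c₀ l k) y - F k y| ≤ T l := fun y hy l k => by
      have := dist_le_tsum_of_dist_le_of_tendsto a (fun l => (h y hy).1 l k) ha (hF y (hsub hy) k) l
      rw [← Real.dist_eq]
      simpa only [T, add_comm _ l] using this
    let N : Fin n → ℝ := fun m => ‖ContinuousLinearMap.proj (R := ℝ) (φ := fun _ : Fin n => ℝ) m‖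
    refine hasFDerivAt_of_tendstoUniformlyOn (l := Filter.atTop) (Metric.isOpen_ball (x := x) (ε := ε))
      (f := fun l => extFun (picard hU B c₀ l i))
      (f' := fun l x => ∑ m, extFun (coordPartial U m (picard hU B c₀ l i)) x •
        ContinuousLinearMap.proj (R := ℝ) (φ := fun _ : Fin n => ℝ) m)
      (g' := fun x => ∑ m, (∑ k, F k x * extFun (B k m i) x) •
        ContinuousLinearMap.proj (R := ℝ) (φ := fun _ : Fin n => ℝ) m) ?_
      (fun l y hy => hasFDerivAt_extFun _ (hsub hy)) (fun y hy => hF y (hsub hy) i)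
      (Metric.mem_ball_self hε)
    have he : Filter.Tendsto (fun l => ∑ m, (b l + ∑ _k : Fin n, T l * M) * N m) Filter.atTop
        (nhds 0) := by
      have : Filter.Tendsto (fun l => ∑ m, (b l + ∑ _k : Fin n, T l * M) * N m) Filter.atTop
          (nhds (∑ m, (0 + ∑ _k : Fin n, 0 * M) * N m)) :=
        tendsto_finsetSum _ fun m _ => ((hb.add (tendsto_finsetSum _ fun k _ =>
          hT.mul_const M)).mul_const (N m))
      simpa using this
    rw [Metric.tendstoUniformlyOn_iff]
    intro δ hδ
    filter_upwards [he.eventually (gt_mem_nhds hδ)] with l hl y hy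
    refine lt_of_le_of_lt ?_ hl
    rw [dist_comm, dist_eq_norm, ← Finset.sum_sub_distrib]
    refine (norm_sum_le _ _).trans (Finset.sum_le_sum fun m _ => ?_)
    rw [← sub_smul, norm_smul, Real.norm_eq_abs]
    refine mul_le_mul_of_nonneg_right ?_ (norm_nonneg _)
    -- The error in the derivative splits into the defect of the iterate and its distance from the
    -- limit, contracted with B.
    have e : extFun (coordPartial U m (picard hU B c₀ l i)) y - ∑ k, F k y * extFun (B k m i) y =
        extFun (connDefect B (picard hU B c₀ l) m i) y +
          ∑ k, (extFun (picard hU B c₀ l k) y - F k y) * extFun (B k m i) y := by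
      rw [connDefect, extFun_sub _ _ (hsub hy), connApply, extFun_sum _ _ (hsub hy)]
      simp only [extFun_mul _ _ (hsub hy), sub_mul, Finset.sum_sub_distrib]
      ring
    rw [e]
    refine (abs_add_le _ _).trans (add_le_add ((h y hy).2.1 l m i)
      ((Finset.abs_sum_le_sum_abs _ _).trans (Finset.sum_le_sum fun k _ => ?_)))
    rw [abs_mul]
    exact mul_le_mul (hFT y hy l k) ((h y hy).2.2 k m i) (abs_nonneg _)
      ((abs_nonneg _).trans (hFT y hy l k))

/-- A flat connection over a star-shaped domain has parallel sections with prescribed values at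
the centre. -/
theorem exists_parallel (hU : StarConvex ℝ c (U : Set (Fin n → ℝ))) (hcU : c ∈ U)
    (hflat : ∀ k s t j, coordPartial U s (B k t j) - coordPartial U t (B k s j) =
      ∑ i, B k t i * B i s j - ∑ i, B k s i * B i t j) (c₀ : Fin n → ℝ) :
    ∃ y : Fin n → SmoothFun U, (∀ i, (y i).1 ⟨c, hcU⟩ = c₀ i) ∧
      ∀ m i, coordPartial U m (y i) = ∑ k, y k * B k m i := by
  obtain ⟨F, hF0, hF⟩ := exists_parallel_hasFDerivAt hU hcU hflat c₀
  -- Bootstrapping: the parallel equation expresses the derivative of F through F and smooth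
  -- coefficients, so each order of differentiability gives the next.
  have hsmooth : ∀ k : ℕ, ∀ i, ContDiffOn ℝ k (F i) U := by
    intro k
    induction k with
    | zero =>
      intro i
      rw [Nat.cast_zero, contDiffOn_zero]
      exact fun x hx => (hF i x hx).continuousAt.continuousWithinAt
    | succ k ih =>
      intro i
      rw [Nat.cast_succ, contDiffOn_succ_iff_fderiv_of_isOpen U.isOpen]
      refine ⟨fun x hx => (hF i x hx).differentiableAt.differentiableWithinAt, by simp, ?_⟩
      refine ContDiffOn.congr (f := fun x => ∑ m, (∑ k, F k x * extFun (B k m i) x) •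
        ContinuousLinearMap.proj (R := ℝ) (φ := fun _ : Fin n => ℝ) m) ?_
        fun x hx => (hF i x hx).fderiv
      refine ContDiffOn.sum fun m _ => ContDiffOn.smul (ContDiffOn.sum fun j _ =>
        (ih j).mul ((contDiffOn_extFun (B j m i)).of_le (by exact_mod_cast le_top)))
        contDiffOn_const
  have hy : ∀ i, (fun x : U => F i x.1) ∈ SmoothFun U := fun i =>
    (contDiffOn_infty.2 fun k => hsmooth k i).congr fun x hx => extend_val U _ hx
  refine ⟨fun i => ⟨_, hy i⟩, hF0, fun m i => ?_⟩
  ext x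
  have h := fderiv_extend_congr U (f := fun x : U => F i x.1) (F := F i) (fun _ => rfl) x
  rw [smoothFun_sum_apply]
  change fderiv ℝ (Function.extend Subtype.val (fun x : U => F i x.1) 0) x.1 (Pi.single m 1) = _
  rw [h, (hF i x.1 x.2).fderiv]
  simp [Pi.single_apply]

/-- A flat connection over a star-shaped domain has a parallel frame. -/
theorem exists_parallel_frame (hU : StarConvex ℝ c (U : Set (Fin n → ℝ))) (hcU : c ∈ U)
    (hflat : ∀ k s t j, coordPartial U s (B k t j) - coordPartial U t (B k s j) =
      ∑ i, B k t i * B i s j - ∑ i, B k s i * B i t j) :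
    ∃ e f : Fin n → Fin n → SmoothFun U,
      (∀ a m i, coordPartial U m (e a i) = ∑ k, e a k * B k m i) ∧
      (∀ i j, ∑ k, e i k * f k j = if i = j then 1 else 0) ∧
      ∀ i j, ∑ k, f i k * e k j = if i = j then 1 else 0 := by
  choose e he0 he using fun a => exists_parallel hU hcU hflat (Pi.single a 1)
  -- The dual connection, the negative transpose of B, is flat as well. Its parallel sections will
  -- form the inverse frame.
  have hflat' : ∀ k s t j, coordPartial U s (-B j t k) - coordPartial U t (-B j s k) =
      ∑ i, -B i t k * -B j s i - ∑ i, -B i s k * -B j t i := by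
    intro k s t j
    have h1 := hflat j s t k
    rw [map_neg, map_neg, Finset.sum_congr rfl fun i _ =>
        (by ring : -B i t k * -B j s i = B j s i * B i t k),
      Finset.sum_congr (f := fun i => -B i s k * -B j t i) rfl fun i _ =>
        (by ring : -B i s k * -B j t i = B j t i * B i s k)]
    linear_combination -h1
  choose f hf0 hf using fun a => exists_parallel (B := fun k m i => -B i m k) hU hcU hflat'
    (Pi.single a 1)
  have h1 : ∀ i j, ∑ k, e i k * f j k = if i = j then 1 else 0 := by
    intro i j
    have hzero : ∀ m, coordPartial U m (∑ k, e i k * f j k) = 0 := by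
      intro m
      simp only [map_sum, Derivation.leibniz, smul_eq_mul, he, hf, Finset.sum_add_distrib,
        Finset.mul_sum]
      rw [Finset.sum_comm, ← Finset.sum_add_distrib]
      refine Finset.sum_eq_zero fun k _ => ?_
      rw [← Finset.sum_add_distrib]
      exact Finset.sum_eq_zero fun l _ => by ring
    -- The pairing of parallel sections of dual connections has zero derivative. It is constant on
    -- the connected set U and is evaluated at the centre, where the initial values are standard
    -- basis vectors.
    have hconst : ∀ x : U, (∑ k, e i k * f j k).1 x = (∑ k, e i k * f j k).1 ⟨c, hcU⟩ := by
      intro x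
      rw [← extFun_apply _ x.2, ← extFun_apply _ hcU]
      refine U.isOpen.is_const_of_fderiv_eq_zero (𝕜 := ℝ)
        (hU.isPathConnected hcU).isConnected.isPreconnected
        ((contDiffOn_extFun _).differentiableOn (by simp)) (fun y hy => ?_) x.2 hcU
      ext v
      rw [fderiv_extFun_apply _ ⟨y, hy⟩]
      simp [hzero]
    ext x
    rw [hconst, smoothFun_sum_apply]
    simp only [smoothFun_mul_apply, he0, hf0, Pi.single_apply]
    split_ifs with hij
    · subst hij; simp
    · simp [Ne.symm hij]
  refine ⟨e, fun i j => f j i, he, h1, ?_⟩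
  have hm : (Matrix.of e) * (Matrix.of fun i j => f j i) = 1 := by
    ext1 i j
    rw [Matrix.mul_apply, Matrix.one_apply]
    exact h1 i j
  intro i j
  have hm' : (Matrix.of fun i j => f j i) * (Matrix.of e) = 1 := mul_eq_one_comm.1 hm
  have := congrFun (congrFun hm' i) j
  rwa [Matrix.mul_apply, Matrix.one_apply] at this

end ParallelSections

end VarHam
end

noncomputable section
namespace VarHam
variable {n : ℕ} {U : TopologicalSpace.Opens (Fin n → ℝ)}

/-! ### Operators acting on the coefficient functions of monomials. -/

section CoefficientOperators

/-- The operator that applies `φ k` to the coefficient functions of the monomials of degree `k`. -/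
def monoOp (φ : ℕ → SmoothFun U →ₗ[ℝ] SmoothFun U) : EvenJet U →ₗ[ℝ] EvenJet U :=
  TensorProduct.lift (LinearMap.flip ((MvPolynomial.basisMonomials (JetIdx n) ℝ).constr ℝ fun α =>
    (TensorProduct.mk ℝ (SmoothFun U) (MvPolynomial (JetIdx n) ℝ)).flip
      (MvPolynomial.monomial α 1) ∘ₗ φ α.degree))

theorem monoOp_monomial (φ : ℕ → SmoothFun U →ₗ[ℝ] SmoothFun U) (f : SmoothFun U)
    (α : JetIdx n →₀ ℕ) : monoOp φ (evenTmul f (MvPolynomial.monomial α 1)) =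
      evenTmul (φ α.degree f) (MvPolynomial.monomial α 1) := by
  have h := (MvPolynomial.basisMonomials (JetIdx n) ℝ).constr_basis ℝ (fun α =>
    (TensorProduct.mk ℝ (SmoothFun U) (MvPolynomial (JetIdx n) ℝ)).flip
      (MvPolynomial.monomial α 1) ∘ₗ φ α.degree) α
  rw [MvPolynomial.coe_basisMonomials] at h
  exact LinearMap.congr_fun h f

/-- The operator that applies `φ k` to the coefficient functions of the terms of degree `k` in the
variables `u^{i,s+1}`. -/
def coefOp (φ : ℕ → SmoothFun U →ₗ[ℝ] SmoothFun U) : DiffPoly U →ₗ[ℝ] DiffPoly U :=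
  LinearMap.rTensor _ (monoOp φ)

theorem coefOp_monomial (φ : ℕ → SmoothFun U →ₗ[ℝ] SmoothFun U) (f : SmoothFun U)
    (α : JetIdx n →₀ ℕ) (e : OddJet n) :
    coefOp φ (jetTmul (evenTmul f (MvPolynomial.monomial α 1)) e) =
      jetTmul (evenTmul (φ α.degree f) (MvPolynomial.monomial α 1)) e :=
  congrArg (fun a => jetTmul a e) (monoOp_monomial φ f α)

theorem diffPoly_monomial_induction {C : DiffPoly U → Prop} (a : DiffPoly U) (zero : C 0)
    (add : ∀ x y, C x → C y → C (x + y))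
    (mon : ∀ f α e, C (jetTmul (evenTmul f (MvPolynomial.monomial α 1)) e)) : C a := by
  induction a using diffPoly_induction with
  | zero => exact zero
  | add x y hx hy => exact add x y hx hy
  | tmul a e =>
    induction a using evenJet_induction with
    | zero => rw [zero_jetTmul]; exact zero
    | add x y hx hy => rw [add_jetTmul]; exact add _ _ hx hy
    | tmul f p =>
      induction p using MvPolynomial.induction_on' with
      | monomial α r =>
        have : evenTmul f (MvPolynomial.monomial α r) =
            evenTmul (r • f) (MvPolynomial.monomial α 1) := by
          rw [smul_evenTmul, ← evenTmul_smul, MvPolynomial.smul_monomial, smul_eq_mul, mul_one]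
        rw [this]
        exact mon _ _ _
      | add p q hp hq => rw [evenTmul_add, add_jetTmul]; exact add _ _ hp hq

theorem coefOp_comp (φ ψ : ℕ → SmoothFun U →ₗ[ℝ] SmoothFun U)
    (h : ∀ k f, φ k (ψ k f) = f) (x : DiffPoly U) : coefOp φ (coefOp ψ x) = x := by
  induction x using diffPoly_monomial_induction with
  | zero => simp
  | add x y hx hy => simp only [map_add, hx, hy]
  | mon f α e => rw [coefOp_monomial, coefOp_monomial, h]

/-- The variables u^{i,0} are functions and are absorbed into the coefficient g; the others form the
monomial. Replacing g by any other function keeps the degrees, so operators on coefficients are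
homogeneous. -/
theorem exists_prod_map_jetU (L : List (JetIdx n)) : ∃ (g : SmoothFun U) (α : JetIdx n →₀ ℕ),
    (L.map (jetU U)).prod = jetTmul (evenTmul g (MvPolynomial.monomial α 1)) 1 ∧
      ∀ h : SmoothFun U, jetTmul (evenTmul h (MvPolynomial.monomial α 1)) 1 ∈
        polyDeg U 0 (L.map Prod.snd).sum := by
  induction L with
  | nil => exact ⟨1, 0, rfl, fun h => ofFun_mem h⟩
  | cons j L ih =>
    obtain ⟨g, α, h1, h2⟩ := ih
    obtain ⟨i, _ | s⟩ := j
    · refine ⟨coordFun U i * g, α, ?_, fun h => by simpa using h2 h⟩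
      rw [List.map_cons, List.prod_cons, h1, jetU_zero, ofFun, jetTmul_mul, evenTmul_mul, one_mul,
        one_mul]
    · have key : ∀ h : SmoothFun U, jetTmul (evenTmul h (MvPolynomial.monomial
          (Finsupp.single (i, s) 1 + α) 1)) 1 =
          jetU U (i, s + 1) * jetTmul (evenTmul h (MvPolynomial.monomial α 1)) 1 := fun h => by
        rw [jetU, jetTmul_mul, evenTmul_mul, one_mul, one_mul, MvPolynomial.X,
          MvPolynomial.monomial_mul, one_mul]
      refine ⟨g, Finsupp.single (i, s) 1 + α, ?_, fun h => ?_⟩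
      · rw [List.map_cons, List.prod_cons, h1, key]
      · rw [key]
        exact mul_mem_polyDeg' (jetU_mem _) (h2 h) (by norm_num) (by simp)

theorem prod_map_jetTh_mem (K : List (JetIdx n)) :
    (K.map (jetTh U)).prod ∈ polyDeg U K.length (K.map Prod.snd).sum := by
  simpa [ofFun_one] using monomial_mem_polyDeg (U := U) 1 [] K

theorem prod_map_jetTh_eq (K : List (JetIdx n)) : ∃ e, (K.map (jetTh U)).prod = jetTmul 1 e := by
  induction K with
  | nil => exact ⟨1, rfl⟩
  | cons j K ih =>
    obtain ⟨e, he⟩ := ih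
    exact ⟨_, by rw [List.map_cons, List.prod_cons, he, jetTh, jetTmul_mul, one_mul]⟩

theorem coefOp_mem (φ : ℕ → SmoothFun U →ₗ[ℝ] SmoothFun U) {p d : ℤ} {x : DiffPoly U}
    (hx : x ∈ polyDeg U p d) : coefOp φ x ∈ polyDeg U p d := by
  refine (Submodule.span_le (p := (polyDeg U p d).comap (coefOp φ))).2 ?_ hx
  rintro _ ⟨f, L, K, rfl, rfl, rfl⟩
  obtain ⟨g, α, h1, h2⟩ := exists_prod_map_jetU (U := U) L
  obtain ⟨e, he⟩ := prod_map_jetTh_eq (U := U) K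
  have hK := prod_map_jetTh_mem (U := U) K
  rw [SetLike.mem_coe, Submodule.mem_comap, h1, he, ofFun, jetTmul_mul, jetTmul_mul, evenTmul_mul,
    one_mul, one_mul, one_mul, mul_one, coefOp_monomial, jetTmul_eq_mul]
  rw [he] at hK
  exact mul_mem_polyDeg' (h2 _) hK (by simp) (by push_cast; rfl)

end CoefficientOperators

/-! ### Poincaré lemma for the constant-coefficient differential. -/

section Homotopy

variable {c : Fin n → ℝ}

/-- The coordinates of the Euler vector field `∑ (u^i - c^i) ∂/∂u^i + ∑ u^{i,s+1} ∂/∂u^{i,s+1}`. -/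
def eulerCoord (c : Fin n → ℝ) : JetIdx n → DiffPoly U
  | (i, 0) => ofFun U (centred c i)
  | (i, s + 1) => jetU U (i, s + 1)

theorem parity_eulerCoord (j : JetIdx n) :
    parity U (eulerCoord (U := U) c j) = eulerCoord c j := by
  obtain ⟨i, _ | s⟩ := j
  · exact parity_ofFun U _
  · exact parity_jetU U (i, s + 1)

theorem eulerField_mul (a b : DiffPoly U) : vectorField U (eulerCoord c) 0 (a * b) =
    vectorField U (eulerCoord c) 0 a * b + a * vectorField U (eulerCoord c) 0 b :=
  vectorField_mul_even parity_eulerCoord (fun j => by simp) a b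

theorem eulerField_ofFun (f : SmoothFun U) :
    vectorField U (eulerCoord c) 0 (ofFun U f) = ofFun U (radial U c f) := by
  rw [vectorField_ofFun, radial_eq, ofFun_sum]
  simp only [ofFun_mul, eulerCoord]

theorem eulerField_jetTmul_one (e : OddJet n) :
    vectorField U (eulerCoord c) 0 (jetTmul 1 e) = 0 := by
  obtain ⟨S, hS'⟩ := exists_support U [jetTmul 1 e]
  have hS := hS' _ (List.mem_singleton.2 rfl)
  rw [vectorField_eq_sum U _ _ _ S (fun j h => (hS j h).1) (fun j h => (hS j h).2)]
  refine Finset.sum_eq_zero fun j _ => ?_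
  rw [dU_tmul, evenPartial_one, zero_jetTmul, mul_zero, Pi.zero_apply, zero_mul, add_zero]

theorem eulerField_monomial (α : JetIdx n →₀ ℕ) :
    vectorField U (eulerCoord c) 0 (jetTmul (evenTmul 1 (MvPolynomial.monomial α 1)) 1) =
      (α.degree : ℝ) • jetTmul (evenTmul 1 (MvPolynomial.monomial α 1)) 1 := by
  have hmul : ∀ α β : JetIdx n →₀ ℕ,
      (jetTmul (evenTmul 1 (MvPolynomial.monomial (α + β) 1)) 1 : DiffPoly U) =
        jetTmul (evenTmul 1 (MvPolynomial.monomial α 1)) 1 *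
          jetTmul (evenTmul 1 (MvPolynomial.monomial β 1)) 1 := fun α β => by
    rw [jetTmul_mul, evenTmul_mul, MvPolynomial.monomial_mul, one_mul, one_mul, one_mul]
  have hadd : ∀ α β : JetIdx n →₀ ℕ, 
      vectorField U (eulerCoord c) 0 (jetTmul (evenTmul 1 (MvPolynomial.monomial α 1)) 1) =
        (α.degree : ℝ) • jetTmul (evenTmul 1 (MvPolynomial.monomial α 1)) 1 →
      vectorField U (eulerCoord c) 0 (jetTmul (evenTmul 1 (MvPolynomial.monomial β 1)) 1) =
        (β.degree : ℝ) • jetTmul (evenTmul 1 (MvPolynomial.monomial β 1)) 1 →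
      vectorField U (eulerCoord c) 0 (jetTmul (evenTmul 1 (MvPolynomial.monomial (α + β) 1)) 1) =
        ((α + β).degree : ℝ) • jetTmul (evenTmul 1 (MvPolynomial.monomial (α + β) 1)) 1 := by
    intro α β h1 h2
    rw [hmul, eulerField_mul, h1, h2, smul_mul_assoc, mul_smul_comm, ← add_smul, map_add,
      Nat.cast_add]
  have hzero : vectorField U (eulerCoord c) 0
      (jetTmul (evenTmul 1 (MvPolynomial.monomial (0 : JetIdx n →₀ ℕ) 1)) 1) =
        ((0 : JetIdx n →₀ ℕ).degree : ℝ) •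
          jetTmul (evenTmul 1 (MvPolynomial.monomial (0 : JetIdx n →₀ ℕ) 1)) 1 := by
    rw [map_zero, Nat.cast_zero, zero_smul]
    refine (eulerField_ofFun 1).trans ?_
    rw [radial_eq, Finset.sum_eq_zero fun i _ => by rw [Derivation.map_one_eq_zero, mul_zero],
      ofFun_zero]
  induction α using Finsupp.induction_linear with
  | zero => exact hzero
  | add α β h1 h2 => exact hadd α β h1 h2
  | single j k =>
    induction k with
    | zero => rw [Finsupp.single_zero]; exact hzero
    | succ k ih =>
      rw [Finsupp.single_add]
      refine hadd _ _ ih ?_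
      rw [Finsupp.degree_single, Nat.cast_one, one_smul]
      exact vectorField_jetU _ _ (j.1, j.2 + 1)

/-- On a monomial of degree k in the u^{i,s+1}, the Euler field is the radial derivation of the
coefficient plus k. After adding m + 1, each coefficient operator is one that a ray integral
inverts. -/
theorem eulerField_add (m : ℕ) (x : DiffPoly U) :
    vectorField U (eulerCoord c) 0 x + ((m + 1 : ℕ) : ℝ) • x =
      coefOp (fun k => radial U c + ((m + k + 1 : ℕ) : ℝ) • LinearMap.id) x := by
  induction x using diffPoly_monomial_induction with
  | zero => simp
  | add x y hx hy => rw [map_add, map_add, ← hx, ← hy, smul_add]; abel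
  | mon f α e =>
    have key : ∀ f : SmoothFun U, jetTmul (evenTmul f (MvPolynomial.monomial α 1)) e =
        ofFun U f * (jetTmul (evenTmul 1 (MvPolynomial.monomial α 1)) 1 * jetTmul 1 e) := by
      intro f
      rw [ofFun, jetTmul_mul, jetTmul_mul, mul_one, evenTmul_mul, mul_one, one_mul, one_mul,
        one_mul]
    rw [coefOp_monomial, key, key, eulerField_mul, eulerField_mul, eulerField_ofFun,
      eulerField_monomial, eulerField_jetTmul_one, mul_zero, add_zero, LinearMap.add_apply,
      LinearMap.smul_apply, LinearMap.id_apply, ofFun_add, ofFun_smul, add_mul, smul_mul_assoc,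
      smul_mul_assoc, mul_smul_comm, add_assoc, ← add_smul]
    congr 2
    push_cast
    ring

/-- The differential `u^{i,s} ↦ θ_i^{s+1}`. -/
def modelD : DiffPoly U →ₗ[ℝ] DiffPoly U := vectorField U (fun j => jetTh U (shift j)) 0

theorem modelD_mul (a b : DiffPoly U) :
    modelD (a * b) = modelD a * b + parity U a * modelD b :=
  vectorField_mul_odd (fun j => parity_jetTh U _) (fun j => by simp) a b

theorem modelD_ofFun (f : SmoothFun U) :
    modelD (ofFun U f) = ∑ i, jetTh U (i, 1) * ofFun U (coordPartial U i f) :=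
  vectorField_ofFun _ _ f

theorem modelD_jetU (j : JetIdx n) : modelD (jetU U j) = jetTh U (shift j) :=
  vectorField_jetU _ _ j

theorem modelD_jetTh (j : JetIdx n) : modelD (jetTh U j) = 0 := vectorField_jetTh _ _ j

theorem modelD_modelD (a : DiffPoly U) : modelD (modelD a) = 0 :=
  vectorField_sq (fun j => parity_jetTh U _) (fun j => by simp) (fun j => modelD_jetTh _)
    (fun j => by simp) a

theorem modelD_mem {p d : ℤ} {a : DiffPoly U} (ha : a ∈ polyDeg U p d) :
    modelD a ∈ polyDeg U (p + 1) (d + 1) := by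
  refine derivation_mem_polyDeg (s := parity U) (fun _ _ _ => parity_mem) modelD_mul
    (fun f => ?_) (fun j => ?_) (fun j => ?_) ha
  · rw [modelD_ofFun]
    exact sum_mem fun i _ => mul_mem_polyDeg' (jetTh_mem _) (ofFun_mem _) (by norm_num)
      (by norm_num)
  · rw [modelD_jetU]
    convert jetTh_mem (U := U) (shift j) using 1
    simp [shift, add_comm]
  · rw [modelD_jetTh]; exact zero_mem _

/-- The components of the contracting vector field: `θ_i^{s+1} ↦ (s + 1) u^{i,s}`, with
coordinates centred at `c` for `s = 0`. -/
def contractCoord (c : Fin n → ℝ) : JetIdx n → DiffPoly U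
  | (_, 0) => 0
  | (i, 1) => ofFun U (centred c i)
  | (i, s + 2) => ((s + 1 : ℕ) + 1 : ℤ) • jetU U (i, s + 1)

def contractField (c : Fin n → ℝ) : DiffPoly U →ₗ[ℝ] DiffPoly U :=
  vectorField U 0 (contractCoord c)

theorem contractField_mul (a b : DiffPoly U) : contractField c (a * b) =
    contractField c a * b + parity U a * contractField c b := by
  refine vectorField_mul_odd (fun j => by simp) (fun j => ?_) a b
  obtain ⟨i, _ | _ | s⟩ := j
  · exact map_zero _
  · exact parity_ofFun U _
  · simp only [contractCoord, map_zsmul, parity_jetU]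

theorem contractField_ofFun (f : SmoothFun U) : contractField c (ofFun U f) = 0 := by
  rw [contractField, vectorField_ofFun]
  simp

theorem contractField_jetU (j : JetIdx n) : contractField c (jetU U j) = 0 :=
  vectorField_jetU _ _ j

theorem contractField_jetTh (j : JetIdx n) :
    contractField c (jetTh U j) = contractCoord c j := vectorField_jetTh _ _ j

theorem contractField_mem {p d : ℤ} {a : DiffPoly U} (ha : a ∈ polyDeg U p d) :
    contractField c a ∈ polyDeg U (p - 1) (d - 1) := by
  refine derivation_mem_polyDeg (q := -1) (e := -1) (s := parity U) (fun _ _ _ => parity_mem)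
    contractField_mul (fun f => ?_) (fun j => ?_) (fun j => ?_) ha
  · rw [contractField_ofFun]; exact zero_mem _
  · rw [contractField_jetU]; exact zero_mem _
  · rw [contractField_jetTh]
    obtain ⟨i, _ | _ | s⟩ := j
    · exact zero_mem _
    · exact ofFun_mem _
    · have h : jetU U (i, s + 1) ∈ polyDeg U (1 + -1) (-1 + ((s + 2 : ℕ) : ℤ)) := by
        rw [show (1 : ℤ) + -1 = 0 by norm_num,
          show (-1 : ℤ) + ((s + 2 : ℕ) : ℤ) = ((s + 1 : ℕ) : ℤ) by push_cast; ring]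
        exact jetU_mem (i, s + 1)
      exact (polyDeg U _ _).toAddSubgroup.zsmul_mem h _

/-- The anticommutator of two odd derivations is a derivation, so generators suffice. The weight s +
1 in the contraction is chosen for this: on u^{i,s} it is 1 from the Euler field plus the x-degree
s, with u^i centred at c when s = 0, and on θ_i^{s+1} it is the x-degree alone. On θ_i^0 both sides
vanish. -/
theorem modelD_contract_add (a : DiffPoly U) :
    modelD (contractField c a) + contractField c (modelD a) =
      vectorField U (eulerCoord c) 0 a +
        vectorField U (fun j => ((1 * j.2 : ℕ) : ℤ) • jetU U j)
          (fun j => ((1 * j.2 + 0 : ℕ) : ℤ) • jetTh U j) a := by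
  have hW : ∀ a b : DiffPoly U, vectorField U (fun j => ((1 * j.2 : ℕ) : ℤ) • jetU U j)
      (fun j => ((1 * j.2 + 0 : ℕ) : ℤ) • jetTh U j) (a * b) =
      vectorField U (fun j => ((1 * j.2 : ℕ) : ℤ) • jetU U j)
        (fun j => ((1 * j.2 + 0 : ℕ) : ℤ) • jetTh U j) a * b +
      a * vectorField U (fun j => ((1 * j.2 : ℕ) : ℤ) • jetU U j)
        (fun j => ((1 * j.2 + 0 : ℕ) : ℤ) • jetTh U j) b :=
    vectorField_mul_even (fun j => by rw [map_zsmul, parity_jetU])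
      (fun j => by rw [map_zsmul, parity_jetTh, smul_neg])
  have hp1 : ∀ a : DiffPoly U, parity U (modelD a) = -modelD (parity U a) :=
    parity_vectorField_odd (fun j => parity_jetTh U _) (fun j => by simp)
  have hp2 : ∀ a : DiffPoly U, parity U (contractField c a) = -contractField c (parity U a) := by
    refine parity_vectorField_odd (fun j => by simp) (fun j => ?_)
    obtain ⟨i, _ | _ | s⟩ := j
    · exact map_zero _
    · exact parity_ofFun U _
    · simp only [contractCoord, map_zsmul, parity_jetU]
  induction a using diffPoly_generators with
  | fn f =>
    rw [contractField_ofFun, map_zero, zero_add, modelD_ofFun, eulerField_ofFun, map_sum,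
      vectorField_ofFun, radial_eq, ofFun_sum]
    simp [contractField_mul, contractField_ofFun, contractField_jetTh, contractCoord, ofFun_mul]
  | even i s =>
    rw [contractField_jetU, map_zero, zero_add, modelD_jetU, contractField_jetTh,
      vectorField_jetU, vectorField_jetU]
    simp only [shift, contractCoord, eulerCoord, one_mul]
    rw [add_smul, one_smul, add_comm]
  | odd j =>
    rw [modelD_jetTh, map_zero, add_zero, contractField_jetTh, vectorField_jetTh,
      vectorField_jetTh, Pi.zero_apply, zero_add]
    obtain ⟨i, _ | _ | s⟩ := j
    · simp [contractCoord]
    · simp only [contractCoord]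
      rw [modelD_ofFun, Finset.sum_eq_single i]
      · rw [coordPartial_centred, if_pos rfl, ofFun_one]; simp
      · intro k _ hk; rw [coordPartial_centred, if_neg hk, ofFun_zero, mul_zero]
      · simp
    · simp only [contractCoord, map_zsmul, modelD_jetU, shift]
      congr 1
      push_cast; ring
  | add a b ha hb =>
    simp only [map_add] at ha hb ⊢
    rw [add_add_add_comm, ha, hb]; abel
  | mul a b ha hb =>
    rw [hW, eulerField_mul, contractField_mul, modelD_mul, map_add, map_add, modelD_mul,
      modelD_mul, contractField_mul, contractField_mul, hp1, hp2, parity_parity]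
    calc _ = (modelD (contractField c a) + contractField c (modelD a)) * b +
          a * (modelD (contractField c b) + contractField c (modelD b)) := by noncomm_ring
      _ = _ := by rw [ha, hb]; noncomm_ring

theorem modelD_contract_of_mem (m : ℕ) {p : ℤ} {a : DiffPoly U}
    (ha : a ∈ polyDeg U p ((m + 1 : ℕ) : ℤ)) :
    modelD (contractField c a) + contractField c (modelD a) =
      coefOp (fun k => radial U c + ((m + k + 1 : ℕ) : ℝ) • LinearMap.id) a := by
  rw [modelD_contract_add, weightField_of_mem 1 0 ha, ← eulerField_add]
  congr 1
  rw [Nat.cast_one, one_mul, Nat.cast_zero, zero_mul, add_zero, Nat.cast_smul_eq_nsmul ℝ,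
    natCast_zsmul]

/-- The differential `u^{i,s} ↦ θ_i^{s+1}` is exact in positive differential degree over a
star-shaped domain. -/
theorem exists_modelD_eq (hU : StarConvex ℝ c (U : Set (Fin n → ℝ))) {p d : ℤ} (hd : 0 < d)
    {a : DiffPoly U} (ha : a ∈ polyDeg U p d) (h : modelD a = 0) :
    ∃ b ∈ polyDeg U (p - 1) (d - 1), modelD b = a := by
  obtain ⟨m, rfl⟩ : ∃ m : ℕ, d = ((m + 1 : ℕ) : ℤ) := ⟨(d - 1).toNat, by omega⟩
  -- In x-degree m + 1 the anticommutator is the Euler field plus m + 1. Here b is the preimage of a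
  -- under it, and its contraction will be the primitive.
  set b := coefOp (fun k => rayInt hU (m + k)) a with hb
  have hbm : b ∈ polyDeg U p ((m + 1 : ℕ) : ℤ) := coefOp_mem _ ha
  have hE : modelD (contractField c b) + contractField c (modelD b) = a := by
    rw [modelD_contract_of_mem m hbm, hb, coefOp_comp]
    exact fun k f => radial_rayInt hU (m + k) f
  have hDb : modelD b ∈ polyDeg U (p + 1) ((m + 1 + 1 : ℕ) : ℤ) := by
    rw [Nat.cast_succ (m + 1)]
    exact modelD_mem hbm
  -- Applying `modelD` to the homotopy identity shows that the anticommutator in x-degree m + 2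
  -- kills `modelD b`. The anticommutator is injective there, by the other side of the ray inverse.
  have h0 : modelD b = 0 := by
    have h1 := modelD_contract_of_mem (c := c) (m + 1) hDb
    rw [modelD_modelD, map_zero, add_zero] at h1
    have h2 := congrArg modelD hE
    rw [map_add, modelD_modelD, zero_add, h, h1] at h2
    have h3 := coefOp_comp (fun k => rayInt hU (m + 1 + k))
      (fun k => radial U c + ((m + 1 + k + 1 : ℕ) : ℝ) • LinearMap.id)
      (fun k f => by
        rw [LinearMap.add_apply, LinearMap.smul_apply, LinearMap.id_apply, rayInt_radial hU])
      (modelD b)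
    rw [h2, map_zero] at h3
    exact h3.symm
  rw [h0, map_zero, add_zero] at hE
  exact ⟨contractField c b, contractField_mem hbm, hE⟩

end Homotopy

end VarHam
end

noncomputable section
namespace VarHam
variable {n : ℕ} {U : TopologicalSpace.Opens (Fin n → ℝ)}

/-! ### Substitution of odd elements for the odd variables. -/

section OddSubstitution

theorem sq_eq_zero_of_odd {x : DiffPoly U} (hx : parity U x = -x) : x * x = 0 := by
  have h := odd_mul_comm U hx x
  rw [hx, neg_mul] at h
  exact eq_of_two_smul (by rw [add_zero]; exact eq_neg_iff_add_eq_zero.1 h)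

/-- The inclusion of the even differential polynomials. -/
def includeEven : EvenJet U →ₐ[ℝ] DiffPoly U :=
  AlgHom.ofLinearMap
    { toFun := fun a => jetTmul a 1
      map_add' := fun a b => add_jetTmul U a b 1
      map_smul' := fun c a => smul_jetTmul U c a 1 }
    rfl (fun a b => by
      change jetTmul (a * b) 1 = jetTmul a 1 * jetTmul b 1
      rw [jetTmul_mul, mul_one])

/-- The substitution of odd elements `η j` for the odd variables. -/
def oddSubst (η : JetIdx n → DiffPoly U) (hη : ∀ j, parity U (η j) = -η j) :
    DiffPoly U →ₐ[ℝ] DiffPoly U :=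
  Algebra.TensorProduct.lift (R := ℝ) (S := ℝ) (A := EvenJet U) (B := OddJet n) (C := DiffPoly U)
    includeEven
    (ExteriorAlgebra.lift ℝ (A := DiffPoly U)
      ⟨Finsupp.linearCombination ℝ (M := DiffPoly U) η, fun m => by
        -- The universal property of the exterior algebra requires that every linear combination of
        -- the η_j squares to zero; such combinations are again odd.
        refine sq_eq_zero_of_odd (U := U) ?_
        induction m using Finsupp.induction_linear with
        | zero => simp
        | add x y hx hy => rw [map_add, map_add, hx, hy, neg_add]
        | single j c => rw [Finsupp.linearCombination_single, map_smul, hη, smul_neg]⟩)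
    (fun a x => tmul_one_mul U a _)

variable {η : JetIdx n → DiffPoly U} (hη : ∀ j, parity U (η j) = -η j)

theorem oddSubst_jetTmul_one (a : EvenJet U) : oddSubst η hη (jetTmul a 1) = jetTmul a 1 := by
  refine (Algebra.TensorProduct.lift_tmul (R := ℝ) (S := ℝ) (A := EvenJet U) (B := OddJet n)
    (C := DiffPoly U) _ _ _ _ _).trans ?_
  rw [map_one, mul_one]
  rfl

theorem oddSubst_ofFun (f : SmoothFun U) : oddSubst η hη (ofFun U f) = ofFun U f :=
  oddSubst_jetTmul_one hη _

theorem oddSubst_jetU (j : JetIdx n) : oddSubst η hη (jetU U j) = jetU U j := by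
  obtain ⟨i, _ | s⟩ := j <;> exact oddSubst_jetTmul_one hη _

theorem oddSubst_jetTh (j : JetIdx n) : oddSubst η hη (jetTh U j) = η j := by
  refine (Algebra.TensorProduct.lift_tmul (R := ℝ) (S := ℝ) (A := EvenJet U) (B := OddJet n)
    (C := DiffPoly U) _ _ _ _ _).trans ?_
  rw [map_one, one_mul, ExteriorAlgebra.lift_ι_apply]
  exact (Finsupp.linearCombination_single _ _ _).trans (one_smul _ _)

theorem parity_oddSubst (a : DiffPoly U) :
    parity U (oddSubst η hη a) = oddSubst η hη (parity U a) := by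
  induction a using diffPoly_generators with
  | fn f => rw [oddSubst_ofFun, parity_ofFun, oddSubst_ofFun]
  | even i s => rw [oddSubst_jetU, parity_jetU, oddSubst_jetU]
  | odd j => rw [oddSubst_jetTh, parity_jetTh, map_neg, oddSubst_jetTh, hη]
  | add a b ha hb => simp only [map_add, ha, hb]
  | mul a b ha hb => simp only [map_mul, ha, hb]

theorem oddSubst_mem (hm : ∀ j, η j ∈ polyDeg U 1 j.2) {p d : ℤ} {a : DiffPoly U}
    (ha : a ∈ polyDeg U p d) : oddSubst η hη a ∈ polyDeg U p d := by
  refine polyDeg_induction (C := fun p d a => oddSubst η hη a ∈ polyDeg U p d)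
    (fun f => ?_) (fun j => ?_) (fun j => ?_) (fun p d => ?_) (fun p d a b ha hb => ?_)
    (fun p q d e a b _ _ ha hb => ?_) ha
  · rw [oddSubst_ofFun]; exact ofFun_mem f
  · rw [oddSubst_jetU]; exact jetU_mem j
  · rw [oddSubst_jetTh]; exact hm j
  · rw [map_zero]; exact zero_mem _
  · rw [map_add]; exact add_mem ha hb
  · rw [map_mul]; exact mul_mem_polyDeg ha hb

theorem oddSubst_comp {ξ : JetIdx n → DiffPoly U} (hξ : ∀ j, parity U (ξ j) = -ξ j)
    (h : ∀ j, oddSubst ξ hξ (η j) = jetTh U j) (a : DiffPoly U) :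
    oddSubst ξ hξ (oddSubst η hη a) = a := by
  induction a using diffPoly_generators with
  | fn f => rw [oddSubst_ofFun, oddSubst_ofFun]
  | even i s => rw [oddSubst_jetU, oddSubst_jetU]
  | odd j => rw [oddSubst_jetTh, h]
  | add a b ha hb => simp only [map_add, ha, hb]
  | mul a b ha hb => simp only [map_mul, ha, hb]

theorem oddSubst_of_mem_zero {d : ℤ} {a : DiffPoly U} (ha : a ∈ polyDeg U 0 d) :
    oddSubst η hη a = a := by
  refine (Submodule.span_le (p := LinearMap.eqLocus (oddSubst η hη).toLinearMap
    LinearMap.id)).2 ?_ ha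
  rintro _ ⟨f, L, K, hK, rfl, rfl⟩
  obtain rfl := List.length_eq_zero_iff.1 (Int.natCast_eq_zero.1 hK)
  change oddSubst η hη _ = _
  rw [map_mul, map_mul, oddSubst_ofFun, map_list_prod, List.map_map]
  simp only [Function.comp_def, oddSubst_jetU, List.map_nil, List.prod_nil, map_one]
  rfl

end OddSubstitution

/-! ### Graded changes of the odd variables. -/

section Coframes

/-- A graded change of odd variables `θ_i^s ↦ ζ (i, s)`: each `ζ (i, s)` is homogeneous, and its
coefficients of the variables of top level `θ_k^s` form an invertible matrix of functions. -/
structure OddCoframe (ζ : JetIdx n → DiffPoly U) : Prop where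
  mem : ∀ j, ζ j ∈ polyDeg U 1 j.2
  top : ∀ s, ∃ m w : Fin n → Fin n → SmoothFun U,
    (∀ i k, dTh U (k, s) (ζ (i, s)) = ofFun U (m i k)) ∧
    (∀ i j, ∑ k, m i k * w k j = if i = j then 1 else 0) ∧
    ∀ i j, ∑ k, w i k * m k j = if i = j then 1 else 0

/-- The change of coordinates on the odd part of one-forms. -/
def coframeMap (ζ : JetIdx n → DiffPoly U) :
    (JetIdx n →₀ DiffPoly U) →ₗ[DiffPoly U] (JetIdx n →₀ DiffPoly U) :=
  Finsupp.linearCombination (DiffPoly U) fun j => gradTh U (ζ j)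

variable {ζ : JetIdx n → DiffPoly U}

theorem coframeMap_single (j : JetIdx n) (a : DiffPoly U) :
    coframeMap ζ (Finsupp.single j a) = a • gradTh U (ζ j) :=
  Finsupp.linearCombination_single _ _ _

theorem coframeMap_apply (c : JetIdx n →₀ DiffPoly U) (k : JetIdx n) :
    coframeMap ζ c k = c.sum fun j a => a * dTh U k (ζ j) := by
  rw [coframeMap, Finsupp.linearCombination_apply, Finsupp.sum, Finsupp.finsetSum_apply]
  rfl

theorem OddCoframe.dTh_mem (h : OddCoframe ζ) (j k : JetIdx n) :
    dTh U k (ζ j) ∈ polyDeg U 0 (j.2 - k.2) := by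
  simpa using VarHam.dTh_mem (h.mem j) k

theorem OddCoframe.dTh_eq_zero (h : OddCoframe ζ) {j k : JetIdx n} (hjk : j.2 < k.2) :
    dTh U k (ζ j) = 0 := dTh_eq_zero_of_lt (h.mem j) (by exact_mod_cast hjk)

theorem OddCoframe.parity (h : OddCoframe ζ) (j : JetIdx n) : VarHam.parity U (ζ j) = -ζ j :=
  parity_one (h.mem j)

/-- The change of basis is block triangular in the level, because ζ_{i,s} has degree s and so
contains no θ of level above s. Descending induction on the level uses the invertible diagonal
blocks. The family G serves both for injectivity, with G = 0, and for degrees. -/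
theorem OddCoframe.reflects (h : OddCoframe ζ) {G : ℕ → Submodule ℝ (DiffPoly U)}
    (hG : ∀ s t a b, s ≤ t → a ∈ G t → b ∈ polyDeg U 0 ((t : ℤ) - s) → a * b ∈ G s)
    {c : JetIdx n →₀ DiffPoly U} (hc : ∀ k, coframeMap ζ c k ∈ G k.2) (j : JetIdx n) :
    c j ∈ G j.2 := by
  classical
  obtain ⟨N, hN⟩ := exists_level_bound c
  have key : ∀ m s, N ≤ s + m → ∀ i, c (i, s) ∈ G s := by
    intro m
    induction m with
    | zero => intro s hs i; rw [hN _ hs]; exact zero_mem _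
    | succ m ih =>
      intro s hs i
      obtain ⟨μ, w, hμ, hmw, -⟩ := h.top s
      have hup : ∀ j : JetIdx n, s < j.2 → c j ∈ G j.2 := fun j hj => ih j.2 (by omega) j.1
      have hsum : ∀ k, ∑ l, c (l, s) * ofFun U (μ l k) ∈ G s := by
        intro k
        have h1 := hc (k, s)
        rw [coframeMap_apply, Finsupp.sum, ← Finset.sum_filter_add_sum_filter_not _
          (fun j => j.2 = s)] at h1
        have h2 : ∑ j ∈ c.support.filter (fun j => ¬ j.2 = s), c j * dTh U (k, s) (ζ j) ∈ G s := by
          refine sum_mem fun j hj => ?_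
          rcases lt_or_gt_of_ne (Finset.mem_filter.1 hj).2 with hlt | hgt
          · rw [h.dTh_eq_zero hlt, mul_zero]; exact zero_mem _
          · exact hG s j.2 _ _ hgt.le (hup j hgt) (h.dTh_mem j (k, s))
        have h3 := (Submodule.add_mem_iff_left _ h2).1 h1
        convert h3 using 1
        simp only [← hμ]
        rw [← Finset.sum_image (s := Finset.univ) (g := fun l : Fin n => ((l, s) : JetIdx n))
          (f := fun j => c j * dTh U (k, s) (ζ j)) (fun _ _ _ _ h => (Prod.ext_iff.1 h).1)]
        refine (Finset.sum_subset (fun j hj => ?_) fun j hj hj' => ?_).symm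
        · exact Finset.mem_image.2 ⟨j.1, Finset.mem_univ _,
            Prod.ext rfl (Finset.mem_filter.1 hj).2.symm⟩
        · obtain ⟨l, -, rfl⟩ := Finset.mem_image.1 hj
          have : c (l, s) = 0 := by
            by_contra hne
            exact hj' (Finset.mem_filter.2 ⟨Finsupp.mem_support_iff.2 hne, rfl⟩)
          rw [this, zero_mul]
      -- After removal of the higher levels, the coefficients at level s are recovered by inverting
      -- the diagonal block.
      have hi : c (i, s) = ∑ k, (∑ l, c (l, s) * ofFun U (μ l k)) * ofFun U (w k i) := by
        simp only [Finset.sum_mul, mul_assoc, ← ofFun_mul]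
        rw [Finset.sum_comm]
        simp only [← Finset.mul_sum, ← ofFun_sum, hmw]
        rw [Finset.sum_eq_single i (fun l _ hl => by rw [if_neg hl, ofFun_zero, mul_zero])
          (fun h => absurd (Finset.mem_univ i) h), if_pos rfl, ofFun_one, mul_one]
      rw [hi]
      exact sum_mem fun k _ => hG s s _ _ le_rfl (hsum k) (by rw [sub_self]; exact ofFun_mem _)
  exact key N j.2 (by omega) j.1

theorem OddCoframe.injective (h : OddCoframe ζ) : Function.Injective (coframeMap ζ) := by
  rw [injective_iff_map_eq_zero]
  intro c hc
  ext j
  refine (Submodule.mem_bot ℝ).1 (h.reflects (G := fun _ => ⊥) ?_ (fun k => ?_) j)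
  · intro s t a b _ ha _
    rw [(Submodule.mem_bot ℝ).1 ha, zero_mul]
    exact zero_mem _
  · rw [hc]; exact zero_mem _

/-- The same triangularity used for elimination: a combination of the ζ_{i,s} clears the top level s
of the target without touching higher levels, and the rest has smaller level. -/
theorem OddCoframe.surjective (h : OddCoframe ζ) : Function.Surjective (coframeMap ζ) := by
  rw [← LinearMap.range_eq_top]
  have key : ∀ s, ∀ v : JetIdx n →₀ DiffPoly U, (∀ j, s ≤ j.2 → v j = 0) →
      v ∈ LinearMap.range (coframeMap ζ) := by
    intro s
    induction s with
    | zero =>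
      intro v hv
      rw [show v = 0 from Finsupp.ext fun j => hv j (Nat.zero_le _)]
      exact zero_mem _
    | succ s ih =>
      intro v hv
      obtain ⟨μ, w, hμ, -, hwm⟩ := h.top s
      set c : JetIdx n →₀ DiffPoly U :=
        ∑ k, ∑ i, Finsupp.single (i, s) (v (k, s) * ofFun U (w k i)) with hc
      have hTc : ∀ j, coframeMap ζ c j = ∑ k, ∑ i, v (k, s) * ofFun U (w k i) *
          dTh U j (ζ (i, s)) := by
        intro j
        simp only [hc, map_sum, coframeMap_single, Finsupp.finsetSum_apply]
        rfl
      have : v - coframeMap ζ c ∈ LinearMap.range (coframeMap ζ) := by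
        refine ih _ fun j hj => ?_
        rw [Finsupp.sub_apply, hTc]
        rcases hj.lt_or_eq with hlt | heq
        · rw [hv j hlt, zero_sub, neg_eq_zero]
          exact Finset.sum_eq_zero fun k _ => Finset.sum_eq_zero fun i _ => by
            rw [h.dTh_eq_zero hlt, mul_zero]
        · obtain ⟨l, t⟩ := j
          obtain rfl : s = t := heq
          simp only [hμ, mul_assoc, ← ofFun_mul]
          simp only [← Finset.mul_sum, ← ofFun_sum, hwm]
          rw [Finset.sum_eq_single l (fun k _ hk => by rw [if_neg hk, ofFun_zero, mul_zero])
            (fun h => absurd (Finset.mem_univ l) h), if_pos rfl, ofFun_one, mul_one, sub_self]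
      have h2 := add_mem this (LinearMap.mem_range_self (coframeMap ζ) c)
      rwa [sub_add_cancel] at h2
  rw [eq_top_iff]
  intro v _
  obtain ⟨N, hN⟩ := exists_level_bound v
  exact key N v hN

theorem OddCoframe.reflects_degree (h : OddCoframe ζ) {p d : ℤ} {c : JetIdx n →₀ DiffPoly U}
    (hc : ∀ k, coframeMap ζ c k ∈ polyDeg U p (d - k.2)) (j : JetIdx n) :
    c j ∈ polyDeg U p (d - j.2) := by
  refine h.reflects (G := fun s => polyDeg U p (d - s)) (fun s t a b _ ha hb => ?_) hc j
  exact mul_mem_polyDeg' ha hb (add_zero p) (by ring)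

/-- A graded change of odd variables has a graded inverse. -/
theorem OddCoframe.exists_inverse (h : OddCoframe ζ) : ∃ (ξ : JetIdx n → DiffPoly U)
    (hξ : ∀ j, ξ j ∈ polyDeg U 1 j.2),
    (∀ j, oddSubst ζ h.parity (ξ j) = jetTh U j) ∧
      ∀ j, oddSubst ξ (fun j => parity_one (hξ j)) (ζ j) = jetTh U j := by
  -- The rows N j are those of the inverse transition matrix, so the inverse substitution is θ_j ↦ ∑
  -- N_{jk} θ_k.
  choose N hN using fun j => h.surjective (Finsupp.single j 1)
  have hNm : ∀ j k, N j k ∈ polyDeg U 0 (j.2 - k.2) := fun j k => by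
    classical
    refine h.reflects_degree (fun k => ?_) k
    rw [hN, Finsupp.single_apply]
    split_ifs with hjk
    · rw [hjk, sub_self]; exact one_mem_polyDeg
    · exact zero_mem _
  have hL : ∀ (η : JetIdx n → DiffPoly U) (c : JetIdx n →₀ DiffPoly U),
      (c.sum fun k a => a * η k) = Finsupp.linearCombination (DiffPoly U) η c := fun η c => by
    rw [Finsupp.linearCombination_apply]; rfl
  have hζ : ∀ j, ζ j = Finsupp.linearCombination (DiffPoly U) (jetTh U) (gradTh U (ζ j)) :=
    fun j => (gradTh_sum_of_mem (h.mem j)).trans (hL _ _)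
  have hsub : ∀ (η : JetIdx n → DiffPoly U) (hη : ∀ j, VarHam.parity U (η j) = -η j)
      (c : JetIdx n →₀ DiffPoly U) (d : ℤ), (∀ k, c k ∈ polyDeg U 0 (d - k.2)) →
      oddSubst η hη (Finsupp.linearCombination (DiffPoly U) (jetTh U) c) =
        Finsupp.linearCombination (DiffPoly U) η c := by
    intro η hη c d hc
    rw [← hL, ← hL, Finsupp.sum, Finsupp.sum, map_sum]
    exact Finset.sum_congr rfl fun k _ => by
      rw [map_mul, oddSubst_jetTh, oddSubst_of_mem_zero hη (hc k)]
  have hcomp : ∀ (η : JetIdx n → JetIdx n →₀ DiffPoly U) (c : JetIdx n →₀ DiffPoly U),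
      Finsupp.linearCombination (DiffPoly U)
        (fun k => Finsupp.linearCombination (DiffPoly U) (jetTh U) (η k)) c =
      Finsupp.linearCombination (DiffPoly U) (jetTh U)
        (Finsupp.linearCombination (DiffPoly U) η c) := by
    intro η c
    rw [Finsupp.linearCombination_apply, Finsupp.linearCombination_apply (DiffPoly U) c,
      Finsupp.sum, Finsupp.sum, map_sum]
    exact Finset.sum_congr rfl fun k _ => (map_smul _ _ _).symm
  have hξ : ∀ j, Finsupp.linearCombination (DiffPoly U) (jetTh U) (N j) ∈ polyDeg U 1 j.2 := by
    intro j
    rw [← hL]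
    exact sum_mem fun k _ => mul_mem_polyDeg' (hNm j k) (jetTh_mem k) (by norm_num) (by ring)
  refine ⟨fun j => Finsupp.linearCombination (DiffPoly U) (jetTh U) (N j), hξ, fun j => ?_,
    fun j => ?_⟩
  · rw [hsub _ _ _ j.2 (hNm j)]
    conv_lhs => rw [funext hζ]
    rw [hcomp]
    change Finsupp.linearCombination (DiffPoly U) (jetTh U) (coframeMap ζ (N j)) = _
    rw [hN, Finsupp.linearCombination_single, one_smul]
  · conv_lhs => rw [hζ j]
    rw [hsub _ _ _ j.2 fun k => h.dTh_mem j k, hcomp]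
    -- N was chosen as a one-sided inverse of the transition matrix; injectivity of `coframeMap`
    -- makes it inverse on the other side too.
    have : Finsupp.linearCombination (DiffPoly U) N (gradTh U (ζ j)) = Finsupp.single j 1 := by
      refine h.injective ?_
      rw [coframeMap_single, one_smul, Finsupp.linearCombination_apply, Finsupp.sum, map_sum]
      simp only [map_smul, hN]
      conv_rhs => rw [← Finsupp.sum_single (gradTh U (ζ j))]
      exact Finset.sum_congr rfl fun k _ => by
        rw [Finsupp.smul_single, smul_eq_mul, mul_one]
    rw [this, Finsupp.linearCombination_single, one_smul]

end Coframes

end VarHam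
end

noncomputable section
namespace VarHam
variable {n : ℕ} {U : TopologicalSpace.Opens (Fin n → ℝ)} {P : LocalFunctional U}

/-! ### Odd coordinates in which D_P has constant coefficients. -/

section HamiltonianCoframe

/-- An odd coframe of `D_P`-closed elements, with `ζ (i, s + 1)` the image of `u^{i,s}`. -/
structure HamCoframe (P : LocalFunctional U) (ζ : JetIdx n → DiffPoly U) : Prop
    extends OddCoframe ζ where
  hamD_jetU : ∀ j, hamD P (jetU U j) = ζ (shift j)
  hamD_eq_zero : ∀ j, hamD P (ζ j) = 0

/-- Each ∂_x raises the top level by one and leaves the top coefficient unchanged, so every block of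
positive level in the coframe is the same matrix g. -/
theorem dTh_totalD_pow {p : ℤ} {a : DiffPoly U} (ha : a ∈ polyDeg U p 1) (k : Fin n) (s : ℕ) :
    dTh U (k, s + 1) ((totalD U ^ s) a) = dTh U (k, 1) a := by
  induction s with
  | zero => rfl
  | succ s ih =>
    rw [pow_succ', Module.End.mul_apply, dTh_succ_totalD,
      dTh_eq_zero_of_lt (totalD_pow_mem ha s) (by push_cast; omega), map_zero, zero_add, ih]

/-- The coframe given by a frame `e` of one-forms and the components of the vector field `D_P`. -/
def hamCoframe (P : LocalFunctional U) (e : Fin n → Fin n → SmoothFun U) : JetIdx n → DiffPoly U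
  | (a, 0) => ∑ k, ofFun U (e a k) * jetTh U (k, 0)
  | (i, s + 1) => (totalD U ^ s) (varTh U i P)

/-- In D_P(∑ y_k θ_k), the derivative of y contributes -∂_m y_i and the connection contributes ∑ y_k
B^k_{mi}. The parallel equation says exactly that they cancel. -/
theorem hamD_parallel (hP : P ∈ functionalDeg U 2 1) {B : Fin n → Fin n → Fin n → SmoothFun U}
    (hB : ∀ k, varU U k P = ∑ m, (∑ i, ofFun U (B k m i) * jetTh U (i, 0)) * varTh U m P)
    {y : Fin n → SmoothFun U} (hy : ∀ m i, coordPartial U m (y i) = ∑ k, y k * B k m i) :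
    hamD P (∑ k, ofFun U (y k) * jetTh U (k, 0)) = 0 := by
  have h1 : ∀ k, hamD P (ofFun U (y k) * jetTh U (k, 0)) =
      -(∑ m, ∑ l, ofFun U (y l * B l m k) * jetTh U (k, 0) * varTh U m P) +
        ∑ m, ∑ i, ofFun U (y k * B k m i) * jetTh U (i, 0) * varTh U m P := by
    intro k
    rw [hamD_mul hP, hamD_ofFun, parity_ofFun, hamD_jetTh, pow_zero, Module.End.one_apply, hB]
    congr 1
    · rw [Finset.sum_mul, ← Finset.sum_neg_distrib]
      refine Finset.sum_congr rfl fun m _ => ?_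
      rw [hy, mul_assoc, odd_mul_comm U (parity_one (varTh_mem hP m)), map_mul, parity_ofFun,
        parity_jetTh, mul_neg, neg_mul, ofFun_sum, Finset.sum_mul, Finset.sum_mul]
    · simp only [Finset.mul_sum, Finset.sum_mul, ofFun_mul, mul_assoc]
  rw [map_sum, Finset.sum_congr rfl fun k _ => h1 k, Finset.sum_add_distrib,
    Finset.sum_neg_distrib, neg_add_eq_zero]
  rw [Finset.sum_comm, Finset.sum_comm (f := fun k m => ∑ i, ofFun U (y k * B k m i) *
    jetTh U (i, 0) * varTh U m P)]
  exact Finset.sum_congr rfl fun m _ => Finset.sum_comm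

/-- The diagonal block at level zero is the parallel frame, whose members D_P annihilates. At
positive levels the block is g, and closedness comes from D_P(δP/δθ_i) = 0. -/
theorem IsHydroHamiltonian.exists_coframe (hP : IsHydroHamiltonian U P) {c : Fin n → ℝ}
    (hU : StarConvex ℝ c (U : Set (Fin n → ℝ))) (hcU : c ∈ U) : ∃ ζ, HamCoframe P ζ := by
  obtain ⟨g, h, H⟩ := hP.exists_metric
  obtain ⟨B, hB⟩ := H.exists_connection hP.mem hP.schouten_eq_zero
  obtain ⟨e, f, he, hef, hfe⟩ := exists_parallel_frame hU hcU
    (H.connection_flat hP.mem hP.schouten_eq_zero hB)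
  refine ⟨hamCoframe P e, ⟨fun j => ?_, fun s => ?_⟩, fun j => ?_, fun j => ?_⟩
  · obtain ⟨i, _ | s⟩ := j
    · exact sum_mem fun k _ => mul_mem_polyDeg' (ofFun_mem _) (jetTh_mem _) (by norm_num)
        (by norm_num)
    · have h := totalD_pow_mem (varTh_mem hP.mem i) s
      rwa [add_comm, ← Nat.cast_succ] at h
  · cases s with
    | zero =>
      refine ⟨e, f, fun i k => ?_, hef, hfe⟩
      change dTh U (k, 0) (∑ l, ofFun U (e i l) * jetTh U (l, 0)) = _
      rw [map_sum, Finset.sum_eq_single k]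
      · rw [dTh_mul, dTh_ofFun, dTh_jetTh, if_pos rfl, parity_ofFun, zero_mul, zero_add, mul_one]
      · intro l _ hl
        rw [dTh_mul, dTh_ofFun, dTh_jetTh, if_neg (fun h => hl (Prod.ext_iff.1 h).1.symm),
          mul_zero, zero_mul, zero_add]
      · simp
    | succ s =>
      exact ⟨g, h, fun i k => (dTh_totalD_pow (varTh_mem hP.mem i) k s).trans (H.dTh_varTh i k),
        H.mul_inv, H.inv_mul⟩
  · exact VarHam.hamD_jetU j.1 j.2
  · obtain ⟨i, _ | s⟩ := j
    · exact hamD_parallel hP.mem hB (he i)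
    · exact (hamD_totalD_pow s _).trans
        (by rw [(hamD_variational hP.mem hP.schouten_eq_zero i).1, map_zero])

variable {ζ : JetIdx n → DiffPoly U}

/-- The substitution respects parity, so both composites obey the same twisted Leibniz rule and it
is enough to compare them on generators. -/
theorem HamCoframe.hamD_oddSubst (h : HamCoframe P ζ) (hP : P ∈ functionalDeg U 2 1)
    (a : DiffPoly U) :
    hamD P (oddSubst ζ h.parity a) = oddSubst ζ h.parity (modelD a) := by
  induction a using diffPoly_generators with
  | fn f =>
    rw [oddSubst_ofFun, hamD_ofFun, modelD_ofFun, map_sum]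
    refine Finset.sum_congr rfl fun i _ => ?_
    rw [map_mul, oddSubst_jetTh, oddSubst_ofFun]
    congr 1
    exact (VarHam.hamD_jetU i 0).symm.trans (h.hamD_jetU (i, 0))
  | even i s => rw [oddSubst_jetU, h.hamD_jetU, modelD_jetU, oddSubst_jetTh]
  | odd j => rw [oddSubst_jetTh, h.hamD_eq_zero, modelD_jetTh, map_zero]
  | add a b ha hb => simp only [map_add, ha, hb]
  | mul a b ha hb =>
    rw [map_mul, hamD_mul hP, ha, hb, modelD_mul, map_add, map_mul, map_mul, parity_oddSubst]

/-- The differential `D_P` on differential polynomials is exact in positive differential degree. -/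
theorem HamCoframe.exists_hamD_eq (h : HamCoframe P ζ) (hP : P ∈ functionalDeg U 2 1)
    {c : Fin n → ℝ} (hU : StarConvex ℝ c (U : Set (Fin n → ℝ))) {p d : ℤ} (hd : 0 < d)
    {a : DiffPoly U} (ha : a ∈ polyDeg U p d) (h0 : hamD P a = 0) :
    ∃ b ∈ polyDeg U (p - 1) (d - 1), hamD P b = a := by
  obtain ⟨ξ, hξ, h1, h2⟩ := h.exists_inverse
  have e1 := oddSubst_comp (fun j => parity_one (hξ j)) h.parity h1
  have e2 := oddSubst_comp h.parity (fun j => parity_one (hξ j)) h2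
  set a' := oddSubst ξ (fun j => parity_one (hξ j)) a
  have h0' : modelD a' = 0 := by
    rw [← e2 (modelD a'), ← h.hamD_oddSubst hP, e1, h0, map_zero]
  obtain ⟨b, hb, hba⟩ := exists_modelD_eq hU hd (oddSubst_mem _ hξ ha) h0'
  exact ⟨oddSubst ζ h.parity b, oddSubst_mem _ h.mem hb, by rw [h.hamD_oddSubst hP, hba, e1]⟩

end HamiltonianCoframe

/-! ### Exactness on one-forms. -/

section FormExactness

theorem smul_mem_formDeg {p d q e : ℤ} {a : DiffPoly U} {w : JetForm U} (ha : a ∈ polyDeg U q e)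
    (hw : w ∈ formDeg U p d) : a • w ∈ formDeg U (q + p) (e + d) := fun j =>
  ⟨mul_mem_polyDeg' ha (hw j).1 rfl (by ring), mul_mem_polyDeg' ha (hw j).2 (by ring) (by ring)⟩

theorem delta_mem {p d : ℤ} {a : DiffPoly U} (ha : a ∈ polyDeg U p d) :
    delta U a ∈ formDeg U p d := fun j => ⟨dU_mem ha j, parity_mem (dTh_mem ha j)⟩

theorem formLie_mem (hP : P ∈ functionalDeg U 2 1) {p d : ℤ} {w : JetForm U}
    (hw : w ∈ formDeg U p d) : formLie U P w ∈ formDeg U (p + 1) (d + 1) := by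
  rw [formLie_eq, lieForm_one_apply]
  refine add_mem (fun j => ⟨?_, ?_⟩) (add_mem (sum_mem fun j _ => ?_) (sum_mem fun j _ => ?_))
  · have h := hamD_mem hP (hw j).1
    rwa [sub_add_eq_add_sub] at h
  · have h := hamD_mem hP (hw j).2
    rwa [sub_add_eq_add_sub, sub_add_eq_add_sub] at h
  · convert smul_mem_formDeg (parity_mem (hw j).1)
      (delta_mem (prolong_mem (fun i => varTh_mem hP i) j)) using 1
    congr 1
    ring
  · convert smul_mem_formDeg (parity_mem (hw j).2)
      (delta_mem (prolong_mem (fun i => varU_mem hP i) j)) using 1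
    congr 1 <;> ring

variable {ζ : JetIdx n → DiffPoly U}

variable (ζ) in
/-- The form with coefficients `a`, `b` in the coframe `δu^{i,s}`, `δζ (i, s)`. -/
def coframeForm (a b : JetIdx n →₀ DiffPoly U) : JetForm U :=
  (a, 0) + b.sum fun j c => c • delta U (ζ j)

theorem coframeForm_add (a b a' b' : JetIdx n →₀ DiffPoly U) :
    coframeForm ζ (a + a') (b + b') = coframeForm ζ a b + coframeForm ζ a' b' := by
  rw [coframeForm, coframeForm, coframeForm, Finsupp.sum_add_index'
    (h := fun j c => c • delta U (ζ j)) (fun j => zero_smul _ _) (fun j c c' => add_smul _ _ _),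
    add_add_add_comm]
  congr 1

theorem OddCoframe.delta_snd (h : OddCoframe ζ) (j : JetIdx n) :
    (delta U (ζ j)).2 = gradTh U (ζ j) :=
  Finsupp.ext fun k => parity_zero (h.dTh_mem j k)

theorem OddCoframe.coframeForm_snd (h : OddCoframe ζ) (a b : JetIdx n →₀ DiffPoly U) :
    (coframeForm ζ a b).2 = coframeMap ζ b := by
  rw [coframeForm, Finsupp.sum, Prod.snd_add, Prod.snd_sum, zero_add, coframeMap,
    Finsupp.linearCombination_apply, Finsupp.sum]
  exact Finset.sum_congr rfl fun j _ => congrArg (b j • ·) (h.delta_snd j)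

/-- The basis change is triangular here too: the δθ part determines b, and the δu parts of the δζ_j
are then compensated in a. -/
theorem OddCoframe.exists_coframeForm (h : OddCoframe ζ) (w : JetForm U) :
    ∃ a b, w = coframeForm ζ a b := by
  obtain ⟨b, hb⟩ := h.surjective w.2
  refine ⟨w.1 - (coframeForm ζ 0 b).1, b, Prod.ext ?_ ?_⟩
  · rw [coframeForm, coframeForm, Prod.fst_add, Prod.fst_add, zero_add, sub_add_cancel]
  · rw [h.coframeForm_snd, hb]

theorem coframeForm_mem {p d : ℤ} (hζ : ∀ j, ζ j ∈ polyDeg U 1 j.2) {a b : JetIdx n →₀ DiffPoly U}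
    (ha : ∀ j, a j ∈ polyDeg U p (d - j.2)) (hb : ∀ j, b j ∈ polyDeg U (p - 1) (d - j.2)) :
    coframeForm ζ a b ∈ formDeg U p d := by
  refine add_mem (fun j => ⟨ha j, zero_mem _⟩) (sum_mem fun j _ => ?_)
  convert smul_mem_formDeg (hb j) (delta_mem (hζ j)) using 1
  congr 1 <;> ring

/-- The Lie derivative commutes with δ, hence sends δu_j to δζ_{shift j} and δζ_j to 0. It becomes
D_P on all coefficients plus the shift of the δu coefficients, with the sign of an odd operator
passing them. -/
theorem HamCoframe.formLie_coframeForm (h : HamCoframe P ζ) (hP : P ∈ functionalDeg U 2 1)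
    (a b : JetIdx n →₀ DiffPoly U) : formLie U P (coframeForm ζ a b) =
      coframeForm ζ (Finsupp.mapRange.linearMap (hamD P) a)
        (Finsupp.mapRange.linearMap (hamD P) b +
          Finsupp.lmapDomain (DiffPoly U) ℝ shift
            (Finsupp.mapRange.linearMap (parity U).toLinearMap a)) := by
  have hzero : coframeForm ζ (0 : JetIdx n →₀ DiffPoly U) 0 = 0 := by
    rw [coframeForm, Finsupp.sum_zero_index, add_zero]; rfl
  have hA : ∀ a : JetIdx n →₀ DiffPoly U, formLie U P (coframeForm ζ a 0) =
      coframeForm ζ (Finsupp.mapRange.linearMap (hamD P) a)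
        (Finsupp.lmapDomain (DiffPoly U) ℝ shift
          (Finsupp.mapRange.linearMap (parity U).toLinearMap a)) := by
    intro a
    induction a using Finsupp.induction_linear with
    | zero => simp only [map_zero, hzero]
    | add a a' ha ha' =>
      rw [← add_zero (0 : JetIdx n →₀ DiffPoly U), coframeForm_add, map_add, ha, ha', map_add,
        map_add, map_add, coframeForm_add]
    | single j c =>
      have e : coframeForm ζ (Finsupp.single j c) 0 = c • delta U (jetU U j) := by
        rw [coframeForm, Finsupp.sum_zero_index, add_zero, delta_jetU]
        refine Prod.ext ?_ (smul_zero c).symm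
        rw [Prod.smul_fst, Finsupp.smul_single, smul_eq_mul, mul_one]
      rw [e, formLie_smul hP, formLie_delta hP, h.hamD_jetU, delta_jetU, coframeForm,
        Finsupp.mapRange.linearMap_apply, Finsupp.mapRange.linearMap_apply,
        Finsupp.lmapDomain_apply, Finsupp.mapRange_single, Finsupp.mapRange_single,
        Finsupp.mapDomain_single,
        Finsupp.sum_single_index (h := fun j c => c • delta U (ζ j)) (zero_smul _ _)]
      congr 1
      refine Prod.ext ?_ (smul_zero _)
      rw [Prod.smul_fst, Finsupp.smul_single, smul_eq_mul, mul_one]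
  have hB : ∀ b : JetIdx n →₀ DiffPoly U, formLie U P (coframeForm ζ 0 b) =
      coframeForm ζ 0 (Finsupp.mapRange.linearMap (hamD P) b) := by
    intro b
    induction b using Finsupp.induction_linear with
    | zero => simp only [map_zero, hzero]
    | add b b' hb hb' =>
      rw [← add_zero (0 : JetIdx n →₀ DiffPoly U), coframeForm_add, map_add, hb, hb', map_add,
        coframeForm_add]
    | single j c =>
      have e : ∀ c : DiffPoly U, coframeForm ζ 0 (Finsupp.single j c) = c • delta U (ζ j) := by
        intro c
        rw [coframeForm,
          Finsupp.sum_single_index (h := fun j c => c • delta U (ζ j)) (zero_smul _ _)]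
        exact zero_add _
      rw [Finsupp.mapRange.linearMap_apply, Finsupp.mapRange_single, e, e, formLie_smul hP,
        formLie_delta hP, h.hamD_eq_zero, map_zero, smul_zero, add_zero]
  have hab : coframeForm ζ a b = coframeForm ζ a 0 + coframeForm ζ 0 b := by
    rw [← coframeForm_add, add_zero, zero_add]
  rw [hab, map_add, hA, hB, ← coframeForm_add, add_zero, add_comm (Finsupp.mapRange.linearMap _ b)]

/-- The Lie derivative along `D_P` on one-forms is exact in positive differential degree. -/
theorem HamCoframe.exists_formLie_eq (h : HamCoframe P ζ) (hP : P ∈ functionalDeg U 2 1)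
    {c : Fin n → ℝ} (hU : StarConvex ℝ c (U : Set (Fin n → ℝ))) {p d : ℤ} (hd : 0 < d)
    {w : JetForm U} (hw : w ∈ formDeg U p d) (h0 : formLie U P w = 0) :
    ∃ v ∈ formDeg U (p - 1) (d - 1), formLie U P v = w := by
  classical
  obtain ⟨a, b, rfl⟩ := h.exists_coframeForm w
  have hb : ∀ j, b j ∈ polyDeg U (p - 1) (d - j.2) := h.reflects_degree fun k => by
    rw [← h.coframeForm_snd a]; exact (hw k).2
  have hsucc : ∀ (v : JetIdx n →₀ DiffPoly U) j, Finsupp.mapDomain shift v (shift j) = v j :=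
    fun v j => Finsupp.mapDomain_apply shift_injective v j
  have hbot : ∀ (v : JetIdx n →₀ DiffPoly U) i, Finsupp.mapDomain shift v (i, 0) = 0 :=
    fun v i => Finsupp.mapDomain_of_notMem_range v _ fun ⟨k, hk⟩ => by
      simpa [shift] using (Prod.ext_iff.1 hk).2
  rw [h.formLie_coframeForm hP] at h0
  have hz := h.injective ((h.coframeForm_snd _ _).symm.trans ((congrArg Prod.snd h0).trans
    (map_zero (coframeMap ζ)).symm))
  have hz1 : ∀ j, hamD P (b (shift j)) + parity U (a j) = 0 := fun j => by
    have := DFunLike.congr_fun hz (shift j)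
    rw [Finsupp.add_apply, Finsupp.lmapDomain_apply, hsucc] at this
    exact this
  have hz0 : ∀ i, hamD P (b (i, 0)) = 0 := fun i => by
    have := DFunLike.congr_fun hz (i, 0)
    rw [Finsupp.add_apply, Finsupp.lmapDomain_apply, hbot, add_zero] at this
    exact this
  -- The coefficients of δζ_{i,0} have the full x-degree d, so positivity of d makes the exactness
  -- of D_P available for them.
  choose f hf hfb using fun i => h.exists_hamD_eq hP hU hd
    (by simpa using hb (i, 0)) (hz0 i)
  -- The primitive puts the coefficient of δζ_{i,s+1} onto δu^{i,s}, up to the sign that the Lie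
  -- derivative undoes, and keeps among the δζ only the D_P-primitives f at level zero.
  set a' : JetIdx n →₀ DiffPoly U := Finsupp.mapRange.linearMap (parity U).toLinearMap
    (Finsupp.comapDomain shift b shift_injective.injOn) with ha'
  set b' : JetIdx n →₀ DiffPoly U := ∑ i, Finsupp.single (i, 0) (f i) with hb'
  have ha'_apply : ∀ j, a' j = parity U (b (shift j)) := fun j => rfl
  have hb'_zero : ∀ i, b' (i, 0) = f i := fun i => by
    rw [hb', Finsupp.finsetSum_apply, Finset.sum_eq_single i]
    · rw [Finsupp.single_eq_same]
    · intro k _ hk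
      exact Finsupp.single_eq_of_ne fun h => hk (Prod.ext_iff.1 h).1.symm
    · simp
  have hb'_succ : ∀ j, b' (shift j) = 0 := fun j => by
    rw [hb', Finsupp.finsetSum_apply]
    refine Finset.sum_eq_zero fun k _ => Finsupp.single_eq_of_ne fun h => ?_
    exact absurd (Prod.ext_iff.1 h).2 (by simp [shift])
  refine ⟨coframeForm ζ a' b', coframeForm_mem h.mem (fun j => ?_) (fun j => ?_), ?_⟩
  · rw [ha'_apply]
    convert parity_mem (hb (shift j)) using 1
    simp only [shift]
    push_cast
    congr 1
    ring
  · obtain ⟨i, _ | s⟩ := j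
    · rw [hb'_zero]
      convert hf i using 1
      simp
    · rw [show ((i, s + 1) : JetIdx n) = shift (i, s) from rfl, hb'_succ]
      exact zero_mem _
  · rw [h.formLie_coframeForm hP]
    congr 1
    · ext j
      change hamD P (a' j) = a j
      rw [ha'_apply]
      -- D_P is odd and anticommutes with `parity`. Combined with the cocycle relation `hz1`, this
      -- shows that the choice of a' also reproduces a.
      have h1 : parity U (hamD P (b (shift j))) = -hamD P (parity U (b (shift j))) :=
        parity_vectorField_odd (parity_prolong_varTh hP) (parity_prolong_varU hP) _
      rw [eq_neg_of_add_eq_zero_left (hz1 j), map_neg, parity_parity, neg_inj] at h1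
      exact h1.symm
    · ext j
      rw [Finsupp.add_apply, Finsupp.lmapDomain_apply]
      obtain ⟨i, _ | s⟩ := j
      · rw [hbot, add_zero]
        change hamD P (b' (i, 0)) = _
        rw [hb'_zero, hfb]
      · rw [show ((i, s + 1) : JetIdx n) = shift (i, s) from rfl, hsucc]
        change hamD P (b' (shift (i, s))) + parity U (a' (i, s)) = _
        rw [hb'_succ, map_zero, zero_add, ha'_apply, parity_parity]

theorem subsingleton_cohomology {V : Type*} [AddCommGroup V] [Module ℝ V] {G : Submodule ℝ V}
    {D : V →ₗ[ℝ] V} (h : ∀ x ∈ G, D x = 0 → x ∈ LinearMap.range D) :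
    Subsingleton (Cohomology G D) := by
  rw [Submodule.Quotient.subsingleton_iff, Submodule.submoduleOf_eq_top]
  exact fun x hx => ⟨hx.1, h x hx.1 (LinearMap.mem_ker.1 hx.2)⟩

end FormExactness

end VarHam
end

/-! ### The two vanishing theorems. -/

theorem mainTheorem3 {n : ℕ} (U : TopologicalSpace.Opens (Fin n → ℝ)) (x₀ : Fin n → ℝ)
    (hx₀ : x₀ ∈ U) (hU : StarConvex ℝ x₀ (U : Set (Fin n → ℝ)))
    (P : VarHam.LocalFunctional U) (hP : VarHam.IsHydroHamiltonian U P)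
    (p d : ℤ) (hp : 0 < p) (hd : 0 < d) :
    Subsingleton (VarHam.Cohomology (VarHam.formDeg U p d) (VarHam.formLie U P)) ∧
      Subsingleton (VarHam.Cohomology (VarHam.varFormDeg U p d) (VarHam.varFormLie U P)) := by
  obtain ⟨ζ, hζ⟩ := hP.exists_coframe hU hx₀
  refine ⟨VarHam.subsingleton_cohomology fun w hw h0 => ?_,
    VarHam.subsingleton_cohomology ?_⟩
  · obtain ⟨v, -, hv⟩ := hζ.exists_formLie_eq hP.mem hU hd hw h0
    exact ⟨v, hv⟩
  · rintro _ ⟨w, hw, rfl⟩ h0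
    -- A variational cocycle lifts to a form w whose Lie derivative is ∂_x v. This is the connecting
    -- map of the long exact sequence.
    obtain ⟨v, hv⟩ := (Submodule.Quotient.mk_eq_zero _).1 h0
    have hvm : v ∈ VarHam.formDeg U (p + 1) d :=
      VarHam.mem_formDeg_of_formD (hv ▸ VarHam.formLie_mem hP.mem hw)
    -- The Lie derivative squares to zero and commutes with ∂_x, which is injective; hence v is
    -- itself a cocycle.
    have hv0 : VarHam.formLie U P v = 0 := by
      refine VarHam.formD_injective ?_
      rw [← VarHam.formLie_formD, hv, VarHam.formLie_formLie hP.mem hP.schouten_eq_zero, map_zero]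
    obtain ⟨v', hv'm, hv'⟩ := hζ.exists_formLie_eq hP.mem hU hd hvm hv0
    -- Subtracting ∂_x v', where v' is a primitive of v, leaves the class of w unchanged and gives a
    -- genuine cocycle in degree (p, d), to which the first half applies.
    have hm : w - VarHam.formD U v' ∈ VarHam.formDeg U p d := by
      have := VarHam.formD_mem hv'm
      rw [add_sub_cancel_right, sub_add_cancel] at this
      exact sub_mem hw this
    have h1 : VarHam.formLie U P (w - VarHam.formD U v') = 0 := by
      rw [map_sub, VarHam.formLie_formD, hv', hv, sub_self]
    obtain ⟨y, -, hy⟩ := hζ.exists_formLie_eq hP.mem hU hd hm h1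
    refine ⟨(LinearMap.range (VarHam.formD U)).mkQ y, ?_⟩
    refine (congrArg (LinearMap.range (VarHam.formD U)).mkQ hy).trans ?_
    rw [map_sub, sub_eq_self]
    exact (Submodule.Quotient.mk_eq_zero _).2 ⟨v', rfl⟩
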